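/- **Theorem (Flexible quantum signal processing).** Let $n,d,N$ be integers with $d\ge 1$ and $N\ge 1$. A matrix $H\in\mathbb C^{n\times n}$ is encoded in *standard form* $(H,\alpha,U,d)$ if $U$ is a unitary on $\mathbb C^d\otimes\mathbb C^n$, $\alpha>0$, $\alpha\ge\|H\|$ (spectral norm) and $(\langle 0|\otimes I)\,U\,(|0\rangle\otimes I)=H/\alpha$; the standard form is *Hermitian* if $H$ is Hermitian. Let $(H,1,U,d)$ be a Hermitian standard form and let $B(x)=\sum_{j=0}^N b_jx^j$ be a real polynomial of degree at most $N$ such that (1) $B(-x)=(-1)^N B(x)$; (2) $B(0)=0$; (3) $B(x)^2\le 1$ for all $x\in[-1,1]$. Then there is a Hermitian standard form $(B[H],1,V,4d)$, where $B[H]=\sum_{j=0}^N b_jH^j$, and $V$ is implemented exactly by a quantum circuit with $O(N)$ queries to controlled-$U$ and its inverse and $O(N\log(2d))$ primitive gates (for $d\ge2$ this is $O(N\log d)$), with absolute implied constants. The primitive gates are Hadamard, $T$, controlled-NOT, and phase shifts $\mathrm{diag}(1,e^{i\varphi})$. The layout of the circuit depends on $N$ and $d$ only. The angles $\varphi$ depend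 on $B$ (and $N$) only, and one classical algorithm computes them from $N,b_0,\dots,b_N$ in time polynomial in $N$. Conventions. The circuit acts on the system, on two additional ancilla qubits, and on $\lceil\log_2 d\rceil$ qubits that hold the given ancilla register, its basis states $|0\rangle,\dots,|d-1\rangle$ being written in binary; a query acts trivially on the unused labels $\ge d$, and the circuit maps $\mathbb C^{4d}\otimes\mathbb C^n$ to itself and acts there as $V$. Classical time is counted in exact real arithmetic: an operation on integer registers (addition, subtraction), an operation on real numbers ($+,-,\times,\div,\sqrt{\ },\arccos$), a comparison and an access to memory cost $O(1)$, and producing the list of complex roots of a polynomial with $k+1$ given real coefficients costs $k+1$. -/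

import Mathlib

namespace FlexQSP

noncomputable section

/-! ## Encoded matrices -/

section Encoding

open scoped Matrix.Norms.L2Operator

/-- `(H, α, U, d)` is in standard form: the ancilla register has dimension `d`, the signal unitary
`U` acts on ancilla and system, the normalization satisfies `α ≥ ‖H‖` (spectral norm), and
`(⟨0|ₐ ⊗ I) U (|0⟩ₐ ⊗ I) = H / α`. -/
structure StandardForm {n : ℕ} (H : Matrix (Fin n) (Fin n) ℂ) (α : ℝ) {d : ℕ} [NeZero d]
    (U : Matrix (Fin d × Fin n) (Fin d × Fin n) ℂ) : Prop where
  normalization_pos : 0 < α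
  norm_le : ‖H‖ ≤ α
  unitary : U ∈ Matrix.unitaryGroup (Fin d × Fin n) ℂ
  block : ∀ i j : Fin n, U (0, i) (0, j) = H i j / (α : ℂ)

/-- A standard form whose encoded matrix is Hermitian. -/
structure HermitianStandardForm {n : ℕ} (H : Matrix (Fin n) (Fin n) ℂ) (α : ℝ) {d : ℕ} [NeZero d]
    (U : Matrix (Fin d × Fin n) (Fin d × Fin n) ℂ) : Prop extends StandardForm H α U where
  hermitian : H.IsHermitian

end Encoding

/-! ## Quantum circuits with oracle queries

The ancilla register of dimension `d` is held by `m = ⌈log₂ d⌉` qubits (the summand `Fin m`), and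
there are two more ancilla qubits (the summand `Fin 2`). The system register, of any dimension `n`,
is touched by the queries only. -/

/-- The qubits of a circuit. -/
abbrev Qubit (m : ℕ) : Type := Fin 2 ⊕ Fin m

/-- Computational basis states of all ancilla qubits. -/
abbrev QBasis (m : ℕ) : Type := Qubit m → Fin 2

/-- The binary label of the basis state `|k⟩`, `k < d`, of a register of dimension `d`. -/
def label (d : ℕ) (k : Fin d) : Fin (Nat.clog 2 d) → Fin 2 :=
  finFunctionFinEquiv.symm (Fin.castLE (Nat.le_pow_clog one_lt_two d) k)

/-- The label of a basis state of a register of dimension `4 * d = 2 * 2 * d`: the number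
`x * d + y` with `x < 4` and `y < d` is held by the two extra qubits (`x` in binary) and by the
other qubits (`y` in binary). -/
def label4 (d : ℕ) (k : Fin (4 * d)) : QBasis (Nat.clog 2 d) :=
  Sum.elim (finFunctionFinEquiv.symm (Fin.cast (by norm_num) (finProdFinEquiv.symm k).1))
    (label d (finProdFinEquiv.symm k).2)

/-- The matrix of the linear map `|y⟩ |j⟩ ↦ |f y⟩ |j⟩`. -/
def embedding {X Y : Type} [DecidableEq X] (n : ℕ) (f : Y → X) :
    Matrix (X × Fin n) (Y × Fin n) ℂ :=
  fun x y => if x = (f y.1, y.2) then 1 else 0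

/-- The operator `U` on a register of dimension `d` and the system, as an operator on `⌈log₂ d⌉`
qubits and the system: it is `U` on the span of the labels of `0, …, d - 1`, and the identity on
the orthogonal complement (which is zero if `d` is a power of two). -/
def extend {n d : ℕ} (U : Matrix (Fin d × Fin n) (Fin d × Fin n) ℂ) :
    Matrix ((Fin (Nat.clog 2 d) → Fin 2) × Fin n) ((Fin (Nat.clog 2 d) → Fin 2) × Fin n) ℂ :=
  embedding n (label d) * U * (embedding n (label d)).conjTranspose
    + (1 - embedding n (label d) * (embedding n (label d)).conjTranspose)

/-- Instructions of a circuit: the primitive gates Hadamard, `T`, controlled-NOT and phase shift,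
the latter by the `i`-th entry of a list of precomputed angles, and the query to controlled-`U` or,
if `inverse` is `true`, to its inverse; one of the two extra qubits controls the query. -/
inductive Instr (m : ℕ) : Type
  | hadamard (q : Qubit m) : Instr m
  | tGate (q : Qubit m) : Instr m
  | cnot (control target : Qubit m) (ne : control ≠ target) : Instr m
  | phase (q : Qubit m) (i : ℕ) : Instr m
  | query (control : Fin 2) (inverse : Bool) : Instr m

/-- A circuit is a list of instructions, the first of which is carried out first. -/
abbrev Circuit (m : ℕ) : Type := List (Instr m)

/-- Is the instruction a query? -/
def Instr.isQuery {m : ℕ} : Instr m → Bool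
  | .query _ _ => true
  | _ => false

/-- The number of queries to controlled-`U` and its inverse. -/
def Circuit.queries {m : ℕ} (K : Circuit m) : ℕ := K.countP fun g => g.isQuery

/-- The number of primitive gates. -/
def Circuit.gates {m : ℕ} (K : Circuit m) : ℕ := K.countP fun g => !g.isQuery

/-- The Hadamard gate. -/
def hadamardMatrix : Matrix (Fin 2) (Fin 2) ℂ :=
  ((Real.sqrt 2)⁻¹ : ℂ) • !![1, 1; 1, -1]

/-- The phase shift `diag (1, exp (i θ))`. -/
def phaseMatrix (θ : ℝ) : Matrix (Fin 2) (Fin 2) ℂ :=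
  !![1, 0; 0, Complex.exp (θ * Complex.I)]

/-- The one-qubit operator `M` on the qubit `q`. -/
def onQubit {m n : ℕ} (q : Qubit m) (M : Matrix (Fin 2) (Fin 2) ℂ) :
    Matrix (QBasis m × Fin n) (QBasis m × Fin n) ℂ :=
  fun x y => if x.2 = y.2 ∧ ∀ r, r ≠ q → x.1 r = y.1 r then M (x.1 q) (y.1 q) else 0

/-- Controlled-NOT: adds the bit of `control` to the bit of `target`, modulo two. -/
def cnotMatrix {m n : ℕ} (control target : Qubit m) :
    Matrix (QBasis m × Fin n) (QBasis m × Fin n) ℂ :=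
  fun x y =>
    if x = (Function.update y.1 target (y.1 target + y.1 control), y.2) then 1 else 0

/-- The operator `M` on `m` qubits and the system, controlled by an extra qubit. -/
def controlledMatrix {m n : ℕ} (control : Fin 2)
    (M : Matrix ((Fin m → Fin 2) × Fin n) ((Fin m → Fin 2) × Fin n) ℂ) :
    Matrix (QBasis m × Fin n) (QBasis m × Fin n) ℂ :=
  fun x y =>
    if x.1 ∘ Sum.inl = y.1 ∘ Sum.inl then
      if y.1 (Sum.inl control) = 1 then M (x.1 ∘ Sum.inr, x.2) (y.1 ∘ Sum.inr, y.2)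
      else if x = y then 1 else 0
    else 0

/-- The operator of one instruction, for the precomputed angles `φ` and the oracle `U`. -/
def Instr.toMatrix {n d : ℕ} (φ : ℕ → ℝ) (U : Matrix (Fin d × Fin n) (Fin d × Fin n) ℂ) :
    Instr (Nat.clog 2 d) →
      Matrix (QBasis (Nat.clog 2 d) × Fin n) (QBasis (Nat.clog 2 d) × Fin n) ℂ
  | .hadamard q => onQubit q hadamardMatrix
  | .tGate q => onQubit q (phaseMatrix (Real.pi / 4))
  | .cnot c t _ => cnotMatrix c t
  | .phase q i => onQubit q (phaseMatrix (φ i))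
  | .query c false => controlledMatrix c (extend U)
  | .query c true => controlledMatrix c (extend U.conjTranspose)

/-- The operator of a circuit. -/
def Circuit.toMatrix {n d : ℕ} (φ : ℕ → ℝ) (U : Matrix (Fin d × Fin n) (Fin d × Fin n) ℂ) :
    Circuit (Nat.clog 2 d) →
      Matrix (QBasis (Nat.clog 2 d) × Fin n) (QBasis (Nat.clog 2 d) × Fin n) ℂ
  | [] => 1
  | g :: K => Circuit.toMatrix φ U K * g.toMatrix φ U

/-- The circuit maps the subspace `ℂ^(4d) ⊗ ℂ^n` of its state space to itself, and acts there
as `V`. -/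
def Circuit.Implements {n d : ℕ} (K : Circuit (Nat.clog 2 d)) (φ : ℕ → ℝ)
    (U : Matrix (Fin d × Fin n) (Fin d × Fin n) ℂ)
    (V : Matrix (Fin (4 * d) × Fin n) (Fin (4 * d) × Fin n) ℂ) : Prop :=
  Circuit.toMatrix φ U K * embedding n (label4 d) = embedding n (label4 d) * V

/-! ## Classical computation with real numbers

A while language over natural-number registers and arrays of real numbers (an exact real RAM), with
a count of the elementary steps. -/

/-- The memory: natural-number registers, and real arrays (first argument the array, second the
position). -/
structure Mem : Type where
  nat : ℕ → ℕ
  arr : ℕ → ℕ → ℝ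

/-- Natural-number expressions (with truncated subtraction). -/
inductive NExp : Type
  | lit (k : ℕ) : NExp
  | reg (x : ℕ) : NExp
  | add (e f : NExp) : NExp
  | sub (e f : NExp) : NExp

/-- The value of a natural-number expression. -/
def NExp.eval (s : Mem) : NExp → ℕ
  | .lit k => k
  | .reg x => s.nat x
  | .add e f => e.eval s + f.eval s
  | .sub e f => e.eval s - f.eval s

/-- Real expressions. -/
inductive RExp : Type
  | lit (k : ℕ) : RExp
  | read (a : ℕ) (i : NExp) : RExp
  | add (e f : RExp) : RExp
  | sub (e f : RExp) : RExp
  | mul (e f : RExp) : RExp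
  | div (e f : RExp) : RExp
  | sqrt (e : RExp) : RExp
  | arccos (e : RExp) : RExp

/-- The value of a real expression. -/
def RExp.eval (s : Mem) : RExp → ℝ
  | .lit k => k
  | .read a i => s.arr a (i.eval s)
  | .add e f => e.eval s + f.eval s
  | .sub e f => e.eval s - f.eval s
  | .mul e f => e.eval s * f.eval s
  | .div e f => e.eval s / f.eval s
  | .sqrt e => Real.sqrt (e.eval s)
  | .arccos e => Real.arccos (e.eval s)

/-- Tests. -/
inductive Test : Type
  | natLt (e f : NExp) : Test
  | realLt (e f : RExp) : Test

/-- The truth value of a test. -/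
def Test.Holds (s : Mem) : Test → Prop
  | .natLt e f => e.eval s < f.eval s
  | .realLt e f => e.eval s < f.eval s

/-- The complex roots of `∑_{i ≤ k} c i * X ^ i`, with multiplicity, as pairs (real part, imaginary
part) in lexicographic order; the list is empty for the zero polynomial. -/
def rootList (c : ℕ → ℝ) (k : ℕ) : List (ℝ ×ₗ ℝ) :=
  ((∑ i ∈ Finset.range (k + 1), Polynomial.monomial i (c i : ℂ)).roots.map
    fun z => toLex (z.re, z.im)).sort (· ≤ ·)

/-- Programs. `roots a k b c` takes the entries `0, …, k` of the array `a` as the coefficients of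
a polynomial, and writes the real and the imaginary parts of its complex roots to the initial
positions of the arrays `b` and `c`. -/
inductive Program : Type
  | skip : Program
  | setNat (x : ℕ) (e : NExp) : Program
  | setReal (a : ℕ) (i : NExp) (e : RExp) : Program
  | roots (a : ℕ) (k : NExp) (b c : ℕ) : Program
  | seq (P Q : Program) : Program
  | ite (t : Test) (P Q : Program) : Program
  | loop (t : Test) (P : Program) : Program

/-- Write to a natural-number register. -/
def Mem.setNat (s : Mem) (x v : ℕ) : Mem :=
  { s with nat := Function.update s.nat x v }

/-- Write to a position of an array. -/
def Mem.setReal (s : Mem) (a i : ℕ) (v : ℝ) : Mem :=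
  { s with arr := Function.update s.arr a (Function.update (s.arr a) i v) }

/-- Write a list to the initial positions of an array. -/
def Mem.setList (s : Mem) (a : ℕ) (l : List ℝ) : Mem :=
  { s with arr := Function.update s.arr a fun i => l.getD i (s.arr a i) }

/-- `Exec P s t s'`: started in the memory `s`, the program `P` halts after `t` steps in the memory
`s'`. Every assignment and every test is one step; finding the roots of a polynomial with `k + 1`
coefficients is `k + 1` steps. -/
inductive Exec : Program → Mem → ℕ → Mem → Prop
  | skip (s : Mem) : Exec .skip s 1 s
  | setNat (s : Mem) (x : ℕ) (e : NExp) : Exec (.setNat x e) s 1 (s.setNat x (e.eval s))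
  | setReal (s : Mem) (a : ℕ) (i : NExp) (e : RExp) :
      Exec (.setReal a i e) s 1 (s.setReal a (i.eval s) (e.eval s))
  | roots (s : Mem) (a : ℕ) (k : NExp) (b c : ℕ) :
      Exec (.roots a k b c) s (k.eval s + 1)
        ((s.setList b ((rootList (s.arr a) (k.eval s)).map fun z => (ofLex z).1)).setList c
          ((rootList (s.arr a) (k.eval s)).map fun z => (ofLex z).2))
  | seq {P Q : Program} {s s' s'' : Mem} {t t' : ℕ} (hP : Exec P s t s') (hQ : Exec Q s' t' s'') :
      Exec (.seq P Q) s (t + t') s''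
  | iteTrue {b : Test} {P Q : Program} {s s' : Mem} {t : ℕ} (hb : b.Holds s) (hP : Exec P s t s') :
      Exec (.ite b P Q) s (t + 1) s'
  | iteFalse {b : Test} {P Q : Program} {s s' : Mem} {t : ℕ} (hb : ¬ b.Holds s)
      (hQ : Exec Q s t s') : Exec (.ite b P Q) s (t + 1) s'
  | loopFalse {b : Test} {P : Program} {s : Mem} (hb : ¬ b.Holds s) : Exec (.loop b P) s 1 s
  | loopTrue {b : Test} {P : Program} {s s' s'' : Mem} {t t' : ℕ} (hb : b.Holds s)
      (hP : Exec P s t s') (hL : Exec (.loop b P) s' t' s'') : Exec (.loop b P) s (t + t' + 1) s''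

/-- The input: the degree bound in register `0`, the coefficients in array `0`; everything else
is `0`. -/
def input (N : ℕ) (B : Polynomial ℝ) : Mem where
  nat x := if x = 0 then N else 0
  arr a i := if a = 0 then B.coeff i else 0

/-- The output: array `1`. -/
def Mem.output (s : Mem) : ℕ → ℝ := s.arr 1

end

/-! ## Target functions -/

/-- `B` is a real polynomial of degree at most `N` and of parity `N` modulo two, with `B 0 = 0` and
`B² ≤ 1` on `[-1, 1]`. -/
structure Admissible (N : ℕ) (B : Polynomial ℝ) : Prop where
  degree : B.natDegree ≤ N
  parity : ∀ x : ℝ, B.eval (-x) = (-1) ^ N * B.eval x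
  zero : B.eval 0 = 0
  bound : ∀ x ∈ Set.Icc (-1 : ℝ) 1, B.eval x ^ 2 ≤ 1

end FlexQSP

namespace FlexQSP

noncomputable section

/-! ## Circuits that act as permutations or diagonal matrices -/

/-! The circuit alternates queries with diagonal phases that distinguish the ancilla state `|0⟩`
from its complement. Write `J` for the isometry `ψ ↦ |0⟩ψ` and `R_Q = QJ - JH`. If `U` and `U†`
alternate, both have the block `H` because `H` is Hermitian, and `Q J = J H + R_Q`, `Q R_{Q†} = J (1
- H²) - R_Q H`. Hence the whole product sends `J` to `J p(H) + R q(H)` with polynomials given by the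
recursion `signalPoly`, and its block is `p(H)` (`alternatingOp_mul_zeroIsometry`). Neither a
spectral decomposition of `H` nor `U² = 1` is needed.

A flag qubit runs this product in two versions, with opposite angles and with factors `-i` and `i`
per query; the two Hadamard gates on the flag average the two blocks. Substituting `x = (z + 1/z)/2`
turns `p` into a combination of two real polynomials `v`, `w` in `z²` (`phasePoly`,
`signalPoly_eval`). In the average `w` cancels, so `B[H]` is encoded as soon as `v(z²) = z^N B((z +
1/z)/2)` (`signalPoly_add_eq`). Parity of `B` is what makes such a `v` exist (`isLift_hornerLift`).

It remains to find angles that produce this `v`. The reachable pairs `(v, w)` include every pair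
with `v v* + w w* = X^N`, where `*` reverses the coefficients: the angles are peeled off one at a
time, each choice lowering the degree by one (`NormOne.peel`, `phasePoly_angleSeq`). As `v* = v`,
the partner `w` must satisfy `w w* = X^N - v²`. On the unit circle the right side is `1 - B(cos θ)²
≥ 0` up to a phase, so Fejér–Riesz factorization applies: the roots are symmetric under inversion
and conjugation, those on the circle have even multiplicity, and `w` takes the roots inside the disc
and half of those on the circle (`exists_spectral_factor`). The condition `B(0) = 0` gives `v(-1) =
0`; this excludes a vanishing `X^N - v²` and fixes the scale of `w` through its value at `-1`.

Two further ingredients give the complexity bounds. The test whether the register is `|0⟩` costs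
linearly many gates in the number of qubits, without clean workspace: a negation with many controls
is built from Toffoli ladders on borrowed qubits (`ladderFun_apply`, `halfNots_twice`). The angles
are computed by an explicit program, verified in a Hoare-style calculus with time bounds (`Halts`,
`halts_anglesProgram`). -/

theorem Circuit.toMatrix_append {n d : ℕ} (φ : ℕ → ℝ)
    (U : Matrix (Fin d × Fin n) (Fin d × Fin n) ℂ) (K L : Circuit (Nat.clog 2 d)) :
    Circuit.toMatrix φ U (K ++ L) = Circuit.toMatrix φ U L * Circuit.toMatrix φ U K := by
  induction K with
  | nil => simp [Circuit.toMatrix]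
  | cons g K ih => simp [Circuit.toMatrix, ih, Matrix.mul_assoc]

theorem embedding_comp {X Y Z : Type} [DecidableEq X] [DecidableEq Y] [Fintype Y] (n : ℕ)
    (f : Y → X) (g : Z → Y) : embedding n (f ∘ g) = embedding n f * embedding n g := by
  ext x z
  simp only [embedding, Matrix.mul_apply, Function.comp]
  rw [Finset.sum_eq_single (g z.1, z.2)]
  · simp
  · intro b _ hb; simp [hb]
  · simp

theorem embedding_id {X : Type} [DecidableEq X] (n : ℕ) :
    embedding n (id : X → X) = 1 := by
  ext x z
  simp [embedding, Matrix.one_apply]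

/-- The circuit maps `|y⟩` to `|g y⟩`, and leaves the system alone. -/
def Permutes {d : ℕ} (K : Circuit (Nat.clog 2 d))
    (g : QBasis (Nat.clog 2 d) → QBasis (Nat.clog 2 d)) : Prop :=
  ∀ ⦃n : ℕ⦄ (φ : ℕ → ℝ) (U : Matrix (Fin d × Fin n) (Fin d × Fin n) ℂ),
    Circuit.toMatrix φ U K = embedding n g

/-- For the given angles, the circuit multiplies `|y⟩` by `δ y`. -/
def ActsDiagonally {d : ℕ} (φ : ℕ → ℝ) (K : Circuit (Nat.clog 2 d))
    (δ : QBasis (Nat.clog 2 d) → ℂ) : Prop :=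
  ∀ ⦃n : ℕ⦄ (U : Matrix (Fin d × Fin n) (Fin d × Fin n) ℂ),
    Circuit.toMatrix φ U K = Matrix.diagonal fun x => δ x.1

section

variable {d : ℕ} {K L : Circuit (Nat.clog 2 d)}
  {g h : QBasis (Nat.clog 2 d) → QBasis (Nat.clog 2 d)} {φ : ℕ → ℝ}
  {δ ε : QBasis (Nat.clog 2 d) → ℂ}

theorem Permutes.append (hK : Permutes K g) (hL : Permutes L h) : Permutes (K ++ L) (h ∘ g) := by
  intro n φ U
  rw [Circuit.toMatrix_append, hK, hL, embedding_comp]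

theorem Permutes.congr (hK : Permutes K g) (hgh : ∀ y, g y = h y) : Permutes K h :=
  (funext hgh : g = h) ▸ hK

theorem ActsDiagonally.congr (hK : ActsDiagonally φ K δ) (h : ∀ y, δ y = ε y) :
    ActsDiagonally φ K ε :=
  (funext h : δ = ε) ▸ hK

theorem permutes_nil : Permutes ([] : Circuit (Nat.clog 2 d)) id := by
  intro n φ U
  rw [embedding_id]; rfl

theorem ActsDiagonally.append (hK : ActsDiagonally φ K δ) (hL : ActsDiagonally φ L ε) :
    ActsDiagonally φ (K ++ L) (fun y => δ y * ε y) := by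
  intro n U
  rw [Circuit.toMatrix_append, hK, hL, Matrix.diagonal_mul_diagonal]
  simp [mul_comm]

/-- Compute, apply the phase, uncompute: moving a diagonal matrix past the permutation replaces `δ`
by `δ ∘ g`, and the two copies of the permutation cancel. -/
theorem ActsDiagonally.conj (hK : ActsDiagonally φ K δ) (hL : Permutes L g)
    (hg : Function.Involutive g) : ActsDiagonally φ (L ++ K ++ L) (δ ∘ g) := by
  intro n U
  have h1 : Matrix.diagonal (fun x : QBasis (Nat.clog 2 d) × Fin n => δ x.1) * embedding n g
      = embedding n g * Matrix.diagonal (fun x : QBasis (Nat.clog 2 d) × Fin n => (δ ∘ g) x.1) := by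
    ext x y
    simp only [Matrix.diagonal_mul, Matrix.mul_diagonal, embedding, Function.comp]
    split_ifs with hx
    · simp [hx]
    · simp
  rw [Circuit.toMatrix_append, Circuit.toMatrix_append, hK, hL, h1, ← Matrix.mul_assoc,
    ← embedding_comp, hg.comp_self, embedding_id, Matrix.one_mul]

/-! ### One-qubit operators, and the Toffoli gate from the primitive gates -/

theorem onQubit_mul_apply {m n : ℕ} (q : Qubit m) (A : Matrix (Fin 2) (Fin 2) ℂ)
    (M : Matrix (QBasis m × Fin n) (QBasis m × Fin n) ℂ) (x y : QBasis m × Fin n) :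
    (onQubit q A * M : Matrix (QBasis m × Fin n) (QBasis m × Fin n) ℂ) x y = ∑ b, A (x.1 q) b * M (Function.update x.1 q b, x.2) y := by
  rw [Matrix.mul_apply]
  have hinj : Function.Injective fun b : Fin 2 => (Function.update x.1 q b, x.2) := by
    intro b c hbc
    simpa using congrFun (congrArg Prod.fst hbc) q
  rw [← Finset.sum_subset (Finset.subset_univ (Finset.univ.image fun b : Fin 2 =>
    (Function.update x.1 q b, x.2))), Finset.sum_image (fun a _ b _ h => hinj h)]
  · refine Finset.sum_congr rfl fun b _ => ?_
    have h : ∀ r, r ≠ q → x.1 r = Function.update x.1 q b r := fun r hr => by simp [hr]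
    rw [onQubit, if_pos ⟨rfl, h⟩]
    simp only [Function.update_self]
  · intro z _ hz
    have : ¬ (x.2 = z.2 ∧ ∀ r, r ≠ q → x.1 r = z.1 r) := by
      rintro ⟨h1, h2⟩
      apply hz
      simp only [Finset.mem_image, Finset.mem_univ, true_and]
      refine ⟨z.1 q, Prod.ext ?_ h1⟩
      funext r
      by_cases hr : r = q
      · subst hr; simp
      · simp [hr, h2 r hr]
    simp only [onQubit, if_neg this, zero_mul]

theorem onQubit_mul {m n : ℕ} (q : Qubit m) (A B : Matrix (Fin 2) (Fin 2) ℂ) :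
    (onQubit q (A * B) : Matrix (QBasis m × Fin n) _ ℂ) = onQubit q A * onQubit q B := by
  ext x y
  rw [onQubit_mul_apply]
  have h : ∀ b, (∀ r, r ≠ q → Function.update x.1 q b r = y.1 r) ↔ ∀ r, r ≠ q → x.1 r = y.1 r :=
    fun b => forall₂_congr fun r hr => by simp [hr]
  simp only [onQubit, h, Function.update_self, Matrix.mul_apply]
  split_ifs <;> simp

theorem onQubit_diagonal {m n : ℕ} (q : Qubit m) (a b : ℂ) :
    (onQubit q !![a, 0; 0, b] : Matrix (QBasis m × Fin n) _ ℂ)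
      = Matrix.diagonal fun x => if x.1 q = 0 then a else b := by
  ext x y
  by_cases hxy : x = y
  · subst hxy
    simp only [onQubit, Matrix.diagonal_apply_eq]
    generalize x.1 q = i
    fin_cases i <;> simp
  · rw [Matrix.diagonal_apply_ne _ hxy]
    simp only [onQubit]
    split_ifs with h
    · have hq : x.1 q ≠ y.1 q := by
        intro hq
        apply hxy
        refine Prod.ext (funext fun r => ?_) h.1
        by_cases hr : r = q
        · rw [hr, hq]
        · exact h.2 r hr
      revert hq
      generalize x.1 q = i
      generalize y.1 q = j
      intro hq
      fin_cases i <;> fin_cases j <;> simp at hq ⊢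
    · rfl

/-- Eight-th root of unity. -/
def omega : ℂ := Complex.exp ((Real.pi / 4 : ℝ) * Complex.I)

theorem omega_pow_four : omega ^ 4 = -1 := by
  rw [omega, ← Complex.exp_nat_mul, ← Complex.exp_pi_mul_I]
  congr 1; push_cast; ring

theorem omega_pow_two : omega ^ 2 = Complex.I := by
  refine Eq.trans ?_ Complex.exp_pi_div_two_mul_I
  rw [omega, ← Complex.exp_nat_mul]
  congr 1; push_cast; ring

/-- The diagonal gate `T ^ k`. -/
def tPow {m : ℕ} (q : Qubit m) (k : ℕ) : Circuit m := List.replicate k (.tGate q)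

theorem toMatrix_tPow {n : ℕ} (q : Qubit (Nat.clog 2 d)) (k : ℕ)
    (U : Matrix (Fin d × Fin n) (Fin d × Fin n) ℂ) :
    Circuit.toMatrix φ U (tPow q k) = onQubit q !![1, 0; 0, omega ^ k] := by
  induction k with
  | zero =>
    rw [onQubit_diagonal]
    simp [tPow, Circuit.toMatrix]
  | succ k ih =>
    have h : (tPow q (k + 1)) = .tGate q :: tPow q k := by simp [tPow, List.replicate_succ]
    rw [h, Circuit.toMatrix, ih, Instr.toMatrix, ← onQubit_mul]
    congr 1
    ext i j
    fin_cases i <;> fin_cases j <;> simp [phaseMatrix, omega, pow_succ]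

theorem actsDiagonally_tPow (q : Qubit (Nat.clog 2 d)) (k : ℕ) :
    ActsDiagonally φ (tPow q k) (fun y => if y q = 0 then 1 else omega ^ k) := by
  intro n U
  rw [toMatrix_tPow, onQubit_diagonal]

theorem sqrt_two_inv_mul : ((Real.sqrt 2 : ℂ))⁻¹ * ((Real.sqrt 2 : ℂ))⁻¹ = 1 / 2 := by
  rw [← mul_inv, ← Complex.ofReal_mul, Real.mul_self_sqrt (by norm_num)]
  norm_num

/-- Negation of a qubit. -/
def notGate {m : ℕ} (q : Qubit m) : Circuit m :=
  [.hadamard q] ++ tPow q 4 ++ [.hadamard q]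

/-- `T⁴` is the Pauli matrix `Z`, and conjugation by the Hadamard gate turns `Z` into `X`. -/
theorem permutes_notGate (q : Qubit (Nat.clog 2 d)) :
    Permutes (notGate q) fun y => Function.update y q (y q + 1) := by
  intro n φ U
  rw [notGate, Circuit.toMatrix_append, Circuit.toMatrix_append, toMatrix_tPow, omega_pow_four]
  simp only [Circuit.toMatrix, Matrix.one_mul, Instr.toMatrix]
  rw [← onQubit_mul, ← onQubit_mul]
  have hX : hadamardMatrix * (!![1, 0; 0, -1] * hadamardMatrix) = !![0, 1; 1, 0] := by
    ext i j
    fin_cases i <;> fin_cases j <;>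
      simp [hadamardMatrix, Matrix.mul_apply, sqrt_two_inv_mul] <;> norm_num
  rw [hX]
  ext x y
  simp only [onQubit, embedding]
  have h01 : ∀ i j : Fin 2, (!![0, 1; 1, 0] : Matrix (Fin 2) (Fin 2) ℂ) i j
      = if i = j + 1 then 1 else 0 := by
    intro i j; fin_cases i <;> fin_cases j <;> simp
  rw [h01, ← ite_and]
  refine if_congr ?_ rfl rfl
  rw [Prod.ext_iff, Function.eq_update_iff]
  tauto

/-- Controlled-NOT if the two qubits differ. -/
def cx {m : ℕ} (a b : Qubit m) : Circuit m := if h : a ≠ b then [.cnot a b h] else []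

theorem permutes_cx {a b : Qubit (Nat.clog 2 d)} (h : a ≠ b) :
    Permutes (cx a b) fun y => Function.update y b (y b + y a) := by
  intro n φ U
  rw [cx, dif_pos h]
  simp only [Circuit.toMatrix, Instr.toMatrix, Matrix.one_mul]
  rfl

theorem cx_involutive {m : ℕ} {a b : Qubit m} (h : a ≠ b) :
    Function.Involutive fun y : QBasis m => Function.update y b (y b + y a) := by
  intro y
  have : ∀ i j : Fin 2, i + j + j = i := by decide
  simp [h, this]

/-- The phase `-1` if all three qubits are set. -/
def ccz {m : ℕ} (a b c : Qubit m) : Circuit m :=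
  tPow a 1 ++ (tPow b 1 ++ (tPow c 1 ++ ((cx a b ++ tPow b 7 ++ cx a b) ++
    ((cx b c ++ tPow c 7 ++ cx b c) ++ ((cx a c ++ tPow c 7 ++ cx a c) ++
      (cx a c ++ (cx b c ++ tPow c 1 ++ cx b c) ++ cx a c))))))

/-- For bits, `4abc = a + b + c - (a⊕b) - (b⊕c) - (a⊕c) + (a⊕b⊕c)`. The circuit writes each of these
parities into a qubit, applies `T` or `T⁷ = T⁻¹` and restores the qubit; `ω⁴ = -1` gives the sign.
-/
theorem actsDiagonally_ccz {a b c : Qubit (Nat.clog 2 d)} (hab : a ≠ b) (hbc : b ≠ c)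
    (hac : a ≠ c) : ActsDiagonally φ (ccz a b c)
      (fun y => if y a = 1 ∧ y b = 1 ∧ y c = 1 then -1 else 1) := by
  have key := (actsDiagonally_tPow (φ := φ) a 1).append <| (actsDiagonally_tPow b 1).append <|
    (actsDiagonally_tPow c 1).append <|
    ((actsDiagonally_tPow b 7).conj (permutes_cx hab) (cx_involutive hab)).append <|
    ((actsDiagonally_tPow c 7).conj (permutes_cx hbc) (cx_involutive hbc)).append <|
    ((actsDiagonally_tPow c 7).conj (permutes_cx hac) (cx_involutive hac)).append <|
    ((actsDiagonally_tPow c 1).conj (permutes_cx hbc) (cx_involutive hbc)).conj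
      (permutes_cx hac) (cx_involutive hac)
  intro n U
  rw [ccz, key]
  congr 1
  funext x
  simp only [Function.comp, Function.update_self, Function.update_of_ne hbc]
  have h8 : omega ^ 8 = 1 := by
    rw [show 8 = 4 * 2 from rfl, pow_mul, omega_pow_four]; norm_num
  have h16 : omega * (omega * (omega ^ 7 * omega ^ 7)) = 1 := by
    calc _ = (omega ^ 8) ^ 2 := by ring
      _ = 1 := by rw [h8, one_pow]
  have h4 : omega * (omega * (omega * omega)) = -1 := by rw [← omega_pow_four]; ring
  have h16a : omega * (omega ^ 7 * (omega ^ 7 * omega)) = 1 := by rw [← h16]; ring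
  generalize x.1 a = i
  generalize x.1 b = j
  generalize x.1 c = k
  fin_cases i <;> fin_cases j <;> fin_cases k <;> simp [h16, h4, h16a]

/-- The Toffoli gate. -/
def toffoli {m : ℕ} (a b c : Qubit m) : Circuit m :=
  [.hadamard c] ++ ccz a b c ++ [.hadamard c]

/-- The action of the Toffoli gate on basis states. -/
def toffoliFun {m : ℕ} (a b c : Qubit m) (y : QBasis m) : QBasis m :=
  Function.update y c (y c + y a * y b)

/-- The two Hadamard gates on `c` turn the doubly controlled `Z` into a doubly controlled `X`. -/
theorem permutes_toffoli {a b c : Qubit (Nat.clog 2 d)} (hab : a ≠ b) (hbc : b ≠ c)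
    (hac : a ≠ c) : Permutes (toffoli a b c) (toffoliFun a b c) := by
  intro n φ U
  rw [toffoli, Circuit.toMatrix_append, Circuit.toMatrix_append, actsDiagonally_ccz hab hbc hac]
  simp only [Circuit.toMatrix, Matrix.one_mul, Instr.toMatrix]
  ext x y
  rw [onQubit_mul_apply]
  have h : ∀ b, (∀ r, r ≠ c → Function.update x.1 c b r = y.1 r) ↔ ∀ r, r ≠ c → x.1 r = y.1 r :=
    fun b => forall₂_congr fun r hr => by simp [hr]
  simp only [Matrix.diagonal_mul, Function.update_self, Function.update_of_ne hac,
    Function.update_of_ne hbc, onQubit, h, embedding, toffoliFun, Prod.ext_iff,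
    Function.eq_update_iff]
  by_cases hx : x.2 = y.2 ∧ ∀ r, r ≠ c → x.1 r = y.1 r
  · rw [← hx.2 a hac, ← hx.2 b hbc]
    simp only [hx.1, and_true]
    generalize x.1 a = i
    generalize x.1 b = j
    generalize x.1 c = k
    generalize y.1 c = l
    fin_cases i <;> fin_cases j <;> fin_cases k <;> fin_cases l <;>
      simp [hadamardMatrix, sqrt_two_inv_mul] <;> norm_num
  · have hx' : ¬ ((x.1 c = y.1 c + y.1 a * y.1 b ∧ ∀ r, r ≠ c → x.1 r = y.1 r) ∧ x.2 = y.2) := by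
      tauto
    simp only [if_neg hx, if_neg hx', mul_zero, Finset.sum_const_zero]

end

end

end FlexQSP

namespace FlexQSP

noncomputable section

/-! ## Multiply controlled negation with borrowed qubits -/

section

variable {m : ℕ}

/-- The product of the bits `c 0, …, c j`. -/
def controlProd (c : ℕ → Qubit m) (y : QBasis m) : ℕ → Fin 2
  | 0 => y (c 0)
  | j + 1 => y (c (j + 1)) * controlProd c y j

theorem controlProd_congr {c : ℕ → Qubit m} {y z : QBasis m} {j : ℕ}
    (h : ∀ l ≤ j, y (c l) = z (c l)) : controlProd c y j = controlProd c z j := by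
  induction j with
  | zero => exact h 0 le_rfl
  | succ j ih => rw [controlProd, controlProd, ih fun l hl => h l (by omega), h (j + 1) le_rfl]

theorem controlProd_eq (c : ℕ → Qubit m) (y : QBasis m) (j : ℕ) :
    controlProd c y j = if ∀ l < j + 1, y (c l) = 1 then 1 else 0 := by
  induction j with
  | zero =>
    simp only [controlProd, zero_add, Nat.lt_one_iff, forall_eq]
    generalize y (c 0) = i
    revert i; decide
  | succ j ih =>
    rw [controlProd, ih]
    simp only [Nat.forall_lt_succ_right (n := j + 1)]
    generalize y (c (j + 1)) = i
    by_cases h : ∀ l < j + 1, y (c l) = 1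
    · rw [if_pos h, if_congr (and_iff_right h) rfl rfl]
      revert i; decide
    · rw [if_neg h, if_neg (by tauto), mul_zero]

/-- A ladder of Toffoli gates: adds the product of the bits `c 0, …, c i` to the bit `a i`, for
`1 ≤ i ≤ j + 1`. -/
def ladder (c a : ℕ → Qubit m) : ℕ → Circuit m
  | 0 => toffoli (c 1) (c 0) (a 1)
  | j + 1 => toffoli (c (j + 2)) (a (j + 1)) (a (j + 2)) ++ ladder c a j ++
      toffoli (c (j + 2)) (a (j + 1)) (a (j + 2))

/-- The action of `ladder` on basis states. -/
def ladderFun (c a : ℕ → Qubit m) : ℕ → QBasis m → QBasis m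
  | 0 => toffoliFun (c 1) (c 0) (a 1)
  | j + 1 => toffoliFun (c (j + 2)) (a (j + 1)) (a (j + 2)) ∘ ladderFun c a j ∘
      toffoliFun (c (j + 2)) (a (j + 1)) (a (j + 2))

/-- The qubits of `ladder c a j` are in admissible positions. -/
structure LadderLayout (c a : ℕ → Qubit m) (j : ℕ) : Prop where
  first : c 1 ≠ c 0
  inj : ∀ i, 1 ≤ i → i ≤ j + 1 → ∀ k, 1 ≤ k → k ≤ j + 1 → a i = a k → i = k
  disj : ∀ l ≤ j + 1, ∀ i, 1 ≤ i → i ≤ j + 1 → c l ≠ a i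

theorem LadderLayout.mono {c a : ℕ → Qubit m} {j : ℕ} (h : LadderLayout c a (j + 1)) :
    LadderLayout c a j where
  first := h.first
  inj i h1 hi k hk hkj := h.inj i h1 (by omega) k hk (by omega)
  disj l hl i h1 hi := h.disj l (by omega) i h1 (by omega)

theorem LadderLayout.ne {c a : ℕ → Qubit m} {j : ℕ} (h : LadderLayout c a j) {i k : ℕ}
    (hi : 1 ≤ i) (hij : i ≤ j + 1) (hk : 1 ≤ k) (hkj : k ≤ j + 1) (hik : i ≠ k) : a i ≠ a k :=
  fun he => hik (h.inj i hi hij k hk hkj he)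

theorem permutes_ladder {d : ℕ} {c a : ℕ → Qubit (Nat.clog 2 d)} {j : ℕ}
    (h : LadderLayout c a j) : Permutes (ladder c a j) (ladderFun c a j) := by
  induction j with
  | zero =>
    exact permutes_toffoli h.first (h.disj 0 (by omega) 1 le_rfl le_rfl)
      (h.disj 1 (by omega) 1 le_rfl le_rfl)
  | succ j ih =>
    have ht := permutes_toffoli (h.disj (j + 2) le_rfl (j + 1) (by omega) (by omega))
      (h.ne (i := j + 1) (k := j + 2) (by omega) (by omega) (by omega) le_rfl (by omega))
      (h.disj (j + 2) le_rfl _ (by omega) le_rfl)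
    exact (ht.append (ih h.mono)).append ht

theorem ladderFun_of_ne {c a : ℕ → Qubit m} {j : ℕ} (y : QBasis m) {r : Qubit m}
    (hr : ∀ i, 1 ≤ i → i ≤ j + 1 → r ≠ a i) : ladderFun c a j y r = y r := by
  induction j generalizing y with
  | zero => simp [ladderFun, toffoliFun, hr 1 le_rfl le_rfl]
  | succ j ih =>
    have h1 := hr (j + 2) (by omega) le_rfl
    simp only [ladderFun, Function.comp, toffoliFun, Function.update_of_ne h1]
    rw [ih _ fun i hi hij => hr i hi (by omega), Function.update_of_ne h1]

/-- The contents of the `a i` are arbitrary. The outer Toffoli gates add `c (j+2)` times the old and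
then times the new value of `a (j+1)` to `a (j+2)`. Modulo two the unknown value cancels, leaving `c
(j+2)` times the increment of `a (j+1)`, which is the shorter product by induction. -/
theorem ladderFun_apply {c a : ℕ → Qubit m} {j : ℕ} (h : LadderLayout c a j) (y : QBasis m)
    {i : ℕ} (hi : 1 ≤ i) (hij : i ≤ j + 1) :
    ladderFun c a j y (a i) = y (a i) + controlProd c y i := by
  induction j generalizing y i with
  | zero =>
    obtain rfl : i = 1 := by omega
    simp [ladderFun, toffoliFun, controlProd]
  | succ j ih =>
    have hne : ∀ l ≤ j + 2, c l ≠ a (j + 2) := fun l hl => h.disj l hl _ (by omega) le_rfl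
    set z := toffoliFun (c (j + 2)) (a (j + 1)) (a (j + 2)) y with hz
    have hzr : ∀ r, r ≠ a (j + 2) → z r = y r := fun r hr => by simp [hz, toffoliFun, hr]
    have hprod : ∀ i ≤ j + 1, controlProd c z i = controlProd c y i := fun i hi =>
      controlProd_congr fun l hl => hzr _ (hne l (by omega))
    have hstep : ladderFun c a (j + 1) y
        = toffoliFun (c (j + 2)) (a (j + 1)) (a (j + 2)) (ladderFun c a j z) := rfl
    rw [hstep, toffoliFun]
    rcases Nat.lt_or_ge i (j + 2) with hlt | hge
    · have hai : a i ≠ a (j + 2) := h.ne hi hij (by omega) le_rfl (by omega)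
      rw [Function.update_of_ne hai, ih h.mono z hi (by omega), hzr _ hai, hprod i (by omega)]
    · obtain rfl : i = j + 2 := by omega
      have h1 : ladderFun c a j z (a (j + 2)) = z (a (j + 2)) :=
        ladderFun_of_ne z fun k hk hkj => h.ne (by omega) le_rfl hk (by omega) (by omega)
      have h2 : ladderFun c a j z (c (j + 2)) = y (c (j + 2)) := by
        rw [ladderFun_of_ne z fun k hk hkj => h.disj _ le_rfl k hk (by omega), hzr _ (hne _ le_rfl)]
      have h3 : ladderFun c a j z (a (j + 1)) = y (a (j + 1)) + controlProd c y (j + 1) := by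
        rw [ih h.mono z (by omega) le_rfl, hprod _ le_rfl,
          hzr _ (h.ne (by omega) (by omega) (by omega) le_rfl (by omega))]
      rw [Function.update_self, h1, h2, h3,
        show controlProd c y (j + 2) = y (c (j + 2)) * controlProd c y (j + 1) from rfl]
      simp only [hz, toffoliFun, Function.update_self]
      generalize y (a (j + 2)) = u
      generalize y (c (j + 2)) = v
      generalize y (a (j + 1)) = w
      generalize controlProd c y (j + 1) = x
      revert u v w x; decide

/-- Negation of `t` controlled by `c 0, …, c (k - 1)`; the qubits `a 1, …, a (k - 2)` are
borrowed. -/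
def multiNot (c a : ℕ → Qubit m) (t : Qubit m) : ℕ → Circuit m
  | 0 => notGate t
  | 1 => cx (c 0) t
  | 2 => toffoli (c 1) (c 0) t
  | k + 3 => ladder c (Function.update a (k + 2) t) (k + 1) ++
      ladder c (Function.update a (k + 2) t) k

/-- The qubits of `multiNot c a t k` are in admissible positions. -/
structure MultiNotLayout (c a : ℕ → Qubit m) (t : Qubit m) (k : ℕ) : Prop where
  first : 2 ≤ k → c 1 ≠ c 0
  inj : ∀ i, 1 ≤ i → i + 1 < k → ∀ l, 1 ≤ l → l + 1 < k → a i = a l → i = l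
  disj : ∀ l < k, ∀ i, 1 ≤ i → i + 1 < k → c l ≠ a i
  ne_target : ∀ i, 1 ≤ i → i + 1 < k → a i ≠ t
  control_ne : ∀ l < k, c l ≠ t

/-- The action of a multiply controlled negation on basis states. -/
def multiNotFun (c : ℕ → Qubit m) (t : Qubit m) (k : ℕ) (y : QBasis m) : QBasis m :=
  Function.update y t (y t + if ∀ l < k, y (c l) = 1 then 1 else 0)

/-- The long ladder puts the full product into `t` but also disturbs the borrowed qubits; the ladder
shorter by one rung repeats exactly these disturbances and so undoes them. -/
theorem permutes_multiNot {d : ℕ} {c a : ℕ → Qubit (Nat.clog 2 d)} {t : Qubit (Nat.clog 2 d)}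
    {k : ℕ} (h : MultiNotLayout c a t k) :
    Permutes (multiNot c a t k) (multiNotFun c t k) := by
  match k, h with
  | 0, h =>
    exact (permutes_notGate t).congr fun y => by simp [multiNotFun]
  | 1, h =>
    refine (permutes_cx (h.control_ne 0 (by omega))).congr fun y => ?_
    simp only [multiNotFun, ← controlProd_eq c _ 0, controlProd]
  | 2, h =>
    refine (permutes_toffoli (h.first le_rfl) (h.control_ne 0 (by omega))
      (h.control_ne 1 (by omega))).congr fun y => ?_
    simp only [multiNotFun, ← controlProd_eq c _ 1, controlProd, toffoliFun]
  | k + 3, h =>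
    -- The target serves as the top rung `k + 2` of the long ladder; the rungs `1, …, k + 1` are the
    -- borrowed qubits.
    set b := Function.update a (k + 2) t with hb
    have hbt : b (k + 2) = t := by simp [hb]
    have hba : ∀ i, i ≠ k + 2 → b i = a i := fun i hi => by simp [hb, hi]
    have hl : LadderLayout c b (k + 1) := by
      refine ⟨h.first (by omega), ?_, ?_⟩
      · intro i hi hik l hl hlk hil
        rcases eq_or_ne i (k + 2) with rfl | hi'
        · rcases eq_or_ne l (k + 2) with rfl | hl'
          · rfl
          · rw [hbt, hba l hl'] at hil
            exact absurd hil.symm (h.ne_target l hl (by omega))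
        · rcases eq_or_ne l (k + 2) with rfl | hl'
          · rw [hbt, hba i hi'] at hil
            exact absurd hil (h.ne_target i hi (by omega))
          · rw [hba i hi', hba l hl'] at hil
            exact h.inj i hi (by omega) l hl (by omega) hil
      · intro l hl i hi hik
        rcases eq_or_ne i (k + 2) with rfl | hi'
        · rw [hbt]; exact h.control_ne l (by omega)
        · rw [hba i hi']; exact h.disj l (by omega) i hi (by omega)
    refine ((permutes_ladder hl).append (permutes_ladder hl.mono)).congr fun y => ?_
    funext r
    symm
    have hctl : ∀ l ≤ k + 2, ladderFun c b (k + 1) y (c l) = y (c l) := fun l hl' =>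
      ladderFun_of_ne y fun i hi hik => hl.disj l hl' i hi hik
    simp only [multiNotFun, Function.comp, ← controlProd_eq c y (k + 2)]
    rcases eq_or_ne r t with rfl | hr
    · rw [Function.update_self, ladderFun_of_ne, ← hbt, ladderFun_apply hl y (by omega) le_rfl]
      intro i hi hik
      rw [← hbt]
      exact hl.ne (by omega) le_rfl hi (by omega) (by omega)
    · rw [Function.update_of_ne hr]
      by_cases hrb : ∃ i, 1 ≤ i ∧ i ≤ k + 1 ∧ r = b i
      · obtain ⟨i, hi, hik, rfl⟩ := hrb
        rw [ladderFun_apply hl.mono _ hi hik, ladderFun_apply hl y hi (by omega),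
          controlProd_congr (z := y) fun l hl' => hctl l (by omega)]
        generalize y (b i) = u
        generalize controlProd c y i = v
        revert u v; decide
      · push Not at hrb
        rw [ladderFun_of_ne _ hrb, ladderFun_of_ne]
        intro i hi hik
        rcases eq_or_ne i (k + 2) with rfl | hi'
        · rwa [hbt]
        · exact hrb i hi (by omega)

/-! ## Negation of the flag controlled by the ancilla register -/

/-- The qubits of the ancilla register, as a sequence. -/
def regQubit (m : ℕ) (i : ℕ) : Qubit m :=
  if h : i < m then Sum.inr ⟨i, h⟩ else Sum.inl 0

/-- The controls of the negation of the flag. -/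
def flagControl (m : ℕ) (l : ℕ) : Qubit m :=
  if l = 0 then Sum.inl 1 else regQubit m ((m + 1) / 2 + l - 1)

theorem regQubit_of_lt {i : ℕ} (h : i < m) : regQubit m i = Sum.inr ⟨i, h⟩ := dif_pos h

/-- Negates the second extra qubit if the first half of the register is all ones. -/
def firstHalfNot (m : ℕ) : Circuit m :=
  multiNot (regQubit m) (fun i => regQubit m ((m + 1) / 2 - 1 + i)) (Sum.inl 1) ((m + 1) / 2)

/-- Negates the flag if the second extra qubit and the second half of the register are all ones. -/
def secondHalfNot (m : ℕ) : Circuit m :=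
  multiNot (flagControl m) (fun i => regQubit m (i - 1)) (Sum.inl 0) (m - (m + 1) / 2 + 1)

/-- Each half of the register lends its qubits to the negation controlled by the other half. With
the first half rounded up, `⌈m/2⌉ - 2` and `⌊m/2⌋ - 1` borrowed qubits are needed and the opposite
half is large enough in both cases. -/
theorem firstHalf_layout (m : ℕ) : MultiNotLayout (regQubit m)
    (fun i => regQubit m ((m + 1) / 2 - 1 + i)) (Sum.inl 1) ((m + 1) / 2) where
  first h := by
    rw [regQubit_of_lt (by omega), regQubit_of_lt (by omega)]
    simp
  inj i hi hik l hl hlk h := by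
    rw [regQubit_of_lt (by omega), regQubit_of_lt (by omega)] at h
    simp at h; omega
  disj l hl i hi hik := by
    rw [regQubit_of_lt (by omega), regQubit_of_lt (by omega)]
    simp; omega
  ne_target i hi hik := by
    rw [regQubit_of_lt (by omega)]
    simp
  control_ne l hl := by
    rw [regQubit_of_lt (by omega)]
    simp

theorem flagControl_of_pos {l : ℕ} (h : 0 < l) (hl : (m + 1) / 2 + l - 1 < m) :
    flagControl m l = Sum.inr ⟨(m + 1) / 2 + l - 1, hl⟩ := by
  rw [flagControl, if_neg (by omega), regQubit_of_lt hl]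

theorem secondHalf_layout (m : ℕ) : MultiNotLayout (flagControl m)
    (fun i => regQubit m (i - 1)) (Sum.inl 0) (m - (m + 1) / 2 + 1) where
  first h := by
    rw [flagControl_of_pos (by omega) (by omega)]
    simp [flagControl]
  inj i hi hik l hl hlk h := by
    rw [regQubit_of_lt (by omega), regQubit_of_lt (by omega)] at h
    simp at h; omega
  disj l hl i hi hik := by
    rw [regQubit_of_lt (by omega)]
    rcases Nat.eq_zero_or_pos l with rfl | h0
    · simp [flagControl]
    · rw [flagControl_of_pos h0 (by omega)]
      simp; omega
  ne_target i hi hik := by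
    rw [regQubit_of_lt (by omega)]
    simp
  control_ne l hl := by
    rcases Nat.eq_zero_or_pos l with rfl | h0
    · simp [flagControl]
    · rw [flagControl_of_pos h0 (by omega)]
      simp

/-- Negates the listed qubits of the register. -/
def notAll (l : List (Fin m)) : Circuit m := l.flatMap fun i => notGate (Sum.inr i)

theorem permutes_notAll {d : ℕ} {l : List (Fin (Nat.clog 2 d))} (hl : l.Nodup) :
    Permutes (notAll l) fun y => Sum.elim (fun b => y (Sum.inl b))
      fun i => if i ∈ l then y (Sum.inr i) + 1 else y (Sum.inr i) := by
  induction l with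
  | nil =>
    refine permutes_nil.congr fun y => ?_
    funext r
    rcases r with r | r <;> simp
  | cons j l ih =>
    have hj := List.nodup_cons.mp hl
    refine ((permutes_notGate (Sum.inr j)).append (ih hj.2)).congr fun y => ?_
    funext r
    rcases r with r | r
    · simp
    · by_cases hr : r = j
      · subst hr; simp [hj.1]
      · simp [hr]

/-- Negates the flag if the register is in the state `|0⟩`. -/
def zeroNot (m : ℕ) : Circuit m :=
  notAll (List.finRange m) ++ ((firstHalfNot m ++ secondHalfNot m) ++
    (firstHalfNot m ++ secondHalfNot m)) ++ notAll (List.finRange m)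

/-- The action of `zeroNot` on basis states. -/
def zeroNotFun (m : ℕ) (y : QBasis m) : QBasis m :=
  Function.update y (Sum.inl 0)
    (y (Sum.inl 0) + if ∀ i, y (Sum.inr i) = 0 then 1 else 0)

theorem forall_reg_iff (y : QBasis m) (P : Fin 2 → Prop) :
    ((∀ l < (m + 1) / 2, P (y (regQubit m l))) ∧
      ∀ l < m - (m + 1) / 2, P (y (flagControl m (l + 1)))) ↔ ∀ i, P (y (Sum.inr i)) := by
  constructor
  · rintro ⟨h1, h2⟩ i
    by_cases hi : i.1 < (m + 1) / 2
    · have := h1 i hi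
      rwa [regQubit_of_lt i.2] at this
    · have := h2 (i - (m + 1) / 2) (by omega)
      rw [flagControl_of_pos (by omega) (by omega)] at this
      convert this using 5
      omega
  · intro h
    refine ⟨fun l hl => ?_, fun l hl => ?_⟩
    · rw [regQubit_of_lt (by omega)]; exact h _
    · rw [flagControl_of_pos (by omega) (by omega)]; exact h _

theorem halfNots_apply (y : QBasis m) :
    (multiNotFun (flagControl m) (Sum.inl 0) (m - (m + 1) / 2 + 1) ∘
      multiNotFun (regQubit m) (Sum.inl 1) ((m + 1) / 2)) y
    = Function.update (Function.update y (Sum.inl 1)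
        (y (Sum.inl 1) + if ∀ l < (m + 1) / 2, y (regQubit m l) = 1 then 1 else 0)) (Sum.inl 0)
        (y (Sum.inl 0) + (y (Sum.inl 1) +
          if ∀ l < (m + 1) / 2, y (regQubit m l) = 1 then 1 else 0) *
          if ∀ l < m - (m + 1) / 2, y (flagControl m (l + 1)) = 1 then 1 else 0) := by
  set z := multiNotFun (regQubit m) (Sum.inl 1) ((m + 1) / 2) y with hz
  have hz1 : z (Sum.inl 1) = y (Sum.inl 1) +
      if ∀ l < (m + 1) / 2, y (regQubit m l) = 1 then 1 else 0 := by simp [hz, multiNotFun]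
  have hzr : ∀ r, r ≠ Sum.inl 1 → z r = y r := fun r hr => by simp [hz, multiNotFun, hr]
  have hflag : ∀ l < m - (m + 1) / 2, z (flagControl m (l + 1)) = y (flagControl m (l + 1)) := by
    intro l hl
    rw [flagControl_of_pos (by omega) (by omega)]
    exact hzr _ (by simp)
  have hcond : (∀ l < m - (m + 1) / 2 + 1, z (flagControl m l) = 1) ↔ z (Sum.inl 1) = 1 ∧
      ∀ l < m - (m + 1) / 2, y (flagControl m (l + 1)) = 1 := by
    rw [Nat.forall_lt_succ_left]
    refine and_congr (by simp [flagControl]) (forall₂_congr fun l hl => by rw [hflag l hl])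
  simp only [Function.comp]
  rw [← hz, multiNotFun, ← hz1, hzr (Sum.inl 0) (by simp)]
  have hup : Function.update y (Sum.inl 1) (z (Sum.inl 1)) = z := by
    funext r
    by_cases hr : r = Sum.inl 1
    · subst hr; simp
    · simp [hr, hzr r hr]
  rw [hup]
  congr 2
  simp only [hcond]
  generalize z (Sum.inl 1) = u
  by_cases h : ∀ l < m - (m + 1) / 2, y (flagControl m (l + 1)) = 1
  · rw [if_pos h, if_congr (and_iff_left h) rfl rfl]
    revert u; decide
  · simp only [h, and_false, if_false, mul_zero]

/-- Let `f`, `g` be the products over the two halves and `u` the unknown bit of the second extra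
qubit. The first round adds `(u + f) g` to the flag and leaves `u + f`; the second adds `u g` and
restores `u`. The total added to the flag is `f g`. -/
theorem halfNots_twice (y : QBasis m) :
    (multiNotFun (flagControl m) (Sum.inl 0) (m - (m + 1) / 2 + 1) ∘
      multiNotFun (regQubit m) (Sum.inl 1) ((m + 1) / 2))
    ((multiNotFun (flagControl m) (Sum.inl 0) (m - (m + 1) / 2 + 1) ∘
      multiNotFun (regQubit m) (Sum.inl 1) ((m + 1) / 2)) y)
    = Function.update y (Sum.inl 0)
        (y (Sum.inl 0) + if ∀ i, y (Sum.inr i) = 1 then 1 else 0) := by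
  rw [halfNots_apply y]
  generalize hw : Function.update (Function.update y (Sum.inl 1) _) (Sum.inl 0) _ = w
  have hwr : ∀ i, w (Sum.inr i) = y (Sum.inr i) := fun i => by simp [← hw]
  have h1 : (∀ l < (m + 1) / 2, w (regQubit m l) = 1) ↔
      ∀ l < (m + 1) / 2, y (regQubit m l) = 1 :=
    forall₂_congr fun l hl => by rw [regQubit_of_lt (by omega), hwr]
  have h2 : (∀ l < m - (m + 1) / 2, w (flagControl m (l + 1)) = 1) ↔
      ∀ l < m - (m + 1) / 2, y (flagControl m (l + 1)) = 1 :=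
    forall₂_congr fun l hl => by rw [flagControl_of_pos (by omega) (by omega), hwr]
  rw [halfNots_apply w, if_congr h1 rfl rfl, if_congr h2 rfl rfl,
    ← if_congr (forall_reg_iff y fun b => b = 1) rfl rfl]
  funext r
  rcases r with r | r
  · fin_cases r
    · simp only [← hw, Fin.zero_eta, Function.update_self, ne_eq, not_false_eq_true,
        Sum.inl.injEq, one_ne_zero, Function.update_of_ne]
      generalize y (Sum.inl 0) = u
      generalize y (Sum.inl 1) = v
      split_ifs <;> first | tauto | (revert u v; decide)
    · simp only [← hw, Fin.mk_one, Function.update_self, ne_eq, not_false_eq_true,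
        Sum.inl.injEq, one_ne_zero, Function.update_of_ne]
      generalize y (Sum.inl 1) = v
      split_ifs <;> (revert v; decide)
  · simp [hwr]

theorem permutes_zeroNot (d : ℕ) : Permutes (zeroNot (Nat.clog 2 d)) (zeroNotFun _) := by
  set m := Nat.clog 2 d with hm
  have hX := permutes_notAll (d := d) (List.nodup_finRange m)
  have hG := (permutes_multiNot (d := d) (firstHalf_layout m)).append
    (permutes_multiNot (d := d) (secondHalf_layout m))
  refine ((hX.append (hG.append hG)).append hX).congr fun y => ?_
  simp only [List.mem_finRange, if_true]
  rw [Function.comp_apply, Function.comp_apply, Function.comp_apply, halfNots_twice]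
  have hi : ∀ i : Fin 2, i + 1 + 1 = i := by decide
  have hc : ∀ i : Fin 2, i + 1 = 1 ↔ i = 0 := by decide
  funext r
  rcases r with r | r
  · fin_cases r <;> simp [zeroNotFun, hc]
  · simp [zeroNotFun, hi]

end

end

end FlexQSP

namespace FlexQSP

noncomputable section

/-! ## Operators that restrict to the labelled subspace -/

/-- The labels of the states of the two extra qubits and the register of dimension `d`. -/
def fullLabel (d : ℕ) (x : (Fin 2 → Fin 2) × Fin d) : QBasis (Nat.clog 2 d) :=
  Sum.elim x.1 (label d x.2)

theorem label_injective (d : ℕ) : Function.Injective (label d) := fun k l h => by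
  simpa [label] using h

theorem fullLabel_injective (d : ℕ) : Function.Injective (fullLabel d) := by
  rintro ⟨b, k⟩ ⟨c, l⟩ h
  have h1 : b = c := funext fun i => congrFun h (Sum.inl i)
  have h2 : label d k = label d l := funext fun i => congrFun h (Sum.inr i)
  rw [h1, label_injective d h2]

/-- `zeroNot` tests the bits, whereas the encoding singles out the basis state `0`; on admissible
labels the two conditions agree. -/
theorem label_eq_zero_iff {d : ℕ} [NeZero d] (k : Fin d) : (∀ i, label d k i = 0) ↔ k = 0 := by
  have h0 : label d 0 = 0 := by
    rw [label, Equiv.symm_apply_eq]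
    ext
    simp [finFunctionFinEquiv]
  constructor
  · intro h
    exact label_injective d (by rw [h0]; exact funext h)
  · rintro rfl i
    rw [h0]; rfl

section Embedding

variable {X Y : Type} [DecidableEq X] {n : ℕ} {f : Y → X}

theorem mul_embedding_apply [Fintype X] {Z : Type} (A : Matrix Z (X × Fin n) ℂ) (f : Y → X)
    (x : Z) (y : Y × Fin n) : (A * embedding n f) x y = A x (f y.1, y.2) := by
  simp [Matrix.mul_apply, embedding]

theorem embedding_mul_apply [Fintype Y] (hf : Function.Injective f) {Z : Type}
    (V : Matrix (Y × Fin n) Z ℂ) (a : Y × Fin n) (z : Z) :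
    (embedding n f * V) (f a.1, a.2) z = V a z := by
  rw [Matrix.mul_apply, Finset.sum_eq_single a]
  · simp [embedding]
  · intro b _ hb
    rw [embedding, if_neg, zero_mul]
    intro h
    rw [Prod.ext_iff] at h
    exact hb (Prod.ext (hf h.1.symm) h.2.symm)
  · simp

theorem embedding_mul_apply_of_notMem [Fintype Y] {Z : Type} (V : Matrix (Y × Fin n) Z ℂ)
    {x : X × Fin n} (hx : x.1 ∉ Set.range f) (z : Z) : (embedding n f * V) x z = 0 := by
  rw [Matrix.mul_apply]
  refine Finset.sum_eq_zero fun b _ => ?_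
  rw [embedding, if_neg, zero_mul]
  rintro rfl
  exact hx ⟨b.1, rfl⟩

theorem conjTranspose_embedding_mul [Fintype X] [DecidableEq Y] (hf : Function.Injective f) :
    (embedding n f).conjTranspose * embedding n f = 1 := by
  ext x y
  rw [mul_embedding_apply]
  simp only [Matrix.conjTranspose_apply, embedding, Matrix.one_apply]
  have : ((f y.1, y.2) = (f x.1, x.2)) ↔ x = y := by
    rw [Prod.ext_iff, Prod.ext_iff, hf.eq_iff]
    tauto
  rw [if_congr this rfl rfl]
  split_ifs <;> simp

/-- `A` maps the span of the labels to itself and acts there as `V`. -/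
def Restricts [Fintype X] [Fintype Y] (f : Y → X) (A : Matrix (X × Fin n) (X × Fin n) ℂ)
    (V : Matrix (Y × Fin n) (Y × Fin n) ℂ) : Prop :=
  A * embedding n f = embedding n f * V

/-- Invariance of the labelled subspace passes to products, so a circuit can be analysed step by
step on this subspace and the unused labels never have to be considered. -/
theorem Restricts.mul [Fintype X] [Fintype Y] {A B : Matrix (X × Fin n) (X × Fin n) ℂ}
    {V W : Matrix (Y × Fin n) (Y × Fin n) ℂ} (hA : Restricts f A V) (hB : Restricts f B W) :
    Restricts f (A * B) (V * W) := by
  rw [Restricts] at *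
  rw [Matrix.mul_assoc, hB, ← Matrix.mul_assoc, hA, Matrix.mul_assoc]

theorem restricts_iff [Fintype X] [Fintype Y] (hf : Function.Injective f) {A : Matrix (X × Fin n) (X × Fin n) ℂ}
    {V : Matrix (Y × Fin n) (Y × Fin n) ℂ} : Restricts f A V ↔
      (∀ x y : Y × Fin n, A (f x.1, x.2) (f y.1, y.2) = V x y) ∧
      ∀ (x : X × Fin n) (y : Y × Fin n), x.1 ∉ Set.range f → A x (f y.1, y.2) = 0 := by
  constructor
  · intro h
    refine ⟨fun x y => ?_, fun x y hx => ?_⟩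
    · rw [← mul_embedding_apply A f, h, embedding_mul_apply hf]
    · rw [← mul_embedding_apply A f, h, embedding_mul_apply_of_notMem _ hx]
  · rintro ⟨h1, h2⟩
    ext x y
    rw [mul_embedding_apply]
    by_cases hx : x.1 ∈ Set.range f
    · obtain ⟨a, ha⟩ := hx
      have : x = (f (a, x.2).1, (a, x.2).2) := by rw [ha]
      rw [this, embedding_mul_apply hf, h1]
    · rw [h2 _ _ hx, embedding_mul_apply_of_notMem _ hx]

theorem restricts_diagonal [Fintype X] [DecidableEq Y] [Fintype Y] (hf : Function.Injective f)
    (δ : X → ℂ) :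
    Restricts f (Matrix.diagonal fun x : X × Fin n => δ x.1)
      (Matrix.diagonal fun y : Y × Fin n => δ (f y.1)) := by
  rw [restricts_iff hf]
  refine ⟨fun x y => ?_, fun x y hx => ?_⟩
  · by_cases h : x = y
    · subst h; simp
    · rw [Matrix.diagonal_apply_ne _ h, Matrix.diagonal_apply_ne]
      intro h'
      rw [Prod.ext_iff] at h'
      exact h (Prod.ext (hf h'.1) h'.2)
  · rw [Matrix.diagonal_apply_ne]
    rintro rfl
    exact hx ⟨y.1, rfl⟩

theorem embedding_conj_apply [Fintype X] {g : X → X} (hg : Function.Involutive g)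
    (A : Matrix (X × Fin n) (X × Fin n) ℂ) (x y : X × Fin n) :
    (embedding n g * A * embedding n g) x y = A (g x.1, x.2) (g y.1, y.2) := by
  rw [mul_embedding_apply]
  conv_lhs => rw [show x = (g (g x.1, x.2).1, (g x.1, x.2).2) by simp [hg x.1]]
  rw [embedding_mul_apply hg.injective]

end Embedding

/-- The embedding `E` of the labels satisfies `E†E = 1`, so the summand `1 - EE†` annihilates its
range. -/
theorem restricts_extend {n d : ℕ} (U : Matrix (Fin d × Fin n) (Fin d × Fin n) ℂ) :
    Restricts (label d) (extend U) U := by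
  rw [Restricts, extend, Matrix.add_mul, Matrix.mul_assoc,
    conjTranspose_embedding_mul (label_injective d), Matrix.sub_mul, Matrix.mul_assoc _ (Matrix.conjTranspose _),
    conjTranspose_embedding_mul (label_injective d)]
  simp

/-- The operator that acts as `M b` if the extra qubits are in the state `b`. -/
def blockOp {n d : ℕ} (M : (Fin 2 → Fin 2) → Matrix (Fin d × Fin n) (Fin d × Fin n) ℂ) :
    Matrix (((Fin 2 → Fin 2) × Fin d) × Fin n) (((Fin 2 → Fin 2) × Fin d) × Fin n) ℂ :=
  (Matrix.blockDiagonal M).submatrix (fun x => ((x.1.2, x.2), x.1.1)) (fun x => ((x.1.2, x.2), x.1.1))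

theorem blockOp_mul {n d : ℕ}
    (M N : (Fin 2 → Fin 2) → Matrix (Fin d × Fin n) (Fin d × Fin n) ℂ) :
    blockOp (fun b => M b * N b) = blockOp M * blockOp N := by
  let e : ((Fin 2 → Fin 2) × Fin d) × Fin n ≃ (Fin d × Fin n) × (Fin 2 → Fin 2) :=
    ⟨fun x => ((x.1.2, x.2), x.1.1), fun y => ((y.2, y.1.1), y.1.2), fun _ => rfl, fun _ => rfl⟩
  rw [blockOp, Matrix.blockDiagonal_mul]
  exact (Matrix.submatrix_mul_equiv _ _ _ e _).symm

theorem blockOp_apply {n d : ℕ}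
    (M : (Fin 2 → Fin 2) → Matrix (Fin d × Fin n) (Fin d × Fin n) ℂ)
    (x y : ((Fin 2 → Fin 2) × Fin d) × Fin n) :
    blockOp M x y = if x.1.1 = y.1.1 then M x.1.1 (x.1.2, x.2) (y.1.2, y.2) else 0 := by
  simp [blockOp, Matrix.blockDiagonal_apply]

/-- The signal unitary or its inverse, according to parity. -/
def orient {n d : ℕ} (U : Matrix (Fin d × Fin n) (Fin d × Fin n) ℂ) (k : ℕ) :
    Matrix (Fin d × Fin n) (Fin d × Fin n) ℂ :=
  if k % 2 = 1 then U.conjTranspose else U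

/-- The query to the signal unitary, carried out if the second extra qubit is zero, together with
the phase `-i` or `i` according to the flag. -/
def signalStep (m k : ℕ) : Circuit m :=
  (notGate (Sum.inl 0) ++ tPow (Sum.inl 0) 6 ++ notGate (Sum.inl 0) ++ tPow (Sum.inl 0) 2) ++
    (notGate (Sum.inl 1) ++ [.query 1 (decide (k % 2 = 1))] ++ notGate (Sum.inl 1))

theorem notGate_involutive {m : ℕ} (q : Qubit m) :
    Function.Involutive fun y : QBasis m => Function.update y q (y q + 1) := by
  intro y
  have : ∀ i : Fin 2, i + 1 + 1 = i := by decide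
  simp [this]

/-- The negations make zero the active value of the control, so that the all-zero initial state of
the extra qubits does trigger the query. -/
theorem restricts_query {n d : ℕ} (φ : ℕ → ℝ) (U : Matrix (Fin d × Fin n) (Fin d × Fin n) ℂ)
    (k : ℕ) : Restricts (fullLabel d)
      (Circuit.toMatrix φ U
        (notGate (Sum.inl 1) ++ [.query 1 (decide (k % 2 = 1))] ++ notGate (Sum.inl 1)))
      (blockOp fun b => if b 1 = 0 then orient U k else 1) := by
  have hq : Circuit.toMatrix φ U [.query 1 (decide (k % 2 = 1))]
      = controlledMatrix 1 (extend (orient U k)) := by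
    by_cases h : k % 2 = 1 <;> simp [Circuit.toMatrix, Instr.toMatrix, orient, h]
  rw [Circuit.toMatrix_append, Circuit.toMatrix_append, permutes_notGate, hq,
    restricts_iff (fullLabel_injective d), ← Matrix.mul_assoc]
  obtain ⟨h1, h2⟩ := (restricts_iff (label_injective d)).mp (restricts_extend (orient U k))
  have hadd : ∀ i j : Fin 2, i + 1 = j + 1 ↔ i = j := by decide
  have hone : ∀ i : Fin 2, i + 1 = 1 ↔ i = 0 := by decide
  have hl : ∀ z : QBasis (Nat.clog 2 d), Function.update z (Sum.inl 1) (z (Sum.inl 1) + 1) ∘ Sum.inl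
      = Function.update (z ∘ Sum.inl) 1 (z (Sum.inl 1) + 1) := fun z => by
    funext i; fin_cases i <;> simp
  have hr : ∀ z : QBasis (Nat.clog 2 d), Function.update z (Sum.inl 1) (z (Sum.inl 1) + 1) ∘ Sum.inr
      = z ∘ Sum.inr := fun z => by funext i; simp
  have hup : ∀ b c : Fin 2 → Fin 2, Function.update b 1 (b 1 + 1) = Function.update c 1 (c 1 + 1)
      ↔ b = c := by decide
  have hc : ∀ x y : QBasis (Nat.clog 2 d) × Fin n,
      (embedding n (fun y => Function.update y (Sum.inl 1) (y (Sum.inl 1) + 1)) *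
        controlledMatrix 1 (extend (orient U k)) *
        embedding n (fun y => Function.update y (Sum.inl 1) (y (Sum.inl 1) + 1)) :
        Matrix (QBasis (Nat.clog 2 d) × Fin n) (QBasis (Nat.clog 2 d) × Fin n) ℂ) x y =
      if x.1 ∘ Sum.inl = y.1 ∘ Sum.inl then
        if y.1 (Sum.inl 1) = 0 then
          extend (orient U k) (x.1 ∘ Sum.inr, x.2) (y.1 ∘ Sum.inr, y.2)
        else if x = y then 1 else 0
      else 0 := by
    intro x y
    rw [embedding_conj_apply (notGate_involutive _)]
    simp only [controlledMatrix, hl, hr, Function.update_self, hone]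
    have e1 := hup (x.1 ∘ Sum.inl) (y.1 ∘ Sum.inl)
    simp only [Function.comp_apply] at e1
    refine if_congr e1 (if_congr Iff.rfl rfl (if_congr ?_ rfl rfl)) rfl
    rw [Prod.ext_iff, Prod.ext_iff, (notGate_involutive (Sum.inl 1)).injective.eq_iff]
  -- First the entries between admissible labels, then the vanishing of entries that would lead out
  -- of the subspace; the latter is inherited from `extend`.
  refine ⟨fun x y => ?_, fun x y hx => ?_⟩
  · rw [hc, blockOp_apply]
    have e1 : ∀ z : (Fin 2 → Fin 2) × Fin d, fullLabel d z ∘ Sum.inl = z.1 := fun z => rfl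
    have e2 : ∀ z : (Fin 2 → Fin 2) × Fin d, fullLabel d z ∘ Sum.inr = label d z.2 := fun z => rfl
    have e3 : ∀ z : (Fin 2 → Fin 2) × Fin d, fullLabel d z (Sum.inl 1) = z.1 1 := fun z => rfl
    simp only [e1, e2, e3]
    by_cases hb : x.1.1 = y.1.1
    · rw [if_pos hb, if_pos hb, hb]
      by_cases h0 : y.1.1 1 = 0
      · rw [if_pos h0, if_pos h0]
        exact h1 (x.1.2, x.2) (y.1.2, y.2)
      · rw [if_neg h0, if_neg h0, Matrix.one_apply]
        refine if_congr ?_ rfl rfl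
        rw [Prod.ext_iff, (fullLabel_injective d).eq_iff, Prod.ext_iff, Prod.ext_iff]
        simp [hb]
    · rw [if_neg hb, if_neg hb]
  · rw [hc]
    split_ifs with hb h0 hxy
    · refine h2 (x.1 ∘ Sum.inr, x.2) (y.1.2, y.2) ?_
      rintro ⟨k, hk⟩
      refine hx ⟨(x.1 ∘ Sum.inl, k), ?_⟩
      funext r
      rcases r with r | r
      · rfl
      · exact congrFun hk r
    · exact absurd ⟨y.1, by rw [hxy]⟩ hx
    · rfl
    · rfl

/-- The operator of `signalStep`. -/
theorem restricts_signalStep {n d : ℕ} (φ : ℕ → ℝ)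
    (U : Matrix (Fin d × Fin n) (Fin d × Fin n) ℂ) (k : ℕ) :
    Restricts (fullLabel d) (Circuit.toMatrix φ U (signalStep _ k))
      (blockOp fun b => (if b 0 = 0 then -Complex.I else Complex.I) •
        if b 1 = 0 then orient U k else 1) := by
  -- `T⁶` on the negated flag contributes `ω⁶ = -i` when the flag is zero, `T²` contributes `ω² = i`
  -- when it is one.
  have h6 : omega ^ 6 = -Complex.I := by
    rw [show 6 = 4 + 2 from rfl, pow_add, omega_pow_four, omega_pow_two]; ring
  have hd : ActsDiagonally φ (notGate (Sum.inl 0) ++ tPow (Sum.inl 0) 6 ++ notGate (Sum.inl 0) ++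
      tPow (Sum.inl 0) 2) fun y : QBasis (Nat.clog 2 d) =>
        if y (Sum.inl 0) = 0 then -Complex.I else Complex.I := by
    refine (((actsDiagonally_tPow (Sum.inl 0) 6).conj (permutes_notGate (Sum.inl 0))
      (notGate_involutive _)).append (actsDiagonally_tPow (Sum.inl 0) 2)).congr fun y => ?_
    simp only [Function.comp, Function.update_self, h6, omega_pow_two]
    generalize y (Sum.inl 0) = i
    fin_cases i <;> simp
  rw [signalStep, Circuit.toMatrix_append, hd U]
  convert (restricts_query φ U k).mul (restricts_diagonal (n := n) (fullLabel_injective d)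
    fun y => if y (Sum.inl 0) = 0 then -Complex.I else Complex.I) using 1
  ext x y
  rw [Matrix.mul_diagonal, blockOp_apply, blockOp_apply, fullLabel, Sum.elim_inl]
  by_cases h : x.1.1 = y.1.1
  · rw [if_pos h, if_pos h, h, Matrix.smul_apply, smul_eq_mul, mul_comm]
  · rw [if_neg h, if_neg h, zero_mul]

/-- The phases `φ (2 i)` and `φ (2 i + 1)`, exchanged if the register is not in the state `|0⟩`. -/
def phaseStep (m i : ℕ) : Circuit m :=
  zeroNot m ++ (notGate (Sum.inl 0) ++ [.phase (Sum.inl 0) (2 * i + 1)] ++ notGate (Sum.inl 0) ++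
    [.phase (Sum.inl 0) (2 * i)]) ++ zeroNot m

theorem zeroNot_involutive (m : ℕ) : Function.Involutive (zeroNotFun m) := by
  intro y
  have : ∀ i j : Fin 2, i + j + j = i := by decide
  simp [zeroNotFun, this]

theorem actsDiagonally_phase {d : ℕ} (φ : ℕ → ℝ) (q : Qubit (Nat.clog 2 d)) (i : ℕ) :
    ActsDiagonally φ [.phase q i]
      (fun y => if y q = 0 then 1 else Complex.exp (φ i * Complex.I)) := by
  intro n U
  simp only [Circuit.toMatrix, Matrix.one_mul, Instr.toMatrix, phaseMatrix]
  rw [onQubit_diagonal]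

/-- Between the two `zeroNot` the flag is flipped exactly if the register is `|0⟩`. The phases are
attached to this modified flag, so they depend only on whether `b 0 = 0` and `x.1 = 0` have the same
truth value. -/
theorem restricts_phaseStep {n d : ℕ} [NeZero d] (φ : ℕ → ℝ)
    (U : Matrix (Fin d × Fin n) (Fin d × Fin n) ℂ) (i : ℕ) :
    Restricts (fullLabel d) (Circuit.toMatrix φ U (phaseStep _ i))
      (blockOp fun b => Matrix.diagonal fun x =>
        if (b 0 = 0 ↔ x.1 = 0) then Complex.exp (φ (2 * i) * Complex.I)
        else Complex.exp (φ (2 * i + 1) * Complex.I)) := by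
  have hd := (((actsDiagonally_phase (d := d) φ (Sum.inl 0) (2 * i + 1)).conj
    (permutes_notGate (Sum.inl 0)) (notGate_involutive _)).append
      (actsDiagonally_phase φ (Sum.inl 0) (2 * i))).conj (permutes_zeroNot d) (zeroNot_involutive _)
  rw [phaseStep, hd U]
  convert restricts_diagonal (n := n) (fullLabel_injective d) _ using 1
  ext x y
  rw [blockOp_apply]
  by_cases hxy : x = y
  · subst hxy
    rw [if_pos rfl, Matrix.diagonal_apply_eq, Matrix.diagonal_apply_eq]
    simp only [Function.comp, Function.update_self, zeroNotFun, fullLabel, Sum.elim_inl,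
      Sum.elim_inr, label_eq_zero_iff]
    generalize x.1.1 0 = j
    by_cases hk : x.1.2 = 0
    · simp only [hk, if_true, iff_true]
      fin_cases j <;> simp
    · simp only [hk, if_false, iff_false]
      fin_cases j <;> simp
  · rw [Matrix.diagonal_apply_ne _ hxy]
    split_ifs with h
    · rw [Matrix.diagonal_apply_ne]
      intro h'
      rw [Prod.ext_iff] at h'
      exact hxy (Prod.ext (Prod.ext h h'.1) h'.2)
    · rfl

/-- Alternating signal and phase steps. -/
def alternating (m : ℕ) : ℕ → ℕ → Circuit m
  | i, 0 => phaseStep m i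
  | i, k + 1 => alternating m (i + 1) k ++ signalStep m k ++ phaseStep m i

/-- The layout of the circuit. -/
def layout (N d : ℕ) : Circuit (Nat.clog 2 d) :=
  [.hadamard (Sum.inl 0)] ++ alternating _ 0 N ++ [.hadamard (Sum.inl 0)]

/-- Alternating product of `κ Q`, where `Q` is the signal unitary or its inverse, and diagonal
operators with entry `α i` on the state `|0⟩` of the ancilla register and `β i` elsewhere. -/
def alternatingOp {n d : ℕ} [NeZero d] (α β : ℕ → ℂ) (κ : ℂ)
    (Q : ℕ → Matrix (Fin d × Fin n) (Fin d × Fin n) ℂ) :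
    ℕ → ℕ → Matrix (Fin d × Fin n) (Fin d × Fin n) ℂ
  | i, 0 => Matrix.diagonal fun x => if x.1 = 0 then α i else β i
  | i, k + 1 => (Matrix.diagonal fun x => if x.1 = 0 then α i else β i) *
      ((κ • Q k) * alternatingOp α β κ Q (i + 1) k)

/-- Every step is block diagonal in the two extra bits. The flag exchanges the two phases and the
sign of the factor `∓i`; the other bit decides whether queries take place. -/
theorem restricts_alternating {n d : ℕ} [NeZero d] (φ : ℕ → ℝ)
    (U : Matrix (Fin d × Fin n) (Fin d × Fin n) ℂ) (i k : ℕ) :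
    Restricts (fullLabel d) (Circuit.toMatrix φ U (alternating _ i k))
      (blockOp fun b => alternatingOp
        (fun i => Complex.exp (φ (if b 0 = 0 then 2 * i else 2 * i + 1) * Complex.I))
        (fun i => Complex.exp (φ (if b 0 = 0 then 2 * i + 1 else 2 * i) * Complex.I))
        (if b 0 = 0 then -Complex.I else Complex.I)
        (fun k => if b 1 = 0 then orient U k else 1) i k) := by
  have hD : ∀ i, (fun b : Fin 2 → Fin 2 => Matrix.diagonal fun x : Fin d × Fin n =>
        if (b 0 = 0 ↔ x.1 = 0) then Complex.exp (φ (2 * i) * Complex.I)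
        else Complex.exp (φ (2 * i + 1) * Complex.I)) = fun b => Matrix.diagonal fun x =>
      if x.1 = 0 then Complex.exp (φ (if b 0 = 0 then 2 * i else 2 * i + 1) * Complex.I)
      else Complex.exp (φ (if b 0 = 0 then 2 * i + 1 else 2 * i) * Complex.I) := by
    intro i
    funext b
    congr 1
    funext x
    by_cases h1 : b 0 = 0 <;> by_cases h2 : x.1 = 0 <;> simp [h1, h2]
  induction k generalizing i with
  | zero =>
    have := restricts_phaseStep φ U i
    rwa [hD] at this
  | succ k ih =>
    have hp := restricts_phaseStep φ U i
    rw [hD] at hp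
    rw [alternating, Circuit.toMatrix_append, Circuit.toMatrix_append]
    have := hp.mul ((restricts_signalStep φ U k).mul (ih (i + 1)))
    rw [← blockOp_mul, ← blockOp_mul] at this
    exact this

/-- The one-qubit operator `M` on the first extra qubit. -/
def flagOp {n d : ℕ} (M : Matrix (Fin 2) (Fin 2) ℂ) :
    Matrix (((Fin 2 → Fin 2) × Fin d) × Fin n) (((Fin 2 → Fin 2) × Fin d) × Fin n) ℂ :=
  fun x y => if x.1.1 1 = y.1.1 1 ∧ x.1.2 = y.1.2 ∧ x.2 = y.2 then M (x.1.1 0) (y.1.1 0) else 0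

theorem restricts_flag {n d : ℕ} (M : Matrix (Fin 2) (Fin 2) ℂ) :
    Restricts (n := n) (fullLabel d) (onQubit (Sum.inl 0) M) (flagOp M) := by
  rw [restricts_iff (fullLabel_injective d)]
  refine ⟨fun x y => ?_, fun x y hx => ?_⟩
  · simp only [onQubit, flagOp]
    refine if_congr ?_ rfl rfl
    constructor
    · rintro ⟨h1, h2⟩
      exact ⟨h2 (Sum.inl 1) (by simp), label_injective d (funext fun i =>
        h2 (Sum.inr i) Sum.inr_ne_inl), h1⟩
    · rintro ⟨h1, h2, h3⟩
      refine ⟨h3, fun r hr => ?_⟩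
      rcases r with r | r
      · have : r = 1 := by
          fin_cases r
          · exact absurd rfl hr
          · rfl
        rw [this]; exact h1
      · exact congrFun (congrArg (label d) h2) r
  · rw [onQubit, if_neg]
    rintro ⟨-, h⟩
    refine hx ⟨(x.1 ∘ Sum.inl, y.1.2), ?_⟩
    funext r
    rcases r with r | r
    · rfl
    · exact (h _ Sum.inr_ne_inl).symm

end

end FlexQSP

namespace FlexQSP

noncomputable section

/-! ## The operator of the circuit -/

open Polynomial in
/-- The polynomials `(p, q)` such that `alternatingOp` maps `|0⟩ ψ` to `|0⟩ p(H) ψ` and a term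
`R q(H) ψ` orthogonal to the state `|0⟩` of the ancilla register. -/
def signalPoly (α β : ℕ → ℂ) (κ : ℂ) : ℕ → ℕ → ℂ[X] × ℂ[X]
  | i, 0 => (C (α i), 0)
  | i, k + 1 =>
    (C (κ * α i) * (X * (signalPoly α β κ (i + 1) k).1
        + (1 - X ^ 2) * (signalPoly α β κ (i + 1) k).2),
      C (κ * β i) * ((signalPoly α β κ (i + 1) k).1 - X * (signalPoly α β κ (i + 1) k).2))

section

variable {n d : ℕ} [NeZero d]

/-- The isometry `ψ ↦ |0⟩ ψ`. -/
def zeroIsometry (n d : ℕ) [NeZero d] : Matrix (Fin d × Fin n) (Fin n) ℂ :=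
  fun x j => if x = (0, j) then 1 else 0

theorem mul_zeroIsometry_apply {Z : Type} (A : Matrix Z (Fin d × Fin n) ℂ) (z : Z) (j : Fin n) :
    (A * zeroIsometry n d) z j = A z (0, j) := by
  simp [Matrix.mul_apply, zeroIsometry]

theorem zeroIsometry_mul_apply {Z : Type} (A : Matrix (Fin n) Z ℂ) (x : Fin d × Fin n) (z : Z) :
    (zeroIsometry n d * A) x z = if x.1 = 0 then A x.2 z else 0 := by
  rw [Matrix.mul_apply, Finset.sum_eq_single x.2]
  · by_cases h : x.1 = 0 <;> simp [zeroIsometry, Prod.ext_iff, h]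
  · intro b _ hb
    rw [zeroIsometry, if_neg, zero_mul]
    rintro rfl
    exact hb rfl
  · simp

/-- The part of `Q |0⟩ ψ` orthogonal to the state `|0⟩` of the ancilla register. -/
def offBlock (H : Matrix (Fin n) (Fin n) ℂ) (Q : Matrix (Fin d × Fin n) (Fin d × Fin n) ℂ) :
    Matrix (Fin d × Fin n) (Fin n) ℂ :=
  Q * zeroIsometry n d - zeroIsometry n d * H

theorem offBlock_apply_zero {H : Matrix (Fin n) (Fin n) ℂ}
    {Q : Matrix (Fin d × Fin n) (Fin d × Fin n) ℂ} (h : ∀ i j, Q (0, i) (0, j) = H i j)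
    (i j : Fin n) : offBlock H Q (0, i) j = 0 := by
  simp [offBlock, mul_zeroIsometry_apply, zeroIsometry_mul_apply, h]

/-- The ranges of `J` and of the off-diagonal part `R` of the next query carry the whole dynamics:
the phases act on them as the scalars `α i` and `β i`, and a query mixes them with coefficients that
are polynomials in `H`. -/
theorem alternatingOp_mul_zeroIsometry (α β : ℕ → ℂ) (κ : ℂ) {H : Matrix (Fin n) (Fin n) ℂ}
    {Q : ℕ → Matrix (Fin d × Fin n) (Fin d × Fin n) ℂ} (hQ : ∀ k, Q k * Q (k + 1) = 1)
    (hper : ∀ k, Q (k + 2) = Q k) (hblock : ∀ k i j, Q k (0, i) (0, j) = H i j) (i k : ℕ) :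
    alternatingOp α β κ Q i k * zeroIsometry n d
      = zeroIsometry n d * Polynomial.aeval H (signalPoly α β κ i k).1
        + offBlock H (Q (k + 1)) * Polynomial.aeval H (signalPoly α β κ i k).2 := by
  have hDJ : ∀ i, (Matrix.diagonal fun x : Fin d × Fin n => if x.1 = 0 then α i else β i) *
      zeroIsometry n d = α i • zeroIsometry n d := by
    intro i
    ext x j
    rw [Matrix.diagonal_mul, Matrix.smul_apply, smul_eq_mul]
    by_cases h : x.1 = 0
    · rw [if_pos h]
    · have : x ≠ (0, j) := fun hx => h (by rw [hx])
      simp [zeroIsometry, this]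
  have hDR : ∀ i k, (Matrix.diagonal fun x : Fin d × Fin n => if x.1 = 0 then α i else β i) *
      offBlock H (Q k) = β i • offBlock H (Q k) := by
    intro i k
    ext x j
    rw [Matrix.diagonal_mul, Matrix.smul_apply, smul_eq_mul]
    by_cases h : x.1 = 0
    · have : x = (0, x.2) := Prod.ext h rfl
      rw [this, offBlock_apply_zero (hblock k), mul_zero, mul_zero]
    · rw [if_neg h]
  induction k generalizing i with
  | zero =>
    simp only [alternatingOp, signalPoly, Polynomial.aeval_C, map_zero, Matrix.mul_zero, add_zero]
    rw [hDJ, Algebra.algebraMap_eq_smul_one, Matrix.mul_smul, Matrix.mul_one]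
  | succ k ih =>
    have h1 : Q k * zeroIsometry n d = zeroIsometry n d * H + offBlock H (Q k) := by
      rw [offBlock]; abel
    -- The relation `Q k * Q (k + 1) = 1` replaces the reflection property of qubitization: `Q k`
    -- maps `Q (k + 1) J` back to `J`.
    have h2 : Q k * offBlock H (Q (k + 1)) = zeroIsometry n d * (1 - H * H)
        - offBlock H (Q k) * H := by
      rw [offBlock, Matrix.mul_sub, ← Matrix.mul_assoc, hQ, ← Matrix.mul_assoc, h1,
        Matrix.mul_sub, Matrix.add_mul]
      simp only [Matrix.one_mul, Matrix.mul_one, Matrix.mul_assoc]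
      abel
    -- The step produces the off-diagonal part of `Q k`, whereas the claim names that of `Q (k +
    -- 2)`; they agree by periodicity.
    rw [alternatingOp, Matrix.mul_assoc, Matrix.mul_assoc, ih (i + 1), signalPoly, hper]
    generalize (signalPoly α β κ (i + 1) k).1 = p
    generalize (signalPoly α β κ (i + 1) k).2 = q
    have h3 : Q k * (zeroIsometry n d * Polynomial.aeval H p
        + offBlock H (Q (k + 1)) * Polynomial.aeval H q)
        = zeroIsometry n d * Polynomial.aeval H (Polynomial.X * p + (1 - Polynomial.X ^ 2) * q)
          + offBlock H (Q k) * Polynomial.aeval H (p - Polynomial.X * q) := by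
      rw [Matrix.mul_add, ← Matrix.mul_assoc, h1, ← Matrix.mul_assoc, h2]
      simp only [map_add, map_mul, map_sub, map_one, Polynomial.aeval_X, Matrix.add_mul,
        Matrix.mul_add, Matrix.sub_mul, Matrix.mul_sub, Matrix.mul_assoc, Matrix.mul_one,
        Matrix.one_mul, pow_two]
      abel
    rw [Matrix.smul_mul, h3, Matrix.mul_smul, Matrix.mul_add, ← Matrix.mul_assoc, hDJ,
      ← Matrix.mul_assoc, hDR]
    simp only [map_mul, Polynomial.aeval_C, Algebra.algebraMap_eq_smul_one, Matrix.smul_mul,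
      Matrix.mul_smul, Matrix.one_mul, smul_add, smul_smul]
    rw [mul_comm κ, mul_comm κ]

/-- The term with `R` has no component at the ancilla state `|0⟩`. -/
theorem alternatingOp_apply_zero (α β : ℕ → ℂ) (κ : ℂ) {H : Matrix (Fin n) (Fin n) ℂ}
    {Q : ℕ → Matrix (Fin d × Fin n) (Fin d × Fin n) ℂ} (hQ : ∀ k, Q k * Q (k + 1) = 1)
    (hper : ∀ k, Q (k + 2) = Q k) (hblock : ∀ k i j, Q k (0, i) (0, j) = H i j) (i k : ℕ)
    (a b : Fin n) : alternatingOp α β κ Q i k (0, a) (0, b)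
      = Polynomial.aeval H (signalPoly α β κ i k).1 a b := by
  rw [← mul_zeroIsometry_apply (alternatingOp α β κ Q i k), alternatingOp_mul_zeroIsometry α β κ hQ hper hblock,
    Matrix.add_apply, zeroIsometry_mul_apply, if_pos rfl, Matrix.mul_apply]
  simp [offBlock_apply_zero (hblock _)]

theorem alternatingOp_mem_unitary {α β : ℕ → ℂ} {κ : ℂ}
    {Q : ℕ → Matrix (Fin d × Fin n) (Fin d × Fin n) ℂ}
    (hα : ∀ i, α i * star (α i) = 1) (hβ : ∀ i, β i * star (β i) = 1) (hκ : κ * star κ = 1)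
    (hQ : ∀ k, Q k ∈ Matrix.unitaryGroup (Fin d × Fin n) ℂ) (i k : ℕ) :
    alternatingOp α β κ Q i k ∈ Matrix.unitaryGroup (Fin d × Fin n) ℂ := by
  have hD : ∀ i, (Matrix.diagonal fun x : Fin d × Fin n => if x.1 = 0 then α i else β i)
      ∈ Matrix.unitaryGroup (Fin d × Fin n) ℂ := by
    intro i
    rw [Matrix.mem_unitaryGroup_iff, Matrix.star_eq_conjTranspose, Matrix.diagonal_conjTranspose,
      Matrix.diagonal_mul_diagonal, ← Matrix.diagonal_one]
    congr 1
    funext x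
    by_cases h : x.1 = 0
    · simpa [h] using hα i
    · simpa [h] using hβ i
  induction k generalizing i with
  | zero => exact hD i
  | succ k ih =>
    refine mul_mem (hD i) (mul_mem ?_ (ih _))
    have := Matrix.mem_unitaryGroup_iff.mp (hQ k)
    rw [Matrix.mem_unitaryGroup_iff, star_smul, Matrix.smul_mul, Matrix.mul_smul, smul_smul, this,
      hκ, one_smul]

end

/-! ### Unitarity of the sectors, the Hadamard gates on the flag, and the norm of a block -/

section

variable {n d : ℕ}

theorem blockOp_mem_unitary {M : (Fin 2 → Fin 2) → Matrix (Fin d × Fin n) (Fin d × Fin n) ℂ}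
    (hM : ∀ b, M b ∈ Matrix.unitaryGroup (Fin d × Fin n) ℂ) :
    blockOp M ∈ Matrix.unitaryGroup (((Fin 2 → Fin 2) × Fin d) × Fin n) ℂ := by
  have hstar : star (blockOp M) = blockOp fun b => star (M b) := by
    rw [Matrix.star_eq_conjTranspose, blockOp, Matrix.conjTranspose_submatrix,
      Matrix.blockDiagonal_conjTranspose]
    rfl
  rw [Matrix.mem_unitaryGroup_iff, hstar, ← blockOp_mul]
  ext x y
  rw [blockOp_apply, Matrix.mem_unitaryGroup_iff.mp (hM _), Matrix.one_apply, Matrix.one_apply,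
    ← ite_and]
  refine if_congr ?_ rfl rfl
  simp only [Prod.ext_iff]
  tauto

theorem flagOp_mul_apply (A : Matrix (Fin 2) (Fin 2) ℂ) {Z : Type}
    (M : Matrix (((Fin 2 → Fin 2) × Fin d) × Fin n) Z ℂ)
    (x : ((Fin 2 → Fin 2) × Fin d) × Fin n) (z : Z) :
    (flagOp (n := n) (d := d) A * M) x z
      = ∑ b, A (x.1.1 0) b * M ((Function.update x.1.1 0 b, x.1.2), x.2) z := by
  rw [Matrix.mul_apply]
  have hinj : Function.Injective fun b : Fin 2 => ((Function.update x.1.1 0 b, x.1.2), x.2) := by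
    intro b c hbc
    simpa using congrFun (congrArg (fun z => z.1.1) hbc) 0
  rw [← Finset.sum_subset (Finset.subset_univ (Finset.univ.image fun b : Fin 2 =>
    ((Function.update x.1.1 0 b, x.1.2), x.2))), Finset.sum_image (fun a _ b _ h => hinj h)]
  · refine Finset.sum_congr rfl fun b _ => ?_
    simp [flagOp]
  · intro z _ hz
    rw [flagOp, if_neg, zero_mul]
    rintro ⟨h1, h2, h3⟩
    apply hz
    simp only [Finset.mem_image, Finset.mem_univ, true_and]
    refine ⟨z.1.1 0, Prod.ext (Prod.ext ?_ h2) h3⟩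
    funext r
    fin_cases r
    · simp
    · simpa using h1

theorem mul_flagOp_apply (A : Matrix (Fin 2) (Fin 2) ℂ) {Z : Type}
    (M : Matrix Z (((Fin 2 → Fin 2) × Fin d) × Fin n) ℂ)
    (x : ((Fin 2 → Fin 2) × Fin d) × Fin n) (z : Z) :
    (M * flagOp (n := n) (d := d) A) z x
      = ∑ b, M z ((Function.update x.1.1 0 b, x.1.2), x.2) * A b (x.1.1 0) := by
  have hT : (flagOp A : Matrix (((Fin 2 → Fin 2) × Fin d) × Fin n) _ ℂ).transpose
      = flagOp A.transpose := by
    ext x y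
    simp only [Matrix.transpose_apply, flagOp]
    refine if_congr ?_ rfl rfl
    tauto
  rw [← Matrix.transpose_apply (M * flagOp A), Matrix.transpose_mul, hT, flagOp_mul_apply]
  simp [mul_comm]

theorem hadamardMatrix_mul_self : hadamardMatrix * hadamardMatrix = 1 := by
  ext i j
  fin_cases i <;> fin_cases j <;>
    simp [hadamardMatrix, Matrix.mul_apply, sqrt_two_inv_mul] <;> norm_num

theorem flagOp_hadamard_mem_unitary : (flagOp hadamardMatrix :
    Matrix (((Fin 2 → Fin 2) × Fin d) × Fin n) (((Fin 2 → Fin 2) × Fin d) × Fin n) ℂ)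
      ∈ Matrix.unitaryGroup (((Fin 2 → Fin 2) × Fin d) × Fin n) ℂ := by
  have hs : ∀ i j, star (hadamardMatrix j i) = hadamardMatrix i j := by
    intro i j
    fin_cases i <;> fin_cases j <;> simp [hadamardMatrix, Complex.conj_ofReal]
  have hstar : star (flagOp hadamardMatrix :
      Matrix (((Fin 2 → Fin 2) × Fin d) × Fin n) (((Fin 2 → Fin 2) × Fin d) × Fin n) ℂ)
      = flagOp hadamardMatrix := by
    ext x y
    rw [Matrix.star_apply]
    simp only [flagOp]
    rw [apply_ite star, hs, star_zero]
    refine if_congr ?_ rfl rfl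
    tauto
  rw [Matrix.mem_unitaryGroup_iff, hstar]
  ext x y
  rw [flagOp_mul_apply]
  simp only [flagOp, Function.update_self]
  have h1 : (Function.update x.1.1 0 = fun b => Function.update x.1.1 0 b) := rfl
  simp only [ne_eq, one_ne_zero, not_false_eq_true, Function.update_of_ne, mul_ite, mul_zero]
  rw [Matrix.one_apply]
  by_cases h : x.1.1 1 = y.1.1 1 ∧ x.1.2 = y.1.2 ∧ x.2 = y.2
  · simp only [h, and_self, if_true]
    rw [← Matrix.mul_apply, hadamardMatrix_mul_self, Matrix.one_apply]
    refine if_congr ?_ rfl rfl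
    simp only [Prod.ext_iff, h, and_true, funext_iff, Fin.forall_fin_two]
  · simp only [h, if_false, Finset.sum_const_zero]
    rw [if_neg]
    rintro rfl
    simp at h

/-- The basis states of a register of dimension `4 d`. -/
def splitEquiv (d : ℕ) : Fin (4 * d) ≃ (Fin 2 → Fin 2) × Fin d :=
  finProdFinEquiv.symm.trans
    (((finCongr (by norm_num : 4 = 2 ^ 2)).trans finFunctionFinEquiv.symm).prodCongr
      (Equiv.refl _))

theorem label4_eq (d : ℕ) (k : Fin (4 * d)) : label4 d k = fullLabel d (splitEquiv d k) := rfl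

theorem splitEquiv_zero (d : ℕ) [NeZero d] : splitEquiv d 0 = (0, 0) := by
  rw [← Equiv.eq_symm_apply]
  ext
  simp [splitEquiv, finProdFinEquiv, finFunctionFinEquiv]

theorem implements_of_restricts [NeZero d] {K : Circuit (Nat.clog 2 d)} {φ : ℕ → ℝ}
    {U : Matrix (Fin d × Fin n) (Fin d × Fin n) ℂ}
    {V : Matrix (((Fin 2 → Fin 2) × Fin d) × Fin n) (((Fin 2 → Fin 2) × Fin d) × Fin n) ℂ}
    (h : Restricts (fullLabel d) (Circuit.toMatrix φ U K) V) :
    K.Implements φ U (V.submatrix ((splitEquiv d).prodCongr (Equiv.refl _))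
      ((splitEquiv d).prodCongr (Equiv.refl _))) := by
  have hE : embedding n (label4 d) = (embedding n (fullLabel d)).submatrix id
      ((splitEquiv d).prodCongr (Equiv.refl _)) := by
    ext x y
    simp only [embedding, label4_eq, Matrix.submatrix_apply, id]
    exact if_congr Iff.rfl rfl rfl
  rw [Circuit.Implements, hE]
  rw [Restricts] at h
  rw [Matrix.submatrix_mul_equiv, ← h]
  ext x y
  simp [Matrix.mul_apply]

open scoped Matrix.Norms.L2Operator in
theorem norm_zeroIsometry_le [NeZero d] : ‖zeroIsometry n d‖ ≤ 1 := by
  have h1 : (zeroIsometry n d).conjTranspose * zeroIsometry n d = 1 := by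
    ext i j
    rw [mul_zeroIsometry_apply, Matrix.conjTranspose_apply, zeroIsometry, Matrix.one_apply]
    simp only [Prod.ext_iff, true_and]
    split_ifs with h1 h2 h2 <;> simp_all
  have h2 := Matrix.l2_opNorm_conjTranspose_mul_self (zeroIsometry n d)
  have h3 : ‖(1 : Matrix (Fin n) (Fin n) ℂ)‖ ≤ 1 := by
    rw [← Matrix.diagonal_one, Matrix.l2_opNorm_diagonal]
    exact (pi_norm_le_iff_of_nonneg zero_le_one).mpr fun _ => by simp
  rw [h1] at h2
  nlinarith [norm_nonneg (zeroIsometry n d)]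

-- `A = J† V J` is a compression of a unitary. This yields the norm bound on `B[H]` without
-- functional calculus.
open scoped Matrix.Norms.L2Operator in
theorem norm_le_one_of_block [NeZero d] {A : Matrix (Fin n) (Fin n) ℂ}
    {V : Matrix (Fin d × Fin n) (Fin d × Fin n) ℂ}
    (hV : V ∈ Matrix.unitaryGroup (Fin d × Fin n) ℂ) (hA : ∀ i j, V (0, i) (0, j) = A i j) :
    ‖A‖ ≤ 1 := by
  have hJ : (zeroIsometry n d).conjTranspose * (V * zeroIsometry n d) = A := by
    ext i j
    rw [← hA, ← mul_zeroIsometry_apply V, Matrix.mul_apply, Finset.sum_eq_single (0, i)]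
    · simp [zeroIsometry]
    · intro x _ hx
      simp [zeroIsometry, hx]
    · simp
  have hVn : ‖V‖ ≤ 1 := by
    have h1 : V.conjTranspose * V = 1 := Matrix.mem_unitaryGroup_iff'.mp hV
    have h2 := Matrix.l2_opNorm_conjTranspose_mul_self V
    have h3 : ‖(1 : Matrix (Fin d × Fin n) (Fin d × Fin n) ℂ)‖ ≤ 1 := by
      rw [← Matrix.diagonal_one, Matrix.l2_opNorm_diagonal]
      exact (pi_norm_le_iff_of_nonneg zero_le_one).mpr fun _ => by simp
    rw [h1] at h2
    nlinarith [norm_nonneg V]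
  have hJn := norm_zeroIsometry_le (n := n) (d := d)
  calc ‖A‖ = ‖(zeroIsometry n d).conjTranspose * (V * zeroIsometry n d)‖ := by rw [hJ]
    _ ≤ ‖(zeroIsometry n d).conjTranspose‖ * ‖V * zeroIsometry n d‖ := Matrix.l2_opNorm_mul _ _
    _ ≤ ‖(zeroIsometry n d).conjTranspose‖ * (‖V‖ * ‖zeroIsometry n d‖) := by
        gcongr; exact Matrix.l2_opNorm_mul _ _
    _ ≤ 1 * (1 * 1) := by
        gcongr
        rw [Matrix.l2_opNorm_conjTranspose]; exact hJn
    _ = 1 := by norm_num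

end

/-- If the two polynomials of the flag sectors average to `B`, the circuit block-encodes
`B[H]`. -/
theorem exists_hermitianStandardForm {N : ℕ} {B : Polynomial ℝ} (hdeg : B.natDegree ≤ N)
    {φ : ℕ → ℝ}
    (hφ : (signalPoly (fun i => Complex.exp (φ (2 * i) * Complex.I))
        (fun i => Complex.exp (φ (2 * i + 1) * Complex.I)) (-Complex.I) 0 N).1
      + (signalPoly (fun i => Complex.exp (φ (2 * i + 1) * Complex.I))
        (fun i => Complex.exp (φ (2 * i) * Complex.I)) Complex.I 0 N).1
      = 2 * B.map Complex.ofRealHom)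
    {n d : ℕ} [NeZero d] {H : Matrix (Fin n) (Fin n) ℂ}
    {U : Matrix (Fin d × Fin n) (Fin d × Fin n) ℂ} (hU : HermitianStandardForm H 1 U) :
    ∃ V : Matrix (Fin (4 * d) × Fin n) (Fin (4 * d) × Fin n) ℂ,
      HermitianStandardForm (∑ j ∈ Finset.range (N + 1), (B.coeff j : ℂ) • H ^ j) 1 V ∧
      (layout N d).Implements φ U V := by
  have hB : Polynomial.aeval H (B.map Complex.ofRealHom)
      = ∑ j ∈ Finset.range (N + 1), (B.coeff j : ℂ) • H ^ j := by
    rw [Polynomial.aeval_eq_sum_range' (n := N + 1)]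
    · simp
    · exact Nat.lt_succ_of_le (Polynomial.natDegree_map_le.trans hdeg)
  -- `W b` is the operator in the sector `b` of the two extra qubits.
  set W : (Fin 2 → Fin 2) → Matrix (Fin d × Fin n) (Fin d × Fin n) ℂ := fun b => alternatingOp
        (fun i => Complex.exp (φ (if b 0 = 0 then 2 * i else 2 * i + 1) * Complex.I))
        (fun i => Complex.exp (φ (if b 0 = 0 then 2 * i + 1 else 2 * i) * Complex.I))
        (if b 0 = 0 then -Complex.I else Complex.I)
        (fun k => if b 1 = 0 then orient U k else 1) 0 N with hW
  have hres : Restricts (fullLabel d) (Circuit.toMatrix φ U (layout N d))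
      (flagOp hadamardMatrix * (blockOp W * flagOp hadamardMatrix)) := by
    have hH : Restricts (n := n) (fullLabel d)
        (Circuit.toMatrix φ U [.hadamard (Sum.inl 0)]) (flagOp hadamardMatrix) := by
      simp only [Circuit.toMatrix, Matrix.one_mul, Instr.toMatrix]
      exact restricts_flag _
    rw [layout, Circuit.toMatrix_append, Circuit.toMatrix_append]
    exact hH.mul ((restricts_alternating φ U 0 N).mul hH)
  have hexp : ∀ x : ℝ, Complex.exp (x * Complex.I) * star (Complex.exp (x * Complex.I)) = 1 := by
    intro x
    rw [← starRingEnd_apply, Complex.mul_conj, Complex.normSq_eq_norm_sq,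
      Complex.norm_exp_ofReal_mul_I]
    norm_num
  have hor : ∀ k, orient U k ∈ Matrix.unitaryGroup (Fin d × Fin n) ℂ := by
    intro k
    rw [orient]
    split_ifs
    · exact Unitary.star_mem hU.unitary
    · exact hU.unitary
  have hWu : ∀ b, W b ∈ Matrix.unitaryGroup (Fin d × Fin n) ℂ := by
    intro b
    refine alternatingOp_mem_unitary (fun i => hexp _) (fun i => hexp _) ?_ (fun k => ?_) 0 N
    · split_ifs <;> simp
    · split_ifs
      · exact hor k
      · exact one_mem _
  have hVu : flagOp hadamardMatrix * (blockOp W * flagOp hadamardMatrix)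
      ∈ Matrix.unitaryGroup (((Fin 2 → Fin 2) × Fin d) × Fin n) ℂ :=
    mul_mem flagOp_hadamard_mem_unitary
      (mul_mem (blockOp_mem_unitary hWu) flagOp_hadamard_mem_unitary)
  -- Here Hermiticity enters: the block of `U†` is `H†`, which has to equal the block of `U`.
  have hblockU : ∀ k i j, orient U k (0, i) (0, j) = H i j := by
    intro k i j
    rw [orient]
    split_ifs
    · rw [Matrix.conjTranspose_apply, hU.block]
      simpa using hU.hermitian.apply i j
    · rw [hU.block]; simp
  have hprod : ∀ k, orient U k * orient U (k + 1) = 1 := by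
    intro k
    have h1 : U * U.conjTranspose = 1 := Matrix.mem_unitaryGroup_iff.mp hU.unitary
    have h2 : U.conjTranspose * U = 1 := Matrix.mem_unitaryGroup_iff'.mp hU.unitary
    rcases Nat.mod_two_eq_zero_or_one k with h | h
    · rw [orient, orient, if_neg (by omega), if_pos (by omega), h1]
    · rw [orient, orient, if_pos (by omega), if_neg (by omega), h2]
  have hper : ∀ k, orient U (k + 2) = orient U k := by
    intro k
    simp [orient]
  have hentry : ∀ i j, (flagOp hadamardMatrix * (blockOp W * flagOp hadamardMatrix) :
      Matrix (((Fin 2 → Fin 2) × Fin d) × Fin n) (((Fin 2 → Fin 2) × Fin d) × Fin n) ℂ)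
      ((0, 0), i) ((0, 0), j)
      = (∑ j ∈ Finset.range (N + 1), (B.coeff j : ℂ) • H ^ j) i j := by
    intro i j
    -- The two flag sectors with the second extra bit zero contribute the two polynomials in `hφ`,
    -- evaluated at `H`.
    have hsum : (W (Function.update 0 0 0) (0, i) (0, j) + W (Function.update 0 0 1) (0, i) (0, j))
        = 2 * (∑ j ∈ Finset.range (N + 1), (B.coeff j : ℂ) • H ^ j) i j := by
      have hE := congrFun (congrFun (congrArg (Polynomial.aeval H) hφ) i) j
      rw [map_add, map_mul, hB, Matrix.add_apply] at hE
      rw [hW]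
      simp only [Function.update_self, ne_eq, one_ne_zero, not_false_eq_true,
        Function.update_of_ne, Pi.zero_apply, if_true, if_false]
      rw [alternatingOp_apply_zero _ _ _ hprod hper hblockU,
        alternatingOp_apply_zero _ _ _ hprod hper hblockU, hE,
        show (2 : Polynomial ℂ) = Polynomial.C 2 from rfl, Polynomial.aeval_C,
        Algebra.algebraMap_eq_smul_one, Matrix.smul_mul, Matrix.one_mul, Matrix.smul_apply,
        smul_eq_mul]
    rw [flagOp_mul_apply]
    simp only [mul_flagOp_apply, Fin.sum_univ_two, blockOp_apply]
    -- The blocks between different flag values vanish, so of the four terms from the two Hadamard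
    -- gates only the two diagonal ones survive, each with weight `1/2`.
    have h01 : Function.update (0 : Fin 2 → Fin 2) 0 0 ≠
        Function.update (0 : Fin 2 → Fin 2) 0 1 := by decide
    simp only [h01, h01.symm, if_true, if_false, zero_mul, add_zero, zero_add]
    have hh : ∀ b, hadamardMatrix 0 b = (Real.sqrt 2 : ℂ)⁻¹ ∧
        hadamardMatrix b 0 = (Real.sqrt 2 : ℂ)⁻¹ := by
      intro b; fin_cases b <;> simp [hadamardMatrix]
    simp only [Pi.zero_apply, (hh _).1, (hh _).2]
    calc _ = ((Real.sqrt 2 : ℂ)⁻¹ * (Real.sqrt 2 : ℂ)⁻¹) *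
          (W (Function.update 0 0 0) (0, i) (0, j) + W (Function.update 0 0 1) (0, i) (0, j)) := by
            ring
      _ = _ := by rw [hsum, sqrt_two_inv_mul]; ring
  set ε : Fin (4 * d) × Fin n ≃ ((Fin 2 → Fin 2) × Fin d) × Fin n :=
    (splitEquiv d).prodCongr (Equiv.refl _) with hε
  have hε0 : ∀ i, ε (0, i) = ((0, 0), i) := fun i => by simp [hε, splitEquiv_zero]
  have hVu' : (flagOp hadamardMatrix * (blockOp W * flagOp hadamardMatrix)).submatrix ε ε
      ∈ Matrix.unitaryGroup (Fin (4 * d) × Fin n) ℂ := by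
    have h := Matrix.mem_unitaryGroup_iff.mp hVu
    rw [Matrix.mem_unitaryGroup_iff, Matrix.star_eq_conjTranspose, Matrix.conjTranspose_submatrix,
      Matrix.submatrix_mul_equiv, ← Matrix.star_eq_conjTranspose, h, Matrix.submatrix_one_equiv]
  have hblock : ∀ i j, (flagOp hadamardMatrix * (blockOp W * flagOp hadamardMatrix)).submatrix ε ε
      (0, i) (0, j) = (∑ j ∈ Finset.range (N + 1), (B.coeff j : ℂ) • H ^ j) i j := by
    intro i j
    rw [Matrix.submatrix_apply, hε0, hε0, hentry]
  refine ⟨_, ⟨⟨zero_lt_one, norm_le_one_of_block hVu' hblock, hVu', fun i j => ?_⟩, ?_⟩,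
    implements_of_restricts hres⟩
  · rw [hblock]; simp
  · rw [Matrix.IsHermitian, Matrix.conjTranspose_sum]
    refine Finset.sum_congr rfl fun j _ => ?_
    rw [Matrix.conjTranspose_smul, (hU.hermitian.pow j).eq]
    simp [Complex.conj_ofReal]

end

end FlexQSP

namespace FlexQSP

/-! ## Size of the circuit -/

section

variable {m : ℕ}

theorem queries_append (K L : Circuit m) :
    Circuit.queries (K ++ L) = K.queries + L.queries := List.countP_append ..

theorem gates_le_length (K : Circuit m) : K.gates ≤ K.length := List.countP_le_length

theorem queries_tPow (q : Qubit m) (k : ℕ) : (tPow q k).queries = 0 := by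
  induction k with
  | zero => rfl
  | succ k ih => rw [tPow, List.replicate_succ, Circuit.queries, List.countP_cons]; exact ih

theorem queries_cx (a b : Qubit m) : (cx a b).queries = 0 := by
  rw [cx]; split_ifs <;> rfl

theorem queries_notGate (q : Qubit m) : (notGate q).queries = 0 := by
  rw [notGate, queries_append, queries_append, queries_tPow]; rfl

theorem queries_toffoli (a b c : Qubit m) : (toffoli a b c).queries = 0 := by
  simp only [toffoli, ccz, queries_append, queries_tPow, queries_cx]; rfl

theorem queries_ladder (c a : ℕ → Qubit m) (j : ℕ) : (ladder c a j).queries = 0 := by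
  induction j with
  | zero => exact queries_toffoli ..
  | succ j ih => simp only [ladder, queries_append, queries_toffoli, ih]

theorem queries_multiNot (c a : ℕ → Qubit m) (t : Qubit m) (k : ℕ) :
    (multiNot c a t k).queries = 0 := by
  match k with
  | 0 => exact queries_notGate _
  | 1 => exact queries_cx ..
  | 2 => exact queries_toffoli ..
  | k + 3 => simp only [multiNot, queries_append, queries_ladder]

theorem queries_notAll (l : List (Fin m)) : (notAll l).queries = 0 := by
  induction l with
  | nil => rfl
  | cons i l ih =>
    rw [notAll, List.flatMap_cons, queries_append, queries_notGate]
    exact (zero_add _).trans ih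

theorem queries_zeroNot (m : ℕ) : (zeroNot m).queries = 0 := by
  simp only [zeroNot, firstHalfNot, secondHalfNot, queries_append, queries_notAll,
    queries_multiNot]

theorem queries_phaseStep (i : ℕ) : (phaseStep m i).queries = 0 := by
  simp only [phaseStep, queries_append, queries_zeroNot, queries_notGate]; rfl

theorem queries_signalStep (k : ℕ) : (signalStep m k).queries = 1 := by
  simp only [signalStep, queries_append, queries_tPow, queries_notGate]; rfl

theorem queries_alternating (i k : ℕ) : (alternating m i k).queries = k := by
  induction k generalizing i with
  | zero => exact queries_phaseStep _
  | succ k ih =>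
    simp only [alternating, queries_append, ih, queries_signalStep, queries_phaseStep, add_zero]

theorem queries_layout (N d : ℕ) : (layout N d).queries = N := by
  simp only [layout, queries_append, queries_alternating]
  exact Nat.zero_add N

theorem length_tPow (q : Qubit m) (k : ℕ) : (tPow q k).length = k := List.length_replicate

theorem length_cx_le (a b : Qubit m) : (cx a b).length ≤ 1 := by
  rw [cx]; split_ifs <;> simp

theorem length_notGate (q : Qubit m) : (notGate q).length = 6 := by
  simp [notGate, length_tPow]

theorem length_toffoli_le (a b c : Qubit m) : (toffoli a b c).length ≤ 40 := by
  have h1 := length_cx_le a b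
  have h2 := length_cx_le b c
  have h3 := length_cx_le a c
  simp only [toffoli, ccz, List.length_append, length_tPow, List.length_singleton]
  omega

theorem length_ladder_le (c a : ℕ → Qubit m) (j : ℕ) :
    (ladder c a j).length ≤ 80 * j + 40 := by
  induction j with
  | zero => exact length_toffoli_le ..
  | succ j ih =>
    have := length_toffoli_le (c (j + 2)) (a (j + 1)) (a (j + 2))
    simp only [ladder, List.length_append]
    omega

theorem length_multiNot_le (c a : ℕ → Qubit m) (t : Qubit m) (k : ℕ) :
    (multiNot c a t k).length ≤ 160 * k + 6 := by
  match k with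
  | 0 => exact (length_notGate _).le
  | 1 => exact (length_cx_le ..).trans (by norm_num)
  | 2 => exact (length_toffoli_le ..).trans (by norm_num)
  | k + 3 =>
    have h1 := length_ladder_le c (Function.update a (k + 2) t) (k + 1)
    have h2 := length_ladder_le c (Function.update a (k + 2) t) k
    simp only [multiNot, List.length_append]
    omega

theorem length_notAll (l : List (Fin m)) : (notAll l).length = 6 * l.length := by
  induction l with
  | nil => rfl
  | cons i l ih =>
    rw [notAll, List.flatMap_cons, List.length_append, length_notGate, List.length_cons]
    rw [notAll] at ih
    omega

theorem length_zeroNot_le (m : ℕ) : (zeroNot m).length ≤ 344 * (m + 1) := by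
  have h1 := length_multiNot_le (regQubit m) (fun i => regQubit m ((m + 1) / 2 - 1 + i))
    (Sum.inl 1) ((m + 1) / 2)
  have h2 := length_multiNot_le (flagControl m) (fun i => regQubit m (i - 1)) (Sum.inl 0)
    (m - (m + 1) / 2 + 1)
  simp only [zeroNot, firstHalfNot, secondHalfNot, List.length_append, length_notAll,
    List.length_finRange]
  omega

theorem length_phaseStep_le (i : ℕ) : (phaseStep m i).length ≤ 702 * (m + 1) := by
  have := length_zeroNot_le m
  simp only [phaseStep, List.length_append, length_notGate, List.length_singleton]
  omega

theorem length_signalStep (k : ℕ) : (signalStep m k).length = 33 := by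
  simp only [signalStep, List.length_append, length_notGate, length_tPow, List.length_singleton]

theorem length_alternating_le (i k : ℕ) :
    (alternating m i k).length ≤ (k + 1) * (735 * (m + 1)) := by
  induction k generalizing i with
  | zero =>
    rw [alternating, zero_add, one_mul]
    exact (length_phaseStep_le i).trans (Nat.mul_le_mul_right _ (by norm_num))
  | succ k ih =>
    have h1 := length_phaseStep_le (m := m) i
    have h2 := ih (i + 1)
    simp only [alternating, List.length_append, length_signalStep]
    rw [add_mul (k + 1) 1]
    omega

theorem gates_layout_le {N : ℕ} (hN : 1 ≤ N) (d : ℕ) :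
    (layout N d).gates ≤ 1472 * N * (Nat.clog 2 d + 1) := by
  refine (gates_le_length _).trans ?_
  have h1 := length_alternating_le (m := Nat.clog 2 d) 0 N
  simp only [layout, List.length_append, List.length_singleton]
  -- `735 (N + 1) (m + 1) + 2 ≤ 1472 N (m + 1)`, from `N + 1 ≤ 2 N`, the two Hadamard gates being
  -- absorbed.
  nlinarith [Nat.zero_le (Nat.clog 2 d)]

/-- For `m = ⌈log₂ d⌉ ≥ 1` one has `2 ^ (m - 1) < d`, hence `3 log (2d) ≥ 3 m log 2 ≥ 2 m ≥ m + 1`.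
For `d = 1` the factor two keeps the logarithm positive. -/
theorem clog_add_one_le {d : ℕ} (hd : 1 ≤ d) :
    ((Nat.clog 2 d + 1 : ℕ) : ℝ) ≤ 3 * Real.log (2 * d) := by
  have hlog2 : (2 / 3 : ℝ) ≤ Real.log 2 := by linarith [Real.log_two_gt_d9]
  have hd' : (1 : ℝ) ≤ d := by exact_mod_cast hd
  have hmul : Real.log (2 * d) = Real.log 2 + Real.log d :=
    Real.log_mul (by norm_num) (by positivity)
  have hlogd : 0 ≤ Real.log d := Real.log_nonneg hd'
  rcases Nat.eq_zero_or_pos (Nat.clog 2 d) with h0 | h0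
  · rw [h0]; push_cast; linarith
  · have h1 : 2 ^ (Nat.clog 2 d - 1) < d := Nat.pow_pred_clog_lt_self one_lt_two (by
      by_contra h
      have := Nat.clog_of_right_le_one (b := 2) (n := d) (by omega)
      omega)
    have h2 : ((Nat.clog 2 d - 1 : ℕ) : ℝ) * Real.log 2 ≤ Real.log d := by
      rw [← Real.log_pow]
      refine Real.log_le_log (by positivity) ?_
      exact_mod_cast h1.le
    rw [Nat.cast_sub h0] at h2
    push_cast at h2 ⊢
    nlinarith [(Nat.cast_nonneg (Nat.clog 2 d) : (0 : ℝ) ≤ _)]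

theorem layout_size {N d : ℕ} (hN : 1 ≤ N) (hd : 1 ≤ d) :
    ((layout N d).queries : ℝ) ≤ 4416 * N ∧
      ((layout N d).gates : ℝ) ≤ 4416 * N * Real.log (2 * d) := by
  constructor
  · rw [queries_layout]
    have : (0 : ℝ) ≤ N := Nat.cast_nonneg N
    linarith
  · have h1 : ((layout N d).gates : ℝ) ≤ 1472 * N * ((Nat.clog 2 d + 1 : ℕ) : ℝ) := by
      exact_mod_cast gates_layout_le hN d
    have h2 := clog_add_one_le hd
    calc _ ≤ 1472 * (N : ℝ) * ((Nat.clog 2 d + 1 : ℕ) : ℝ) := h1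
      _ ≤ 1472 * (N : ℝ) * (3 * Real.log (2 * d)) := by gcongr
      _ = _ := by ring

end

end FlexQSP

namespace FlexQSP

noncomputable section

/-! ## Signal processing polynomials -/

open Polynomial

/-- The pair of real polynomials, in the square of the phase of the signal, that describes
alternating signal and phase steps. -/
def phasePoly (ψ : ℕ → ℝ) : ℕ → ℕ → ℝ[X] × ℝ[X]
  | i, 0 => (C (Real.cos (ψ i)), C (Real.sin (ψ i)))
  | i, k + 1 =>
    (C (Real.cos (ψ i)) * (phasePoly ψ (i + 1) k).2
        + C (Real.sin (ψ i)) * (X * (phasePoly ψ (i + 1) k).1),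
      C (Real.sin (ψ i)) * (phasePoly ψ (i + 1) k).2
        - C (Real.cos (ψ i)) * (X * (phasePoly ψ (i + 1) k).1))

/-- Put `δ = (z - y)/2`, so that `1 - x² = -δ²` at `x = (z + y)/2`. A query exchanges the two
combinations `p ∓ δ q` and multiplies them by `y` and `z`, apart from the scalar `κ`; the phases mix
them through cosine and sine. Following the two real components separately gives the recursion
`phasePoly`. Leaving `ι` as either square root of `-1` covers both flag sectors. -/
theorem signalPoly_eval {ψ : ℕ → ℝ} {ι : ℂ} (hι : ι ^ 2 = -1) {α β : ℕ → ℂ}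
    (hα : ∀ i, α i = Real.cos (ψ i) + ι * Real.sin (ψ i))
    (hβ : ∀ i, β i = Real.cos (ψ i) - ι * Real.sin (ψ i)) {z y : ℂ} (hzy : z * y = 1)
    (i k : ℕ) :
    (signalPoly α β (-ι) i k).1.eval ((z + y) / 2)
        - (z - y) / 2 * (signalPoly α β (-ι) i k).2.eval ((z + y) / 2)
      = y ^ k * aeval (z ^ 2) (phasePoly ψ i k).1 + ι * (z ^ k * aeval (y ^ 2) (phasePoly ψ i k).2)
    ∧ (signalPoly α β (-ι) i k).1.eval ((z + y) / 2)
        + (z - y) / 2 * (signalPoly α β (-ι) i k).2.eval ((z + y) / 2)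
      = z ^ k * aeval (y ^ 2) (phasePoly ψ i k).1
        + ι * (y ^ k * aeval (z ^ 2) (phasePoly ψ i k).2) := by
  induction k generalizing i with
  | zero =>
    simp [signalPoly, phasePoly, hα]
  | succ k ih =>
    obtain ⟨h1, h2⟩ := ih (i + 1)
    simp only [signalPoly, phasePoly, eval_mul, eval_C, eval_add, eval_sub, eval_X, eval_one,
      eval_pow, map_add, map_sub, map_mul, aeval_C, aeval_X, hα, hβ, Complex.coe_algebraMap]
    generalize (signalPoly α β (-ι) (i + 1) k).1.eval ((z + y) / 2) = P at *
    generalize (signalPoly α β (-ι) (i + 1) k).2.eval ((z + y) / 2) = Q at *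
    generalize aeval (z ^ 2) (phasePoly ψ (i + 1) k).1 = V at *
    generalize aeval (z ^ 2) (phasePoly ψ (i + 1) k).2 = W at *
    generalize aeval (y ^ 2) (phasePoly ψ (i + 1) k).1 = V' at *
    generalize aeval (y ^ 2) (phasePoly ψ (i + 1) k).2 = W' at *
    generalize ((Real.cos (ψ i) : ℝ) : ℂ) = c
    generalize ((Real.sin (ψ i) : ℝ) : ℂ) = s
    have e1 : (z + y) / 2 * P + (1 - ((z + y) / 2) ^ 2) * Q
        = (z * (y ^ k * V + ι * (z ^ k * W')) + y * (z ^ k * V' + ι * (y ^ k * W))) / 2 := by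
      rw [← h1, ← h2]
      linear_combination Q * (-hzy)
    have e2 : (z - y) / 2 * (P - (z + y) / 2 * Q)
        = (z * (y ^ k * V + ι * (z ^ k * W')) - y * (z ^ k * V' + ι * (y ^ k * W))) / 2 := by
      rw [← h1, ← h2]
      ring
    have e3 : y ^ (k + 1) * z ^ 2 = z * y ^ k := by
      linear_combination z * y ^ k * hzy
    have e4 : z ^ (k + 1) * y ^ 2 = y * z ^ k := by
      linear_combination y * z ^ k * hzy
    constructor
    · rw [e1]
      linear_combination (ι * (c - ι * s)) * e2 - s * V * e3 + ι * c * V' * e4 +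
        (-s * (z * (y ^ k * V + ι * (z ^ k * W'))) - c * (y * (y ^ k * W))) * hι
    · rw [e1]
      linear_combination (-ι * (c - ι * s)) * e2 - s * V' * e4 + ι * c * V * e3 +
        (-s * (y * (z ^ k * V' + ι * (y ^ k * W))) - c * (z * (z ^ k * W'))) * hι

/-- `v (z ^ 2) = z ^ N * B ((z + 1 / z) / 2)`. -/
def IsLift (N : ℕ) (B v : ℝ[X]) : Prop :=
  ∀ z y : ℂ, z * y = 1 → aeval (z ^ 2) v = z ^ N * aeval ((z + y) / 2) B

/-- Adding the identities for both signs of `δ` cancels `q`, and adding those for `ι = i` and `ι =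
-i` cancels the second real polynomial. What remains is `y^N v(z²) + z^N v(y²) = 2 B(x)`. -/
theorem signalPoly_add_eq {N : ℕ} {B : ℝ[X]} {φ : ℕ → ℝ} (hφ : ∀ i, φ (2 * i + 1) = -φ (2 * i))
    (hv : IsLift N B (phasePoly (fun i => φ (2 * i)) 0 N).1) :
    (signalPoly (fun i => Complex.exp (φ (2 * i) * Complex.I))
        (fun i => Complex.exp (φ (2 * i + 1) * Complex.I)) (-Complex.I) 0 N).1
      + (signalPoly (fun i => Complex.exp (φ (2 * i + 1) * Complex.I))
        (fun i => Complex.exp (φ (2 * i) * Complex.I)) Complex.I 0 N).1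
      = 2 * B.map Complex.ofRealHom := by
  have hexp : ∀ i, Complex.exp (φ (2 * i) * Complex.I)
      = Real.cos (φ (2 * i)) + Complex.I * Real.sin (φ (2 * i)) := by
    intro i
    rw [Complex.exp_mul_I, Complex.ofReal_cos, Complex.ofReal_sin, mul_comm Complex.I]
  have hexp' : ∀ i, Complex.exp (φ (2 * i + 1) * Complex.I)
      = Real.cos (φ (2 * i)) - Complex.I * Real.sin (φ (2 * i)) := by
    intro i
    rw [hφ, Complex.exp_mul_I, Complex.ofReal_cos, Complex.ofReal_sin, mul_comm Complex.I,
      Complex.ofReal_neg, Complex.cos_neg, Complex.sin_neg]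
    ring
  refine Polynomial.funext fun x => ?_
  -- Every complex `x` has the form `(z + y)/2` with `z y = 1`: take `z = x + w`, `y = x - w`, where
  -- `w² = x² - 1`.
  obtain ⟨w, hw⟩ := IsAlgClosed.exists_eq_mul_self (x ^ 2 - 1)
  have hzy : (x + w) * (x - w) = 1 := by linear_combination hw
  have hx : ((x + w) + (x - w)) / 2 = x := by ring
  have hyz : (x - w) * (x + w) = 1 := by rw [mul_comm]; exact hzy
  have h1 := signalPoly_eval (ψ := fun i => φ (2 * i)) (ι := Complex.I) Complex.I_sq hexp hexp' hzy 0 N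
  have h2 := signalPoly_eval (ψ := fun i => φ (2 * i)) (ι := -Complex.I) (by simp)
    (fun i => (hexp' i).trans (by ring)) (fun i => (hexp i).trans (by ring)) hzy 0 N
  have h3 := hv _ _ hzy
  have h4 := hv _ _ hyz
  rw [neg_neg] at h2
  rw [hx] at h1 h2 h3
  rw [add_comm (x - w), hx] at h4
  have h5 : (x - w) ^ N * (x + w) ^ N = 1 := by rw [← mul_pow, hyz, one_pow]
  rw [eval_add, eval_mul, eval_map, show eval₂ Complex.ofRealHom x B = aeval x B from rfl]
  rw [h3, h4] at h1 h2
  have : eval x (2 : ℂ[X]) = 2 := by simp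
  rw [this]
  linear_combination (h1.1 + h1.2 + h2.1 + h2.2) / 2 + 2 * aeval x B * h5

/-- The polynomials in Horner's scheme for the lift of `B`. -/
def hornerLift (N : ℕ) (B : ℝ[X]) : ℕ → ℝ[X]
  | 0 => C (B.coeff N)
  | i + 1 => C (1 / 2) * (hornerLift N B i + X * hornerLift N B i)
      + C (B.coeff (N - (i + 1))) * X ^ ((i + 2) / 2)

theorem natDegree_hornerLift_le (N : ℕ) (B : ℝ[X]) (i : ℕ) :
    (hornerLift N B i).natDegree ≤ i := by
  induction i with
  | zero => simp [hornerLift]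
  | succ i ih =>
    rw [hornerLift]
    refine (natDegree_add_le _ _).trans (max_le ?_ ?_)
    · refine (natDegree_C_mul_le _ _).trans ((natDegree_add_le _ _).trans (max_le (by omega) ?_))
      refine natDegree_mul_le.trans ?_
      rw [natDegree_X]; omega
    · refine (natDegree_C_mul_X_pow_le _ _).trans (by omega)

theorem Admissible.coeff_eq_zero {N : ℕ} {B : ℝ[X]} (hB : Admissible N B) {j : ℕ}
    (hj : (N + j) % 2 = 1) : B.coeff j = 0 := by
  have h : B.comp (C (-1) * X) = C ((-1) ^ N) * B := Polynomial.funext fun x => by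
    simpa using hB.parity x
  have h1 := congrArg (fun p => coeff p j) h
  simp only [comp_C_mul_X_coeff, coeff_C_mul] at h1
  have h2 : ((-1 : ℝ) ^ N) * (-1) ^ j = -1 := by
    rw [← pow_add, Odd.neg_one_pow (Nat.odd_iff.mpr hj)]
  have h3 : ((-1 : ℝ) ^ N) * (-1) ^ N = 1 := by
    rw [← pow_add, Even.neg_one_pow ⟨N, rfl⟩]
  linear_combination (-1 / 2) * (-1 : ℝ) ^ N * h1 + (1 / 2) * B.coeff j * h2 - (1 / 2) * B.coeff j * h3

/-- A Horner step multiplies by `x`, and `z x = (z² + 1)/2` is a polynomial in `z²`. After `i` steps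
the value is `z^i` times the partial Horner sum, so each new coefficient enters with a power of `z`
that is even whenever the coefficient is nonzero. -/
theorem isLift_hornerLift {N : ℕ} {B : ℝ[X]} (hB : Admissible N B) :
    IsLift N B (hornerLift N B N) := by
  intro z y hzy
  have key : ∀ i ≤ N, aeval (z ^ 2) (hornerLift N B i)
      = z ^ i * ∑ j ∈ Finset.range (i + 1), (B.coeff (N - j) : ℂ) * ((z + y) / 2) ^ (i - j) := by
    intro i hi
    induction i with
    | zero => simp [hornerLift]
    | succ i ih =>
      have hterm : (B.coeff (N - (i + 1)) : ℂ) * (z ^ 2) ^ ((i + 2) / 2)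
          = z ^ (i + 1) * B.coeff (N - (i + 1)) := by
        -- For even `i` the new coefficient vanishes by parity and the rounded exponent is
        -- irrelevant; for odd `i` the division is exact.
        rcases Nat.mod_two_eq_zero_or_one i with h | h
        · rw [hB.coeff_eq_zero (by omega)]; simp
        · rw [← pow_mul, show 2 * ((i + 2) / 2) = i + 1 by omega, mul_comm]
      rw [Finset.sum_range_succ, hornerLift]
      have hs : ∑ j ∈ Finset.range (i + 1), (B.coeff (N - j) : ℂ) * ((z + y) / 2) ^ (i + 1 - j)
          = (z + y) / 2 * ∑ j ∈ Finset.range (i + 1), (B.coeff (N - j) : ℂ) * ((z + y) / 2) ^ (i - j) := by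
        rw [Finset.mul_sum]
        refine Finset.sum_congr rfl fun j hj => ?_
        rw [Finset.mem_range] at hj
        rw [show i + 1 - j = (i - j) + 1 by omega, pow_succ]
        ring
      simp only [map_add, map_mul, aeval_C, aeval_X, map_pow, Complex.coe_algebraMap,
        ih (by omega)]
      rw [hterm, hs]
      push_cast
      simp only [Nat.sub_self, pow_zero]
      generalize ∑ j ∈ Finset.range (i + 1), (B.coeff (N - j) : ℂ) * ((z + y) / 2) ^ (i - j) = S
      linear_combination (-1 / 2) * z ^ i * S * hzy
  rw [key N le_rfl, aeval_eq_sum_range' (Nat.lt_succ_of_le hB.degree)]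
  congr 1
  rw [← Finset.sum_range_reflect]
  refine Finset.sum_congr rfl fun j hj => ?_
  rw [Finset.mem_range] at hj
  rw [show N - (N + 1 - 1 - j) = j by omega, Complex.real_smul]

end

end FlexQSP

namespace FlexQSP

/-! ## Spectral factorization -/

open Polynomial

theorem eval_reflect {K : Type*} [Field K] {N : ℕ} {f : K[X]} (hf : f.natDegree ≤ N) {u : K}
    (hu : u ≠ 0) : (reflect N f).eval u = u ^ N * f.eval u⁻¹ := by
  have h1 : (reflect N f).natDegree < N + 1 := by
    have := natDegree_reflect_le (N := N) (p := f)
    omega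
  rw [eval_eq_sum_range' h1, eval_eq_sum_range' (Nat.lt_succ_of_le hf), ← Finset.sum_range_reflect,
    Finset.mul_sum]
  refine Finset.sum_congr rfl fun j hj => ?_
  rw [Finset.mem_range] at hj
  rw [show N + 1 - 1 - j = N - j by omega, coeff_reflect, revAt_le (by omega),
    show N - (N - j) = j by omega, inv_pow, pow_sub₀ _ hu (by omega)]
  ring

/-- `(z + 1/z)/2` is invariant under `z ↦ 1/z`, so `u^N v(1/u) = v(u)`; squares of positive reals
suffice to identify the polynomials. -/
theorem IsLift.reflect_eq {N : ℕ} {B v : ℝ[X]} (hv : IsLift N B v) (hd : v.natDegree ≤ N) :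
    reflect N v = v := by
  have key : ∀ x : ℝ, 0 < x → (reflect N v).eval (x ^ 2) = v.eval (x ^ 2) := by
    intro x hx
    have hx' : (x : ℂ) ≠ 0 := by exact_mod_cast hx.ne'
    have h1 := hv x (x : ℂ)⁻¹ (mul_inv_cancel₀ hx')
    have h2 := hv (x : ℂ)⁻¹ x (inv_mul_cancel₀ hx')
    rw [add_comm] at h2
    have h3 : ∀ y : ℝ, aeval (y : ℂ) v = ((v.eval y : ℝ) : ℂ) := fun y => by
      rw [← Complex.coe_algebraMap, aeval_algebraMap_apply]; simp
    rw [eval_reflect hd (by positivity)]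
    have h4 : ((v.eval (x ^ 2) : ℝ) : ℂ) = x ^ N * aeval (((x : ℂ) + (x : ℂ)⁻¹) / 2) B := by
      rw [← h1, ← h3]; push_cast; rfl
    have h5 : ((v.eval ((x ^ 2)⁻¹) : ℝ) : ℂ)
        = (x : ℂ)⁻¹ ^ N * aeval (((x : ℂ) + (x : ℂ)⁻¹) / 2) B := by
      rw [← h2, ← h3]; push_cast; rw [inv_pow]
    have h6 : (((x ^ 2) ^ N * v.eval ((x ^ 2)⁻¹) : ℝ) : ℂ) = ((v.eval (x ^ 2) : ℝ) : ℂ) := by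
      rw [Complex.ofReal_mul, h5, h4, Complex.ofReal_pow, Complex.ofReal_pow, inv_pow, ← mul_assoc]
      congr 1
      field_simp
      ring
    exact_mod_cast h6
  refine eq_of_infinite_eval_eq _ _ (Set.Infinite.mono (s := Set.Ioi 0) ?_ (Set.Ioi_infinite 0))
  intro y hy
  have := key (Real.sqrt y) (Real.sqrt_pos.mpr hy)
  rwa [Real.sq_sqrt (le_of_lt hy)] at this

/-- `X ^ N - v * v`, the polynomial to be factored. -/
theorem reflect_remainder {N : ℕ} {v : ℝ[X]} (hd : v.natDegree ≤ N) (hv : reflect N v = v) :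
    reflect (2 * N) (X ^ N - v * v) = X ^ N - v * v := by
  have h1 : reflect (2 * N) (v * v) = v * v := by
    rw [two_mul, reflect_mul v v hd hd, hv]
  have h2 : reflect (2 * N) (X ^ N : ℝ[X]) = X ^ N := by
    rw [reflect_monomial, revAt_le (by omega)]
    congr 1; omega
  have h3 := reflect_add (X ^ N - v * v) (v * v) (2 * N)
  rw [sub_add_cancel, h1, h2] at h3
  exact eq_sub_of_add_eq h3.symm

/-- The reflection of a product of linear factors. -/
theorem reflect_multiset_prod {K : Type*} [Field K] (s : Multiset K) :
    reflect s.card (s.map fun a => X - C a).prod = (s.map fun a => 1 - C a * X).prod := by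
  induction s using Multiset.induction with
  | empty => simp
  | cons a s ih =>
    rw [Multiset.map_cons, Multiset.prod_cons, Multiset.card_cons, add_comm,
      reflect_mul _ _ (natDegree_X_sub_C_le a) (natDegree_multiset_prod_X_sub_C_eq_card s).le, ih,
      Multiset.map_cons, Multiset.prod_cons]
    congr 1
    have h3 := reflect_add (X - C a) (C a) 1
    rw [sub_add_cancel, reflect_one_X, reflect_C, pow_one] at h3
    rw [h3]; ring

/-- Reversing the factorization `(X - r)^k Q` gives `(1 - rX)^k` times the reversal of `Q`, and `1 -
rX` is a multiple of `X - 1/r`. -/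
theorem pow_inv_dvd_of_reflect_eq {N k : ℕ} {G : ℂ[X]} (hd : G.natDegree ≤ N)
    (hG : reflect N G = G) {r : ℂ} (hr : r ≠ 0) (h : (X - C r) ^ k ∣ G) :
    (X - C r⁻¹) ^ k ∣ G := by
  rcases eq_or_ne G 0 with h0 | h0
  · rw [h0]; exact dvd_zero _
  obtain ⟨Q, hQ⟩ := h
  have hQ0 : Q ≠ 0 := by rintro rfl; exact h0 (by rw [hQ, mul_zero])
  have hdeg : G.natDegree = k + Q.natDegree := by
    rw [hQ, natDegree_mul (pow_ne_zero _ (X_sub_C_ne_zero r)) hQ0, natDegree_pow, natDegree_X_sub_C,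
      mul_one]
  have h1 : reflect k ((X - C r) ^ k) = (1 - C r * X) ^ k := by
    simpa using reflect_multiset_prod (Multiset.replicate k r)
  have h2 : G = (1 - C r * X) ^ k * reflect (N - k) Q := by
    conv_lhs => rw [← hG, hQ, show N = k + (N - k) by omega]
    rw [reflect_mul _ _ (by simp [natDegree_pow]) (by omega), h1]
  have h3 : (1 - C r * X) = C (-r) * (X - C r⁻¹) := by
    rw [mul_sub, ← C_mul, neg_mul, mul_inv_cancel₀ hr, C_neg, C_neg, C_1]; ring
  rw [h2, h3, mul_pow]
  exact Dvd.dvd.mul_right (Dvd.intro_left _ rfl) _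

theorem rootMultiplicity_inv {N : ℕ} {G : ℂ[X]} (hd : G.natDegree ≤ N)
    (hG : reflect N G = G) {r : ℂ} (hr : r ≠ 0) :
    G.rootMultiplicity r⁻¹ = G.rootMultiplicity r := by
  rcases eq_or_ne G 0 with h0 | h0
  · simp [h0]
  refine le_antisymm ?_ ?_
  · rw [le_rootMultiplicity_iff h0]
    simpa using pow_inv_dvd_of_reflect_eq hd hG (inv_ne_zero hr) (pow_rootMultiplicity_dvd G r⁻¹)
  · rw [le_rootMultiplicity_iff h0]
    exact pow_inv_dvd_of_reflect_eq hd hG hr (pow_rootMultiplicity_dvd G r)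

theorem rootMultiplicity_conj (G : ℝ[X]) (r : ℂ) :
    (G.map Complex.ofRealHom).rootMultiplicity (starRingEnd ℂ r)
      = (G.map Complex.ofRealHom).rootMultiplicity r := by
  rcases eq_or_ne G 0 with h0 | h0
  · simp [h0]
  have h0' : G.map Complex.ofRealHom ≠ 0 :=
    (Polynomial.map_ne_zero_iff Complex.ofRealHom.injective).mpr h0
  have key : ∀ r : ℂ, (G.map Complex.ofRealHom).rootMultiplicity r
      ≤ (G.map Complex.ofRealHom).rootMultiplicity (starRingEnd ℂ r) := by
    intro r
    rw [le_rootMultiplicity_iff h0']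
    have h := Polynomial.map_dvd (starRingEnd ℂ) (pow_rootMultiplicity_dvd (G.map Complex.ofRealHom) r)
    have hc : (G.map Complex.ofRealHom).map (starRingEnd ℂ) = G.map Complex.ofRealHom := by
      rw [Polynomial.map_map]
      congr 1
      ext x
      simp
    rw [hc] at h
    simpa using h
  exact le_antisymm (by simpa using key (starRingEnd ℂ r)) (key r)

/-- Roots on the unit circle have even multiplicity if the polynomial is, up to a power of the
variable, nonnegative on the unit circle. -/
theorem even_rootMultiplicity {N : ℕ} {G : ℂ[X]} (h0 : G ≠ 0) {g : ℝ → ℝ} (hg : ∀ θ, 0 ≤ g θ)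
    (hG : ∀ θ : ℝ, G.eval (Complex.exp (2 * θ * Complex.I))
      = Complex.exp (2 * N * θ * Complex.I) * g θ) {r : ℂ} (hr : ‖r‖ = 1) :
    Even (G.rootMultiplicity r) := by
  by_contra hodd
  rw [Nat.not_even_iff_odd] at hodd
  obtain ⟨Q, hQ, hQr⟩ := exists_eq_pow_rootMultiplicity_mul_and_not_dvd G h0 r
  set k := G.rootMultiplicity r
  rw [dvd_iff_isRoot, IsRoot.def] at hQr
  -- The circle is parametrized by `exp (2iθ)`, so `θ = t` is the parameter of `r`.
  set t : ℝ := r.arg / 2 with ht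
  have hrt : r = Complex.exp (2 * t * Complex.I) := by
    have := Complex.norm_mul_exp_arg_mul_I r
    rw [hr, Complex.ofReal_one, one_mul] at this
    refine this.symm.trans (congrArg Complex.exp ?_)
    rw [ht]; push_cast; ring
  -- The quotient of `g` by `sin (θ - t) ^ k`: it is continuous, and nonzero at `t` because `Q r ≠
  -- 0`. For odd `k` the sine power changes sign at `t` while `g ≥ 0`, so the one-sided limits of
  -- `h` force `h t = 0`.
  set h : ℝ → ℂ := fun θ => Complex.exp (-(2 * N * θ * Complex.I))
    * (2 * Complex.I * Complex.exp ((θ + t) * Complex.I)) ^ k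
    * Q.eval (Complex.exp (2 * θ * Complex.I)) with hh
  have hht : h t ≠ 0 := by
    rw [hh]
    simp only
    rw [← hrt]
    refine mul_ne_zero (mul_ne_zero (Complex.exp_ne_zero _) (pow_ne_zero _ ?_)) hQr
    exact mul_ne_zero (mul_ne_zero two_ne_zero Complex.I_ne_zero) (Complex.exp_ne_zero _)
  have hcont : Continuous h := by
    have := Q.continuous
    fun_prop
  have hgh : ∀ θ : ℝ, (g θ : ℂ) = ((Real.sin (θ - t) ^ k : ℝ) : ℂ) * h θ := by
    intro θ
    have e1 : Complex.exp (2 * θ * Complex.I) - r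
        = 2 * Complex.I * Complex.exp ((θ + t) * Complex.I) * Real.sin (θ - t) := by
      rw [hrt, Complex.ofReal_sin, Complex.sin]
      have a1 : Complex.exp (2 * θ * Complex.I)
          = Complex.exp ((θ + t) * Complex.I) * Complex.exp (((θ - t : ℝ) : ℂ) * Complex.I) := by
        rw [← Complex.exp_add]; congr 1; push_cast; ring
      have a2 : Complex.exp (2 * t * Complex.I)
          = Complex.exp ((θ + t) * Complex.I) * Complex.exp (-((θ - t : ℝ) : ℂ) * Complex.I) := by
        rw [← Complex.exp_add]; congr 1; push_cast; ring
      rw [a1, a2]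
      linear_combination -(Complex.exp ((θ + t) * Complex.I) *
        (Complex.exp (-((θ - t : ℝ) : ℂ) * Complex.I) - Complex.exp (((θ - t : ℝ) : ℂ) * Complex.I)))
          * Complex.I_sq
    have e2 : Complex.exp (-(2 * N * θ * Complex.I)) * Complex.exp (2 * N * θ * Complex.I) = 1 := by
      rw [← Complex.exp_add]; simp
    have e3 := hG θ
    rw [hQ, eval_mul, eval_pow, eval_sub, eval_X, eval_C, e1] at e3
    calc (g θ : ℂ) = Complex.exp (-(2 * N * θ * Complex.I)) *
          (Complex.exp (2 * N * θ * Complex.I) * g θ) := by rw [← mul_assoc, e2, one_mul]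
      _ = _ := by rw [← e3, hh, mul_pow]; push_cast; ring
  have hsin : ∀ s : ℝ, 0 < s → s < 1 → 0 < Real.sin s := fun s h1 h2 =>
    Real.sin_pos_of_pos_of_lt_pi h1 (by linarith [Real.pi_gt_three])
  have hright : ∀ s : ℝ, 0 < s → s < 1 → 0 ≤ (h (t + s)).re ∧ (h (t + s)).im = 0 := by
    intro s h1 h2
    have e := hgh (t + s)
    rw [add_sub_cancel_left] at e
    have hp : 0 < Real.sin s ^ k := pow_pos (hsin s h1 h2) k
    have e1 := congrArg Complex.re e
    have e2 := congrArg Complex.im e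
    rw [Complex.re_ofReal_mul, Complex.ofReal_re] at e1
    rw [Complex.im_ofReal_mul, Complex.ofReal_im] at e2
    have := hg (t + s)
    refine ⟨?_, ?_⟩
    · rw [e1] at this; exact nonneg_of_mul_nonneg_right this hp
    · rcases mul_eq_zero.mp e2.symm with h3 | h3
      · exact absurd h3 hp.ne'
      · exact h3
  have hleft : ∀ s : ℝ, 0 < s → s < 1 → (h (t - s)).re ≤ 0 := by
    intro s h1 h2
    have e := hgh (t - s)
    rw [sub_sub_cancel_left, Real.sin_neg, hodd.neg_pow] at e
    have hp : 0 < Real.sin s ^ k := pow_pos (hsin s h1 h2) k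
    have e1 := congrArg Complex.re e
    rw [Complex.re_ofReal_mul, Complex.ofReal_re] at e1
    have := hg (t - s)
    nlinarith
  have hlimr : Filter.Tendsto (fun s : ℝ => h (t + s)) (nhdsWithin 0 (Set.Ioi 0)) (nhds (h t)) := by
    have : Filter.Tendsto (fun s : ℝ => h (t + s)) (nhds 0) (nhds (h (t + 0))) :=
      (hcont.comp (continuous_const.add continuous_id)).tendsto 0
    rw [add_zero] at this
    exact this.mono_left nhdsWithin_le_nhds
  have hliml : Filter.Tendsto (fun s : ℝ => h (t - s)) (nhdsWithin 0 (Set.Ioi 0)) (nhds (h t)) := by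
    have : Filter.Tendsto (fun s : ℝ => h (t - s)) (nhds 0) (nhds (h (t - 0))) :=
      (hcont.comp (continuous_const.sub continuous_id)).tendsto 0
    rw [sub_zero] at this
    exact this.mono_left nhdsWithin_le_nhds
  have hev : ∀ᶠ s : ℝ in nhdsWithin 0 (Set.Ioi 0), 0 < s ∧ s < 1 := by
    filter_upwards [Ioo_mem_nhdsGT (zero_lt_one (α := ℝ))] with s hs using hs
  have i1 : 0 ≤ (h t).re := ge_of_tendsto ((Complex.continuous_re.tendsto _).comp hlimr)
    (hev.mono fun s hs => (hright s hs.1 hs.2).1)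
  have i2 : (h t).im = 0 := by
    refine tendsto_nhds_unique ((Complex.continuous_im.tendsto _).comp hlimr) ?_
    exact tendsto_const_nhds.congr' (hev.mono fun s hs => (hright s hs.1 hs.2).2.symm)
  have i3 : (h t).re ≤ 0 := le_of_tendsto ((Complex.continuous_re.tendsto _).comp hliml)
    (hev.mono fun s hs => hleft s hs.1 hs.2)
  exact hht (Complex.ext (le_antisymm i3 i1) i2)

end FlexQSP

/-! ### Selection of half of the roots and the spectral factor -/

namespace FlexQSP

open Polynomial

/-- Half of the roots: those inside the unit disc, and every second one of those on the unit circle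
(the first argument says whether the next one is skipped). -/
noncomputable def selectRoots : ℕ → List ℂ → List ℂ
  | _, [] => []
  | p, r :: l =>
    if Complex.normSq r < 1 then r :: selectRoots p l
    else if 1 < Complex.normSq r then selectRoots p l
    else if p < 1 then r :: selectRoots 1 l
    else selectRoots 0 l

/-- Makes it harmless to pad a root list of unknown length by numbers outside the disc. -/
theorem selectRoots_append (l l' : List ℂ) (h : ∀ r ∈ l', 1 < Complex.normSq r) (p : ℕ) :
    selectRoots p (l ++ l') = selectRoots p l := by
  induction l generalizing p with
  | nil =>
    induction l' generalizing p with
    | nil => rfl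
    | cons r l' ih =>
      have hr := h r (by simp)
      have := ih (fun x hx => h x (by simp [hx])) p
      simp only [List.nil_append, selectRoots] at this ⊢
      rw [if_neg (by linarith), if_pos hr, this]
  | cons r l ih => simp only [List.cons_append, selectRoots, ih]

open Classical in
theorem count_selectRoots_of_ne (l : List ℂ) {r : ℂ} (hr : Complex.normSq r ≠ 1) (p : ℕ) :
    (selectRoots p l).count r = if Complex.normSq r < 1 then l.count r else 0 := by
  induction l generalizing p with
  | nil => simp [selectRoots]
  | cons a l ih =>
    rw [selectRoots]
    by_cases hra : a = r
    · subst hra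
      rcases lt_or_gt_of_ne hr with h | h
      · rw [if_pos h, List.count_cons_self, ih, if_pos h, if_pos h, List.count_cons_self]
      · rw [if_neg h.le.not_gt, if_pos h, ih]
        simp [h.le.not_gt]
    · rw [List.count_cons_of_ne hra]
      split_ifs <;> simp_all [List.count_cons_of_ne]

-- Sorting makes equal entries on the circle consecutive among the circle entries, and even
-- multiplicities let them be grouped in equal pairs. Alternately keeping and skipping then keeps
-- one entry of each pair.
open Classical in
theorem count_selectRoots_of_eq (l : List ℂ)
    (hl : l.Pairwise fun a b => toLex (a.re, a.im) ≤ toLex (b.re, b.im))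
    (heven : ∀ r, Complex.normSq r = 1 → Even (l.count r)) {r : ℂ} (hr : Complex.normSq r = 1) :
    (selectRoots 0 l).count r = l.count r / 2 := by
  -- Roots off the circle do not touch the alternation, so they may be discarded even if they stand
  -- between two equal circle roots.
  have hfilter : ∀ (l : List ℂ) (p : ℕ), (selectRoots p l).count r
      = (selectRoots p (l.filter fun a => Complex.normSq a = 1)).count r := by
    intro l
    induction l with
    | nil => intro p; rfl
    | cons a l ih =>
      intro p
      rcases lt_trichotomy (Complex.normSq a) 1 with h | h | h
      · have hra : a ≠ r := by rintro rfl; exact h.ne hr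
        rw [List.filter_cons_of_neg (by simpa using h.ne), selectRoots, if_pos h,
          List.count_cons_of_ne hra, ih]
      · rw [List.filter_cons_of_pos (by simpa using h), selectRoots, selectRoots]
        simp only [h, lt_irrefl, if_false]
        split_ifs
        · rw [List.count_cons, List.count_cons, ih]
        · exact ih 0
      · rw [List.filter_cons_of_neg (by simpa using h.ne'), selectRoots, if_neg h.le.not_gt,
          if_pos h, ih]
  have hcount : ∀ a, Complex.normSq a = 1 →
      (l.filter fun a => Complex.normSq a = 1).count a = l.count a := fun a ha =>
    List.count_filter (by simpa using ha)
  rw [hfilter, ← hcount r hr]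
  have hpair : (l.filter fun a => Complex.normSq a = 1).Pairwise
      fun a b => toLex (a.re, a.im) ≤ toLex (b.re, b.im) := hl.sublist List.filter_sublist
  have hmem : ∀ a ∈ l.filter fun a => Complex.normSq a = 1, Complex.normSq a = 1 := fun a ha => by
    simpa using (List.mem_filter.mp ha).2
  have hev : ∀ a, Even ((l.filter fun a => Complex.normSq a = 1).count a) := by
    intro a
    by_cases ha : Complex.normSq a = 1
    · rw [hcount a ha]; exact heven a ha
    · rw [List.count_eq_zero_of_not_mem fun h => ha (hmem a h)]
      exact Even.zero
  generalize l.filter (fun a => Complex.normSq a = 1) = c at hpair hmem hev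
  clear hcount hfilter heven hl
  induction hn : c.length using Nat.strong_induction_on generalizing c with
  | _ n ih =>
  match c, hn with
  | [], _ => simp [selectRoots]
  | [a], _ =>
    have := hev a
    simp at this
  | a :: b :: t, hn =>
    -- The head occurs at least twice; as the list is sorted, everything up to its second occurrence
    -- equals it.
    have hab : b = a := by
      by_contra hne
      have hat : a ∈ t := by
        by_contra hat
        have := hev a
        rw [List.count_cons_self, List.count_cons_of_ne hne, List.count_eq_zero_of_not_mem hat]
          at this
        simp at this
      have h1 : toLex (a.re, a.im) ≤ toLex (b.re, b.im) :=
        (List.pairwise_cons.mp hpair).1 b (by simp)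
      have h2 : toLex (b.re, b.im) ≤ toLex (a.re, a.im) :=
        (List.pairwise_cons.mp (List.pairwise_cons.mp hpair).2).1 a hat
      have h3 := toLex.injective (le_antisymm h1 h2)
      rw [Prod.ext_iff] at h3
      exact hne (Complex.ext h3.1.symm h3.2.symm)
    subst hab
    have ha := hmem b (by simp)
    simp only [selectRoots, ha, lt_irrefl, if_false, zero_lt_one, if_true]
    have hc : ∀ x, (b :: b :: t).count x = t.count x + 2 * if b = x then 1 else 0 := by
      intro x
      rw [List.count_cons, List.count_cons]
      by_cases hx : b = x <;> simp [hx]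
    have := ih t.length (by simp at hn; omega) t
      (List.pairwise_cons.mp (List.pairwise_cons.mp hpair).2).2 (fun x hx => hmem x (by simp [hx]))
      (fun x => by
        have := hev x
        rw [hc] at this
        exact (Nat.even_add.mp this).mpr (even_two_mul _)) rfl
    rw [hc, List.count_cons, this]
    by_cases hx : b = r <;> simp [hx]

/-- The coefficient sequence is a palindrome of length `N + 1`, so as many coefficients vanish at
the top as at the bottom. Roots at zero are thus paired with missing degree, i.e. with roots at
infinity. -/
theorem natDegree_add_natTrailingDegree_of_reflect_eq {N : ℕ} {G : ℂ[X]} (h0 : G ≠ 0)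
    (hd : G.natDegree ≤ N) (hG : reflect N G = G) : G.natDegree + G.natTrailingDegree = N := by
  have hc : ∀ i ≤ N, G.coeff (N - i) = G.coeff i := fun i hi => by
    conv_rhs => rw [← hG, coeff_reflect, revAt_le hi]
  have h1 : G.natTrailingDegree ≤ N - G.natDegree := by
    refine natTrailingDegree_le_of_ne_zero ?_
    rw [hc _ hd]
    exact leadingCoeff_ne_zero.mpr h0
  have h2 : N - G.natTrailingDegree ≤ G.natDegree := by
    refine le_natDegree_of_ne_zero ?_
    rw [hc _ ((natTrailingDegree_le_natDegree G).trans hd)]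
    exact mt trailingCoeff_eq_zero.mp h0
  omega

open Classical in
/-- The inverses of the nonzero elements. -/
noncomputable def invRoots (s : Multiset ℂ) : Multiset ℂ := (s.filter (· ≠ 0)).map (·⁻¹)

/-- A nonzero `a` gives `1 - aX = -a (X - 1/a)`, and `a = 0` gives the factor `1`. -/
theorem exists_prod_one_sub (s : Multiset ℂ) : ∃ μ : ℂ,
    (s.map fun a => 1 - C a * X).prod = C μ * ((invRoots s).map fun a => X - C a).prod := by
  classical
  induction s using Multiset.induction with
  | empty => exact ⟨1, by simp [invRoots]⟩
  | cons a s ih =>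
    obtain ⟨μ, hμ⟩ := ih
    by_cases ha : a = 0
    · refine ⟨μ, ?_⟩
      rw [Multiset.map_cons, Multiset.prod_cons, hμ, invRoots, invRoots,
        Multiset.filter_cons_of_neg _ (by simpa using ha), ha]
      simp
    · refine ⟨-a * μ, ?_⟩
      rw [Multiset.map_cons, Multiset.prod_cons, hμ, invRoots, invRoots,
        Multiset.filter_cons_of_pos (p := fun x : ℂ => x ≠ 0) s ha, Multiset.map_cons, Multiset.map_cons, Multiset.prod_cons]
      have h3 : (1 - C a * X) = C (-a) * (X - C a⁻¹) := by
        rw [mul_sub, ← C_mul, neg_mul, mul_inv_cancel₀ ha, C_neg, C_neg, C_1]; ring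
      rw [h3, C_mul]
      ring

open Classical in
theorem count_invRoots (s : Multiset ℂ) (r : ℂ) :
    (invRoots s).count r = if r = 0 then 0 else s.count r⁻¹ := by
  split_ifs with h
  · rw [Multiset.count_eq_zero, invRoots, h]
    simp
  · conv_lhs => rw [← inv_inv r]
    rw [invRoots, Multiset.count_map_eq_count' _ _ inv_injective,
      Multiset.count_filter_of_pos (p := fun x : ℂ => x ≠ 0) (inv_ne_zero h)]

open Classical in
/-- Spectral factorization, up to normalization: the selected roots are those inside the unit disc,
and half of those on the unit circle. -/
theorem exists_spectral_factor {N : ℕ} {G : ℝ[X]} (hd : G.natDegree ≤ 2 * N)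
    (hrefl : reflect (2 * N) G = G) {g : ℝ → ℝ} (hg : ∀ θ, 0 ≤ g θ)
    (hG : ∀ θ : ℝ, (G.map Complex.ofRealHom).eval (Complex.exp (2 * θ * Complex.I))
      = Complex.exp (2 * N * θ * Complex.I) * g θ) (hone : G.eval (-1) = (-1) ^ N)
    {s : Multiset ℂ}
    (hin : ∀ r, Complex.normSq r < 1 → s.count r = (G.map Complex.ofRealHom).rootMultiplicity r)
    (hon : ∀ r, Complex.normSq r = 1 →
      s.count r = (G.map Complex.ofRealHom).rootMultiplicity r / 2)
    (hout : ∀ r, 1 < Complex.normSq r → s.count r = 0) :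
    ∃ w : ℝ[X], w.map Complex.ofRealHom = (s.map fun a => X - C a).prod ∧ w.natDegree ≤ N ∧
      w.eval (-1) ≠ 0 ∧ w * reflect N w = C (w.eval (-1) ^ 2) * G := by
  set Gc := G.map Complex.ofRealHom with hGc
  have hev : Gc.eval (-1) = (-1) ^ N := by
    have h1 := eval_map_apply Complex.ofRealHom (p := G) (-1)
    rw [hone] at h1
    simpa using h1
  have h0 : Gc ≠ 0 := by
    intro h
    rw [h, eval_zero] at hev
    exact pow_ne_zero N (neg_ne_zero.mpr one_ne_zero) hev.symm
  have hdc : Gc.natDegree ≤ 2 * N := natDegree_map_le.trans hd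
  have hreflc : reflect (2 * N) Gc = Gc := by rw [hGc, reflect_map, hrefl]
  have hinv : ∀ r : ℂ, r ≠ 0 → Gc.rootMultiplicity r⁻¹ = Gc.rootMultiplicity r :=
    fun r hr => rootMultiplicity_inv hdc hreflc hr
  -- Inversion maps the selected roots to the rest: inside to outside, and on the circle half of the
  -- multiplicity to the other half. Zero is selected in full and has no inverse.
  have hroots : Gc.roots = s + invRoots s := by
    ext r
    rw [Multiset.count_add, count_invRoots, count_roots]
    by_cases hr0 : r = 0
    · rw [if_pos hr0, hin r (by simp [hr0]), add_zero]
    rw [if_neg hr0]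
    have hpos : 0 < Complex.normSq r := Complex.normSq_pos.mpr hr0
    rcases lt_trichotomy (Complex.normSq r) 1 with h | h | h
    · rw [hin r h, hout r⁻¹ (by rw [Complex.normSq_inv]; exact (one_lt_inv₀ hpos).mpr h), add_zero]
    · rw [hon r h, hon r⁻¹ (by rw [Complex.normSq_inv, h, inv_one]), hinv r hr0]
      have := even_rootMultiplicity h0 hg hG (r := r) (by
        rw [Complex.normSq_eq_norm_sq] at h
        nlinarith [norm_nonneg r])
      obtain ⟨k, hk⟩ := this
      omega
    · rw [hout r h, hin r⁻¹ (by rw [Complex.normSq_inv]; exact inv_lt_one_of_one_lt₀ h), hinv r hr0,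
        zero_add]
  -- Zero roots are counted in `s` but not in `invRoots s`; the deficit is the trailing degree, so
  -- `2 * s.card = 2 * N`.
  have hcard : s.card = N := by
    have h1 : Gc.roots.card = Gc.natDegree := (IsAlgClosed.splits Gc).natDegree_eq_card_roots.symm
    have h2 := natDegree_add_natTrailingDegree_of_reflect_eq h0 hdc hreflc
    have h3 : s.count 0 = Gc.natTrailingDegree := by
      rw [hin 0 (by simp), rootMultiplicity_eq_natTrailingDegree']
    have h4 : (invRoots s).card + s.count 0 = s.card := by
      have h5 := congrArg Multiset.card (Multiset.filter_add_not (fun a : ℂ => a ≠ 0) s)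
      rw [Multiset.card_add] at h5
      rw [invRoots, Multiset.card_map, ← h5, Multiset.count, Multiset.countP_eq_card_filter]
      congr 3
      ext a
      simp [eq_comm]
    rw [hroots, Multiset.card_add] at h1
    omega
  set wc := (s.map fun a => X - C a).prod with hwc
  -- The selection depends only on modulus and multiplicity, so it is closed under conjugation and
  -- the product has real coefficients.
  have hlift : wc ∈ lifts Complex.ofRealHom := by
    have hs : s.map (starRingEnd ℂ) = s := by
      ext r
      have h1 : (s.map (starRingEnd ℂ)).count r = s.count (starRingEnd ℂ r) := by
        conv_lhs => rw [← Complex.conj_conj r]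
        exact Multiset.count_map_eq_count' _ _ (starRingEnd ℂ).injective _
      rw [h1]
      have h2 := rootMultiplicity_conj G r
      rcases lt_trichotomy (Complex.normSq r) 1 with h | h | h
      · rw [hin r h, hin _ (by rwa [Complex.normSq_conj]), h2]
      · rw [hon r h, hon _ (by rwa [Complex.normSq_conj]), h2]
      · rw [hout r h, hout _ (by rwa [Complex.normSq_conj])]
    have hconj : wc.map (starRingEnd ℂ) = wc := by
      conv_rhs => rw [hwc, ← hs]
      rw [hwc, Polynomial.map_multiset_prod, Multiset.map_map, Multiset.map_map]
      congr 2
      funext a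
      simp
    rw [lifts_iff_coeff_lifts]
    intro k
    have h1 := congrArg (fun p => coeff p k) hconj
    simp only [coeff_map] at h1
    obtain ⟨x, hx⟩ := Complex.conj_eq_iff_real.mp h1
    exact ⟨x, hx.symm⟩
  obtain ⟨w, hw⟩ := (mem_lifts _).mp hlift
  have hdeg : wc.natDegree = N := by
    rw [hwc, natDegree_multiset_prod_X_sub_C_eq_card, hcard]
  have hwd : w.natDegree ≤ N := by
    rw [← hdeg, ← hw, natDegree_map_eq_of_injective Complex.ofRealHom.injective]
  have hprod : ∃ μ : ℂ, wc * reflect N wc = C μ * Gc := by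
    obtain ⟨μ, hμ⟩ := exists_prod_one_sub s
    have h1 : reflect N wc = (s.map fun a => 1 - C a * X).prod := by
      rw [← hcard]; exact reflect_multiset_prod s
    have h2 := (IsAlgClosed.splits Gc).eq_prod_roots
    rw [hroots, Multiset.map_add, Multiset.prod_add] at h2
    refine ⟨μ * Gc.leadingCoeff⁻¹, ?_⟩
    rw [h1, hμ]
    have h3 : (C Gc.leadingCoeff⁻¹ : ℂ[X]) * C Gc.leadingCoeff = 1 := by
      rw [← C_mul, inv_mul_cancel₀ (leadingCoeff_ne_zero.mpr h0), C_1]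
    rw [C_mul]
    linear_combination (-(C μ * C Gc.leadingCoeff⁻¹)) * h2
      - (C μ * wc * ((invRoots s).map fun a => X - C a).prod) * h3
  obtain ⟨μ, hμ⟩ := hprod
  have hwev : wc.eval (-1) = ((w.eval (-1) : ℝ) : ℂ) := by
    have h1 := eval_map_apply Complex.ofRealHom (p := w) (-1)
    rw [hw] at h1
    simpa using h1
  have hne : w.eval (-1) ≠ 0 := by
    intro h
    rw [h, Complex.ofReal_zero] at hwev
    have hmem : (-1 : ℂ) ∈ s := by
      rw [← roots_multiset_prod_X_sub_C s, ← hwc, mem_roots']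
      refine ⟨?_, hwev⟩
      rw [hwc]
      exact (monic_multiset_prod_of_monic _ _ fun a _ => monic_X_sub_C a).ne_zero
    have h2 : Gc.IsRoot (-1) := by
      refine ((mem_roots' (p := Gc)).mp ?_).2
      rw [hroots]
      exact Multiset.mem_add.mpr (Or.inl hmem)
    rw [IsRoot.def, hev] at h2
    exact pow_ne_zero N (neg_ne_zero.mpr one_ne_zero) h2
  -- At `-1`, which is its own inverse, `w w*` takes the value `(-1)^N w(-1)²`, and `G` takes the
  -- value `(-1)^N`.
  have hμ' : μ = ((w.eval (-1) : ℝ) : ℂ) ^ 2 := by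
    have h1 := congrArg (eval (-1)) hμ
    rw [eval_mul, eval_mul, eval_C, hev, eval_reflect hdeg.le (by norm_num), hwev,
      inv_neg, inv_one, hwev] at h1
    have h2 : ((-1 : ℂ) ^ N) * (-1) ^ N = 1 := by
      rw [← pow_add, Even.neg_one_pow ⟨N, rfl⟩]
    linear_combination (-(-1 : ℂ) ^ N) * h1 + ((w.eval (-1) : ℝ) ^ 2 - μ : ℂ) * h2
  refine ⟨w, hw, hwd, hne, map_injective _ Complex.ofRealHom.injective ?_⟩
  rw [Polynomial.map_mul, ← reflect_map, hw, hμ, hμ', Polynomial.map_mul, map_C, ← hGc]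
  simp

/-! ## Computation of the angles -/

/-- The pair of polynomials of degree at most `n` has squared norm one on the unit circle. -/
structure NormOne (n : ℕ) (v w : ℝ[X]) : Prop where
  left : v.natDegree ≤ n
  right : w.natDegree ≤ n
  norm : v * reflect n v + w * reflect n w = X ^ n

/-- The direction `(cos ψ, sin ψ)` of the next angle. -/
noncomputable def direction (n : ℕ) (v w : ℝ[X]) : ℝ × ℝ :=
  if 0 < v.coeff 0 * v.coeff 0 + w.coeff 0 * w.coeff 0 then
    (v.coeff 0 / √(v.coeff 0 * v.coeff 0 + w.coeff 0 * w.coeff 0),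
      w.coeff 0 / √(v.coeff 0 * v.coeff 0 + w.coeff 0 * w.coeff 0))
  else if 0 < v.coeff n * v.coeff n + w.coeff n * w.coeff n then
    (w.coeff n / √(v.coeff n * v.coeff n + w.coeff n * w.coeff n),
      (0 - v.coeff n) / √(v.coeff n * v.coeff n + w.coeff n * w.coeff n))
  else (1, 0)

/-- The angle with given cosine and sine. -/
noncomputable def angle (c s : ℝ) : ℝ := if s < 0 then 0 - Real.arccos c else Real.arccos c

/-- Removal of one angle. -/
noncomputable def peel (n : ℕ) (v w : ℝ[X]) : ℝ[X] × ℝ[X] :=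
  (C (direction n v w).2 * v.divX - C (direction n v w).1 * w.divX,
    C (direction n v w).1 * v + C (direction n v w).2 * w)

theorem cos_sin_angle {c s : ℝ} (h : c ^ 2 + s ^ 2 = 1) :
    Real.cos (angle c s) = c ∧ Real.sin (angle c s) = s := by
  have hc1 : -1 ≤ c := by nlinarith [sq_nonneg s]
  have hc2 : c ≤ 1 := by nlinarith [sq_nonneg s]
  have hs : √(1 - c ^ 2) = |s| := by rw [← h, add_sub_cancel_left, Real.sqrt_sq_eq_abs]
  rw [angle]
  split_ifs with h0
  · rw [zero_sub, Real.cos_neg, Real.sin_neg, Real.cos_arccos hc1 hc2, Real.sin_arccos, hs,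
      abs_of_neg h0]
    simp
  · rw [Real.cos_arccos hc1 hc2, Real.sin_arccos, hs, abs_of_nonneg (not_lt.mp h0)]
    simp

theorem sqrt_div_sq {a b : ℝ} (h : 0 < a * a + b * b) :
    (a / √(a * a + b * b)) ^ 2 + (b / √(a * a + b * b)) ^ 2 = 1 := by
  rw [div_pow, div_pow, Real.sq_sqrt h.le, ← add_div, div_eq_one_iff_eq h.ne']
  ring

theorem direction_sq (n : ℕ) (v w : ℝ[X]) :
    (direction n v w).1 ^ 2 + (direction n v w).2 ^ 2 = 1 := by
  rw [direction]
  split_ifs with h1 h2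
  · exact sqrt_div_sq h1
  · rw [add_comm, zero_sub, neg_div, neg_sq]; exact sqrt_div_sq h2
  · norm_num

theorem direction_mul_zero (n : ℕ) (v w : ℝ[X]) :
    (direction n v w).2 * v.coeff 0 = (direction n v w).1 * w.coeff 0 := by
  rw [direction]
  by_cases h1 : 0 < v.coeff 0 * v.coeff 0 + w.coeff 0 * w.coeff 0
  · rw [if_pos h1]; simp only; ring
  · have hv : v.coeff 0 = 0 := by
      nlinarith [mul_self_nonneg (v.coeff 0), mul_self_nonneg (w.coeff 0)]
    have hw : w.coeff 0 = 0 := by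
      nlinarith [mul_self_nonneg (v.coeff 0), mul_self_nonneg (w.coeff 0)]
    rw [hv, hw, mul_zero, mul_zero]

/-- The constant coefficient of a reversal is the top coefficient, and `X ^ (n + 1)` has constant
coefficient zero: bottom and top coefficient vectors are orthogonal. -/
theorem NormOne.coeff_mul {n : ℕ} {v w : ℝ[X]} (h : NormOne (n + 1) v w) :
    v.coeff 0 * v.coeff (n + 1) + w.coeff 0 * w.coeff (n + 1) = 0 := by
  have := congrArg (fun p => coeff p 0) h.norm
  simpa [mul_coeff_zero, coeff_reflect] using this

/-- A single unit vector has to be parallel to the bottom coefficients and orthogonal to the top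
ones. The orthogonality of these two vectors makes both demands compatible; if one vector vanishes,
the other alone decides. -/
theorem direction_mul_top {n : ℕ} {v w : ℝ[X]} (h : NormOne (n + 1) v w) :
    (direction (n + 1) v w).1 * v.coeff (n + 1) + (direction (n + 1) v w).2 * w.coeff (n + 1)
      = 0 := by
  have h0 := h.coeff_mul
  rw [direction]
  split_ifs with h1 h2
  · simp only
    rw [div_mul_eq_mul_div, div_mul_eq_mul_div, ← add_div, h0, zero_div]
  · simp only
    ring
  · have hv : v.coeff (n + 1) = 0 := by
      nlinarith [mul_self_nonneg (v.coeff (n + 1)), mul_self_nonneg (w.coeff (n + 1))]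
    have hw : w.coeff (n + 1) = 0 := by
      nlinarith [mul_self_nonneg (v.coeff (n + 1)), mul_self_nonneg (w.coeff (n + 1))]
    rw [hv, hw, mul_zero, mul_zero, add_zero]

/-- Up to a reflection, `peel` is a rotation by the chosen angle followed by division of one
component by `X`; that division is exact by `direction_mul_zero`. -/
theorem peel_inverse (n : ℕ) (v w : ℝ[X]) :
    v = C (direction n v w).1 * (peel n v w).2 + C (direction n v w).2 * (X * (peel n v w).1) ∧
    w = C (direction n v w).2 * (peel n v w).2
      - C (direction n v w).1 * (X * (peel n v w).1) := by
  have h1 := congrArg C (direction_sq n v w)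
  have h2 := congrArg C (direction_mul_zero n v w)
  have hv := divX_mul_X_add v
  have hw := divX_mul_X_add w
  rw [peel]
  simp only [C_add, C_pow, C_mul, C_1] at h1 h2
  generalize (C (direction n v w).1 : ℝ[X]) = c at *
  generalize (C (direction n v w).2 : ℝ[X]) = s at *
  constructor
  · linear_combination (-v) * h1 - s * s * hv + s * c * hw + s * h2
  · linear_combination (-w) * h1 + c * s * hv - c * c * hw - c * h2

/-- A plane orthogonal transformation with constant entries preserves `v v* + w w*`. In the new
components the sum is `X` times the corresponding sum at degree `n`, so `X` can be cancelled. The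
degree drops because `X` divides one component and the top coefficient of the other vanishes. -/
theorem NormOne.peel {n : ℕ} {v w : ℝ[X]} (h : NormOne (n + 1) v w) :
    NormOne n (peel (n + 1) v w).1 (peel (n + 1) v w).2 := by
  obtain ⟨hv, hw⟩ := peel_inverse (n + 1) v w
  have hsq := congrArg C (direction_sq (n + 1) v w)
  have hleft : (FlexQSP.peel (n + 1) v w).1.natDegree ≤ n := by
    have hdiv : ∀ p : ℝ[X], p.natDegree ≤ n + 1 → p.divX.natDegree ≤ n := fun p hp => by
      rw [natDegree_divX_eq_natDegree_tsub_one]; omega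
    exact (natDegree_sub_le _ _).trans (max_le
      ((natDegree_C_mul_le _ _).trans (hdiv v h.left))
      ((natDegree_C_mul_le _ _).trans (hdiv w h.right)))
  have hright : (FlexQSP.peel (n + 1) v w).2.natDegree ≤ n := by
    have h1 : (FlexQSP.peel (n + 1) v w).2.natDegree ≤ n + 1 :=
      (natDegree_add_le _ _).trans (max_le ((natDegree_C_mul_le _ _).trans h.left)
        ((natDegree_C_mul_le _ _).trans h.right))
    rw [natDegree_le_iff_coeff_eq_zero] at h1 ⊢
    intro k hk
    rcases Nat.lt_or_ge (n + 1) k with hk' | hk'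
    · exact h1 k hk'
    · obtain rfl : k = n + 1 := by omega
      simpa [FlexQSP.peel] using direction_mul_top h
  refine ⟨hleft, hright, ?_⟩
  have hn := h.norm
  generalize hc : direction (n + 1) v w = cs at *
  generalize (FlexQSP.peel (n + 1) v w).1 = a at *
  generalize (FlexQSP.peel (n + 1) v w).2 = b at *
  have e1 : reflect (n + 1) (X * a) = reflect n a := by
    rw [add_comm n 1, reflect_mul X a natDegree_X_le hleft, reflect_one_X, one_mul]
  have e2 : reflect (n + 1) b = X * reflect n b := by
    have := reflect_mul (1 : ℝ[X]) b (F := 1) (by simp) hright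
    rw [one_mul, reflect_one, pow_one, add_comm 1 n] at this
    exact this
  have e3 : reflect (n + 1) (C cs.2 * b - C cs.1 * (X * a))
      = C cs.2 * reflect (n + 1) b - C cs.1 * reflect (n + 1) (X * a) := by
    rw [sub_eq_add_neg, ← neg_mul, ← C_neg, reflect_add, reflect_C_mul, reflect_C_mul, C_neg]
    ring
  rw [hw, e3, hv, reflect_add, reflect_C_mul, reflect_C_mul, e1, e2] at hn
  simp only [C_add, C_pow, C_1] at hsq
  have hX : X * (a * reflect n a + b * reflect n b) = X * (X ^ n : ℝ[X]) := by
    rw [← pow_succ', ← hn]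
    linear_combination (-(X * (a * reflect n a + b * reflect n b))) * hsq
  exact mul_left_cancel₀ X_ne_zero hX

/-- The pair of polynomials after removal of `k` angles. -/
noncomputable def peelSeq (N : ℕ) (v w : ℝ[X]) : ℕ → ℝ[X] × ℝ[X]
  | 0 => (v, w)
  | k + 1 => peel (N - k) (peelSeq N v w k).1 (peelSeq N v w k).2

/-- The angles. -/
noncomputable def angleSeq (N : ℕ) (v w : ℝ[X]) (k : ℕ) : ℝ :=
  angle (direction (N - k) (peelSeq N v w k).1 (peelSeq N v w k).2).1
    (direction (N - k) (peelSeq N v w k).1 (peelSeq N v w k).2).2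

theorem NormOne.peelSeq {N : ℕ} {v w : ℝ[X]} (h : NormOne N v w) {k : ℕ} (hk : k ≤ N) :
    NormOne (N - k) (peelSeq N v w k).1 (peelSeq N v w k).2 := by
  induction k with
  | zero => exact h
  | succ k ih =>
    have := ih (by omega)
    rw [FlexQSP.peelSeq]
    rw [show N - k = (N - (k + 1)) + 1 by omega] at this ⊢
    exact this.peel

/-- Each stage of the recursion for `phasePoly` is the inverse of one peeling, so the pair is
rebuilt from the last angle upwards. -/
theorem phasePoly_angleSeq {N : ℕ} {v w : ℝ[X]} (h : NormOne N v w) {ψ : ℕ → ℝ}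
    (hψ : ∀ k ≤ N, ψ k = angleSeq N v w k) : phasePoly ψ 0 N = (v, w) := by
  have key : ∀ j ≤ N, phasePoly ψ (N - j) j = peelSeq N v w (N - j) := by
    intro j hj
    induction j with
    | zero =>
      -- At degree zero the pair is a constant unit vector, which is its own direction.
      have hn := h.peelSeq (le_refl N)
      obtain ⟨hc, hs⟩ := cos_sin_angle (direction_sq (N - N) (peelSeq N v w N).1 (peelSeq N v w N).2)
      rw [phasePoly, Nat.sub_zero, hψ N le_rfl, angleSeq, hc, hs]
      rw [Nat.sub_self] at hn ⊢
      generalize peelSeq N v w N = p at *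
      have h1 := hn.norm
      rw [eq_C_of_natDegree_le_zero hn.left, eq_C_of_natDegree_le_zero hn.right] at h1
      simp only [reflect_C, pow_zero, mul_one, ← C_mul, ← C_add] at h1
      have h2 : p.1.coeff 0 * p.1.coeff 0 + p.2.coeff 0 * p.2.coeff 0 = 1 := by
        rw [← C_1] at h1
        exact C_injective h1
      rw [direction, h2, if_pos one_pos, Real.sqrt_one, div_one, div_one]
      exact Prod.ext (eq_C_of_natDegree_le_zero hn.left).symm
        (eq_C_of_natDegree_le_zero hn.right).symm
    | succ j ih =>
      have hstep : N - (j + 1) + 1 = N - j := by omega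
      obtain ⟨hc, hs⟩ := cos_sin_angle (direction_sq (N - (N - (j + 1)))
        (peelSeq N v w (N - (j + 1))).1 (peelSeq N v w (N - (j + 1))).2)
      have hp : peelSeq N v w (N - j) = peel (N - (N - (j + 1))) (peelSeq N v w (N - (j + 1))).1
          (peelSeq N v w (N - (j + 1))).2 := by rw [← hstep]; rfl
      rw [phasePoly, hstep, ih (by omega), hψ _ (by omega), angleSeq, hc, hs, hp]
      obtain ⟨hv, hw⟩ := peel_inverse (N - (N - (j + 1))) (peelSeq N v w (N - (j + 1))).1
        (peelSeq N v w (N - (j + 1))).2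
      exact Prod.ext hv.symm hw.symm
  have := key N le_rfl
  rwa [Nat.sub_self] at this

end FlexQSP

namespace FlexQSP

open Polynomial

/-! ## The complementary polynomial -/

theorem map_eval_ofReal (G : ℝ[X]) (x : ℝ) :
    aeval (x : ℂ) G = ((G.eval x : ℝ) : ℂ) := by
  rw [← Complex.coe_algebraMap, aeval_algebraMap_apply]; simp

/-- With `z = exp (iθ)` the lift at `z²` is `z^N B(cos θ)`, so `z^{2N}` factors out. -/
theorem IsLift.remainder_eval {N : ℕ} {B v : ℝ[X]} (hv : IsLift N B v) (θ : ℝ) :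
    ((X ^ N - v * v).map Complex.ofRealHom).eval (Complex.exp (2 * θ * Complex.I))
      = Complex.exp (2 * N * θ * Complex.I) * ((1 - B.eval (Real.cos θ) ^ 2 : ℝ) : ℂ) := by
  have hzy : Complex.exp (θ * Complex.I) * Complex.exp (-(θ * Complex.I)) = 1 := by
    rw [← Complex.exp_add, add_neg_cancel, Complex.exp_zero]
  have h1 := hv _ _ hzy
  have hcos : (Complex.exp (θ * Complex.I) + Complex.exp (-(θ * Complex.I))) / 2
      = (Real.cos θ : ℂ) := by
    rw [Complex.ofReal_cos, Complex.cos, neg_mul]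
  have hz : Complex.exp (2 * θ * Complex.I) = Complex.exp (θ * Complex.I) ^ 2 := by
    rw [← Complex.exp_nat_mul]; push_cast; ring_nf
  have hzN : Complex.exp (2 * N * θ * Complex.I) = (Complex.exp (θ * Complex.I) ^ N) ^ 2 := by
    rw [← pow_mul, ← Complex.exp_nat_mul]; push_cast; ring_nf
  rw [hcos, map_eval_ofReal] at h1
  rw [eval_map, show ∀ x : ℂ, eval₂ Complex.ofRealHom x (X ^ N - v * v) = aeval x (X ^ N - v * v)
    from fun _ => rfl, hz, hzN]
  simp only [map_sub, map_mul, map_pow, aeval_X, h1]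
  push_cast
  ring

/-- The choice `z = i` gives `z² = -1` and `(z + 1/z)/2 = 0`; hence `v(-1) = 0`. -/
theorem IsLift.remainder_eval_neg_one {N : ℕ} {B v : ℝ[X]} (hv : IsLift N B v)
    (hB : B.eval 0 = 0) : (X ^ N - v * v).eval (-1) = (-1) ^ N := by
  have h1 := hv Complex.I (-Complex.I) (by simp)
  have h2 : aeval ((0 : ℝ) : ℂ) B = 0 := by rw [map_eval_ofReal, hB, Complex.ofReal_zero]
  rw [add_neg_cancel, zero_div, ← Complex.ofReal_zero, h2, mul_zero, Complex.I_sq,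
    show (-1 : ℂ) = ((-1 : ℝ) : ℂ) by simp, map_eval_ofReal, Complex.ofReal_eq_zero] at h1
  simp [h1]

/-- The list of the complex roots. -/
noncomputable def complexRoots (c : ℕ → ℝ) (k : ℕ) : List ℂ :=
  (rootList c k).map fun z => ⟨(ofLex z).1, (ofLex z).2⟩

theorem sum_monomial_eq_map {c : ℕ → ℝ} {k : ℕ} {G : ℝ[X]} (hd : G.natDegree ≤ k)
    (hc : ∀ i ≤ k, c i = G.coeff i) :
    ∑ i ∈ Finset.range (k + 1), monomial i (c i : ℂ) = G.map Complex.ofRealHom := by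
  rw [as_sum_range' (G.map Complex.ofRealHom) (k + 1)
    (Nat.lt_succ_of_le (natDegree_map_le.trans hd))]
  refine Finset.sum_congr rfl fun i hi => ?_
  rw [hc i (by simpa [Nat.lt_succ_iff] using hi), coeff_map]
  rfl

theorem coe_complexRoots {c : ℕ → ℝ} {k : ℕ} {G : ℝ[X]} (hd : G.natDegree ≤ k)
    (hc : ∀ i ≤ k, c i = G.coeff i) :
    (complexRoots c k : Multiset ℂ) = (G.map Complex.ofRealHom).roots := by
  rw [complexRoots, ← Multiset.map_coe, rootList, Multiset.sort_eq, sum_monomial_eq_map hd hc,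
    Multiset.map_map]
  exact Multiset.map_id' _

theorem pairwise_complexRoots (c : ℕ → ℝ) (k : ℕ) :
    (complexRoots c k).Pairwise fun a b => toLex (a.re, a.im) ≤ toLex (b.re, b.im) := by
  rw [complexRoots, List.pairwise_map]
  exact Multiset.pairwise_sort (Multiset.map (fun z : ℂ => toLex (z.re, z.im)) _) (· ≤ ·)

theorem length_rootList_le {c : ℕ → ℝ} {k : ℕ} {G : ℝ[X]} (hd : G.natDegree ≤ k)
    (hc : ∀ i ≤ k, c i = G.coeff i) : (rootList c k).length ≤ k := by
  have h := congrArg Multiset.card (coe_complexRoots hd hc)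
  rw [Multiset.coe_card, complexRoots, List.length_map] at h
  rw [h]
  exact (card_roots' _).trans (natDegree_map_le.trans hd)

/-- Only the square of the normalizing factor `e` matters, because `w` occurs quadratically in
`NormOne`. The program may therefore use either sign of `w(-1)`. -/
theorem exists_normOne {N : ℕ} {B : ℝ[X]} (hB : Admissible N B) {c : ℕ → ℝ}
    (hc : ∀ i ≤ 2 * N, c i = (X ^ N - hornerLift N B N * hornerLift N B N).coeff i) :
    ∃ w : ℝ[X], w.map Complex.ofRealHom
        = ((selectRoots 0 (complexRoots c (2 * N))).map fun a => X - C a).prod ∧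
      w.natDegree ≤ N ∧
      ∀ e : ℝ, e ^ 2 = w.eval (-1) ^ 2 → NormOne N (hornerLift N B N) (C e⁻¹ * w) := by
  classical
  have hv := isLift_hornerLift hB
  have hvd := natDegree_hornerLift_le N B N
  generalize hornerLift N B N = v at *
  have hrefl := hv.reflect_eq hvd
  have hd : (X ^ N - v * v).natDegree ≤ 2 * N := by
    refine (natDegree_sub_le _ _).trans (max_le ?_ (natDegree_mul_le.trans (by omega)))
    rw [natDegree_X_pow]; omega
  have hroots := coe_complexRoots hd hc
  have hcount : ∀ r, (complexRoots c (2 * N)).count r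
      = ((X ^ N - v * v).map Complex.ofRealHom).rootMultiplicity r := fun r => by
    rw [← Multiset.coe_count, hroots, count_roots]
  have hg : ∀ θ : ℝ, 0 ≤ 1 - B.eval (Real.cos θ) ^ 2 := fun θ =>
    sub_nonneg.mpr (hB.bound _ ⟨Real.neg_one_le_cos θ, Real.cos_le_one θ⟩)
  have hone := hv.remainder_eval_neg_one hB.zero
  have h0 : (X ^ N - v * v).map Complex.ofRealHom ≠ 0 := by
    rw [Ne, Polynomial.map_eq_zero]
    intro h
    rw [h, eval_zero] at hone
    exact pow_ne_zero N (neg_ne_zero.mpr one_ne_zero) hone.symm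
  obtain ⟨w, hw, hwd, hne, hww⟩ := exists_spectral_factor hd (reflect_remainder hvd hrefl) hg
    hv.remainder_eval hone (s := (selectRoots 0 (complexRoots c (2 * N)) : Multiset ℂ))
    (fun r hr => by
      rw [Multiset.coe_count, count_selectRoots_of_ne _ hr.ne, if_pos hr, hcount])
    (fun r hr => by
      rw [Multiset.coe_count, count_selectRoots_of_eq _ (pairwise_complexRoots _ _) ?_ hr, hcount]
      intro r hr
      rw [hcount]
      refine even_rootMultiplicity h0 hg hv.remainder_eval ?_
      rw [Complex.normSq_eq_norm_sq] at hr
      nlinarith [norm_nonneg r])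
    (fun r hr => by
      rw [Multiset.coe_count, count_selectRoots_of_ne _ hr.ne', if_neg hr.le.not_gt])
  rw [Multiset.map_coe, Multiset.prod_coe] at hw
  refine ⟨w, hw, hwd, fun e he => ⟨hvd, (natDegree_C_mul_le _ _).trans hwd, ?_⟩⟩
  have he0 : e ^ 2 ≠ 0 := by rw [he]; exact pow_ne_zero 2 hne
  have h3 : (C (e⁻¹ * e⁻¹ * w.eval (-1) ^ 2) : ℝ[X]) = 1 := by
    rw [← he, ← C_1]; congr 1; field_simp [pow_ne_zero_iff two_ne_zero |>.mp he0]
  rw [C_mul, C_mul] at h3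
  rw [reflect_C_mul, hrefl]
  linear_combination (C e⁻¹ * C e⁻¹) * hww + (X ^ N - v * v) * h3

end FlexQSP

namespace FlexQSP

open Polynomial

/-! ## Verification of programs -/

/-- Started in the memory `s`, the program halts after at most `T` steps, in a memory that
satisfies `Q`. -/
def Halts (P : Program) (s : Mem) (T : ℕ) (Q : Mem → Prop) : Prop :=
  ∃ t s', Exec P s t s' ∧ t ≤ T ∧ Q s'

namespace Halts

variable {P P' : Program} {s : Mem} {T T' : ℕ} {Q Q' : Mem → Prop}

theorem mono (h : Halts P s T Q) (hT : T ≤ T') (hQ : ∀ s, Q s → Q' s) : Halts P s T' Q' := by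
  obtain ⟨t, s', he, ht, hq⟩ := h
  exact ⟨t, s', he, ht.trans hT, hQ _ hq⟩

theorem skip (h : Q s) : Halts .skip s 1 Q := ⟨_, _, .skip s, le_rfl, h⟩

theorem setNat {x : ℕ} {e : NExp} (h : Q (s.setNat x (e.eval s))) : Halts (.setNat x e) s 1 Q :=
  ⟨_, _, .setNat s x e, le_rfl, h⟩

theorem setReal {a : ℕ} {i : NExp} {e : RExp} (h : Q (s.setReal a (i.eval s) (e.eval s))) :
    Halts (.setReal a i e) s 1 Q :=
  ⟨_, _, .setReal s a i e, le_rfl, h⟩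

/-- The postcondition of the first program is that the second one halts. Verification thus composes
by nesting, and the time bounds add up. -/
theorem seq (h : Halts P s T fun s' => Halts P' s' T' Q) : Halts (.seq P P') s (T + T') Q := by
  obtain ⟨t, s', he, ht, t', s'', he', ht', hq⟩ := h
  exact ⟨_, _, .seq he he', Nat.add_le_add ht ht', hq⟩

theorem ite {b : Test} (h1 : b.Holds s → Halts P s T Q) (h2 : ¬ b.Holds s → Halts P' s T Q) :
    Halts (.ite b P P') s (T + 1) Q := by
  by_cases hb : b.Holds s
  · obtain ⟨t, s', he, ht, hq⟩ := h1 hb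
    exact ⟨_, _, .iteTrue hb he, Nat.add_le_add_right ht 1, hq⟩
  · obtain ⟨t, s', he, ht, hq⟩ := h2 hb
    exact ⟨_, _, .iteFalse hb he, Nat.add_le_add_right ht 1, hq⟩

theorem loop {b : Test} {I : ℕ → Mem → Prop} {M : ℕ} (h0 : I 0 s)
    (hstep : ∀ i < M, ∀ s, I i s → b.Holds s ∧ Halts P s T (I (i + 1)))
    (hend : ∀ s, I M s → ¬ b.Holds s) : Halts (.loop b P) s (M * (T + 1) + 1) (I M) := by
  -- Induction on the number `j` of remaining iterations.
  have key : ∀ j ≤ M, ∀ s, I (M - j) s → Halts (.loop b P) s (j * (T + 1) + 1) (I M) := by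
    intro j
    induction j with
    | zero =>
      intro _ s hs
      exact ⟨_, _, .loopFalse (hend s hs), by omega, hs⟩
    | succ j ih =>
      intro hj s hs
      obtain ⟨hb, t, s', he, ht, hq⟩ := hstep (M - (j + 1)) (by omega) s hs
      rw [show M - (j + 1) + 1 = M - j by omega] at hq
      obtain ⟨t', s'', he', ht', hq'⟩ := ih (by omega) s' hq
      exact ⟨_, _, .loopTrue hb he he', by rw [Nat.succ_mul]; omega, hq'⟩
  exact key M le_rfl s (by rwa [Nat.sub_self])

end Halts

/-- Counting loop: the register `x` runs from `0` to the value of `e`. -/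
def forLoop (x : ℕ) (e : NExp) (P : Program) : Program :=
  .seq (.setNat x (.lit 0))
    (.loop (.natLt (.reg x) e) (.seq P (.setNat x (.add (.reg x) (.lit 1)))))

theorem Halts.forLoop {x : ℕ} {e : NExp} {P : Program} {s : Mem} {T M : ℕ} {I : ℕ → Mem → Prop}
    (h0 : I 0 (s.setNat x 0)) (he : ∀ i s, I i s → s.nat x = i ∧ e.eval s = M)
    (hstep : ∀ i < M, ∀ s, I i s → Halts P s T fun s' => I (i + 1) (s'.setNat x (s'.nat x + 1))) :
    Halts (forLoop x e P) s (M * (T + 2) + 2) (I M) := by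
  refine (Halts.seq (Halts.setNat (Halts.loop (T := T + 1) h0 ?_ ?_))).mono (by
    rw [show T + 1 + 1 = T + 2 from rfl]; omega) fun _ => id
  · intro i hi s hs
    refine ⟨?_, Halts.seq ((hstep i hi s hs).mono le_rfl fun s' hs' => Halts.setNat hs')⟩
    rw [Test.Holds, NExp.eval, (he i s hs).1, (he i s hs).2]
    exact hi
  · intro s hs
    rw [Test.Holds, NExp.eval, (he M s hs).1, (he M s hs).2]
    exact lt_irrefl M

/-- Fill the positions from `off` on of the array `dst` with the values of `e`; register `1` is the
counter, and register `4` holds the number of entries. -/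
def fill (dst off : ℕ) (e : RExp) : Program :=
  forLoop 1 (.reg 4) (.setReal dst (.add (.reg 1) (.lit off)) e)

/-- After `k` rounds the positions below `k + off` hold the target and the others are unchanged. The
hypothesis `he` is stated in this intermediate memory because `e` may read `dst` itself. -/
theorem Halts.fill {dst off : ℕ} {e : RExp} {s : Mem} {m : ℕ} (target : ℕ → ℝ) {Q : Mem → Prop}
    (hm : s.nat 4 = m)
    (he : ∀ k < m, e.eval ⟨Function.update s.nat 1 k, Function.update s.arr dst
      fun j => if j < k + off then target j else s.arr dst j⟩ = target (k + off))
    (hold : ∀ j, j < off ∨ m + off ≤ j → s.arr dst j = target j)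
    (hQ : Q ⟨Function.update s.nat 1 m, Function.update s.arr dst target⟩) :
    Halts (fill dst off e) s (3 * m + 2) Q := by
  refine (Halts.forLoop (T := 1) (M := m) (I := fun k s' =>
    k ≤ m ∧ s' = ⟨Function.update s.nat 1 k, Function.update s.arr dst
      fun j => if j < k + off then target j else s.arr dst j⟩) ?_ ?_ ?_).mono (by omega) ?_
  · refine ⟨Nat.zero_le m, ?_⟩
    rw [Mem.setNat]
    congr 1
    refine (Function.update_eq_self_iff.mpr ?_).symm
    funext j
    split_ifs with h
    · exact (hold j (Or.inl (by omega))).symm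
    · rfl
  · rintro i s' ⟨hi, rfl⟩
    simp [NExp.eval, hm]
  · rintro i hi s' ⟨-, rfl⟩
    refine Halts.setReal ⟨hi, ?_⟩
    rw [he i hi]
    simp only [Mem.setReal, Mem.setNat, NExp.eval, Function.update_self, Function.update_idem]
    congr 2
    funext j
    rw [Function.update_apply]
    split_ifs <;> first | rfl | omega | (subst_vars; rfl)
  · rintro s' ⟨-, rfl⟩
    convert hQ using 4
    split_ifs with h
    · rfl
    · exact hold _ (Or.inr (by omega))

/-- Only the entries `1, …, m` may be nonzero. -/
def Short (m : ℕ) (g : ℕ → ℝ) : Prop := g 0 = 0 ∧ ∀ j, m < j → g j = 0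

/-- Entry `0` is kept at zero and serves as the coefficient of index `-1`: reading one position
lower is then multiplication by `X`, with no boundary case. -/
theorem Halts.fillOne {dst : ℕ} {e : RExp} {s : Mem} {m : ℕ} (target : ℕ → ℝ) {Q : Mem → Prop}
    (hm : s.nat 4 = m) (hs : Short m (s.arr dst)) (ht : Short m target)
    (he : ∀ k < m, e.eval ⟨Function.update s.nat 1 k, Function.update s.arr dst
      fun j => if j < k + 1 then target j else s.arr dst j⟩ = target (k + 1))
    (hQ : Q ⟨Function.update s.nat 1 m, Function.update s.arr dst target⟩) :
    Halts (FlexQSP.fill dst 1 e) s (3 * m + 2) Q := by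
  refine Halts.fill target hm he (fun j hj => ?_) hQ
  rcases hj with hj | hj
  · obtain rfl : j = 0 := by omega
    rw [hs.1, ht.1]
  · rw [hs.2 j (by omega), ht.2 j (by omega)]

/-- The coefficients of a polynomial as the entries `1, 2, …` of an array. -/
noncomputable def entries (A : ℝ[X]) (k : ℕ) : ℝ := (X * A).coeff k

@[simp] theorem entries_zero (A : ℝ[X]) : entries A 0 = 0 := by simp [entries]

@[simp] theorem entries_succ (A : ℝ[X]) (k : ℕ) : entries A (k + 1) = A.coeff k := by
  simp [entries]

theorem entries_eq_zero : entries 0 = 0 := by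
  funext k
  simp [entries]

theorem short_zero (m : ℕ) : Short m 0 := ⟨rfl, fun _ _ => rfl⟩

theorem short_entries {m : ℕ} {A : ℝ[X]} (h : A.natDegree < m) : Short m (entries A) := by
  refine ⟨entries_zero A, fun j hj => ?_⟩
  obtain ⟨k, rfl⟩ : ∃ k, j = k + 1 := ⟨j - 1, by omega⟩
  rw [entries_succ]
  exact coeff_eq_zero_of_natDegree_lt (by omega)

theorem update_entries (A : ℝ[X]) (h : ℕ) (b : ℝ) :
    Function.update (entries A) (h + 1) (A.coeff h + b) = entries (A + C b * X ^ h) := by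
  funext j
  rw [Function.update_apply]
  rcases j with _ | j
  · simp
  · rw [entries_succ, entries_succ, coeff_add, coeff_C_mul_X_pow]
    split_ifs <;> simp_all

/-- The entry of the array `a` at the position of the counter plus `off`. -/
def cell (a off : ℕ) : RExp := .read a (.add (.reg 1) (.lit off))

/-- Copy the entries `1, 2, …` of the array `a` to the array `dst`. -/
def copy (a dst : ℕ) : Program := fill dst 1 (cell a 1)

theorem Halts.copy {a dst : ℕ} {s : Mem} {m : ℕ} {Q : Mem → Prop} (hne : a ≠ dst)
    (hm : s.nat 4 = m) (hs : Short m (s.arr dst)) (ht : Short m (s.arr a))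
    (hQ : Q ⟨Function.update s.nat 1 m, Function.update s.arr dst (s.arr a)⟩) :
    Halts (copy a dst) s (3 * m + 2) Q := by
  refine Halts.fillOne _ hm hs ht (fun k _ => ?_) hQ
  simp [cell, RExp.eval, NExp.eval, Function.update_of_ne hne]

/-- Fill the entries `1, 2, …` of the array `dst` with the values of `e`, using the array `2` as a
buffer. -/
def assign (dst : ℕ) (e : RExp) : Program := .seq (fill 2 1 e) (copy 2 dst)

/-- The detour through array `2` is needed when `e` reads `dst` at a lower position than the one
written, since an ascending loop would already have overwritten it. So `he` leaves the buffer
contents `b` arbitrary. -/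
theorem Halts.assign {dst : ℕ} {e : RExp} {s : Mem} {m : ℕ} (g : ℕ → ℝ) {Q : Mem → Prop}
    (hne : 2 ≠ dst) (hm : s.nat 4 = m) (hb : Short m (s.arr 2)) (hs : Short m (s.arr dst))
    (hg : Short m g)
    (he : ∀ k < m, ∀ b, e.eval ⟨Function.update s.nat 1 k, Function.update s.arr 2 b⟩ = g (k + 1))
    (hQ : Q ⟨Function.update s.nat 1 m, Function.update (Function.update s.arr 2 g) dst g⟩) :
    Halts (assign dst e) s (6 * m + 4) Q := by
  refine (Halts.seq (Halts.fillOne g hm hb hg (fun k hk => he k hk _)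
    (Halts.copy hne (m := m) ?_ ?_ ?_ ?_))).mono (by omega) fun _ => id
  · simpa using hm
  · simpa [Function.update_of_ne hne.symm] using hs
  · simpa using hg
  · simpa using hQ

/-- The part of the memory that all parts of the program use: register `0` holds `N`, register `4`
the common length `2 * N + 1` of the arrays, the array `2` is a buffer, the arrays from `n` on have
not been used yet, and neither has the output array. -/
structure Frame (N n : ℕ) (s : Mem) : Prop where
  bound : s.nat 0 = N
  width : s.nat 4 = 2 * N + 1
  output : s.arr 1 = 0
  buffer : Short (2 * N + 1) (s.arr 2)
  fresh : ∀ a, n ≤ a → s.arr a = 0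

namespace Frame

variable {N n : ℕ} {s : Mem}

theorem mono {n' : ℕ} (h : Frame N n s) (hn : n ≤ n') : Frame N n' s :=
  { h with fresh := fun a ha => h.fresh a (hn.trans ha) }

theorem updateNat (h : Frame N n s) {x : ℕ} (hx0 : x ≠ 0) (hx4 : x ≠ 4) (v : ℕ) :
    Frame N n ⟨Function.update s.nat x v, s.arr⟩ :=
  { h with
    bound := by simp [Function.update_of_ne hx0.symm, h.bound]
    width := by simp [Function.update_of_ne hx4.symm, h.width] }

theorem updateArr (h : Frame N n s) {a : ℕ} (ha : 2 < a) (han : a < n) (g : ℕ → ℝ) :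
    Frame N n ⟨s.nat, Function.update s.arr a g⟩ :=
  { h with
    output := by simp [Function.update_of_ne (show 1 ≠ a by omega), h.output]
    buffer := by simpa [Function.update_of_ne (show 2 ≠ a by omega)] using h.buffer
    fresh := fun b hb => by simp [Function.update_of_ne (show b ≠ a by omega), h.fresh b hb] }

theorem updateBuffer (h : Frame N n s) (hn : 2 < n) {g : ℕ → ℝ} (hg : Short (2 * N + 1) g) :
    Frame N n ⟨s.nat, Function.update s.arr 2 g⟩ :=
  { h with
    output := by simp [h.output]
    buffer := by simpa using hg
    fresh := fun b hb => by simp [Function.update_of_ne (show b ≠ 2 by omega), h.fresh b hb] }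

end Frame

/-! ## The lift of the polynomial -/

/-- One step of Horner's scheme. -/
def hornerBody : Program :=
  .seq (assign 3 (.div (.add (cell 3 1) (cell 3 0)) (.lit 2)))
    (.seq
      (.ite (.natLt (.add (.reg 3) (.reg 3)) (.add (.reg 2) (.lit 1)))
        (.setNat 3 (.add (.reg 3) (.lit 1))) .skip)
      (.setReal 3 (.add (.reg 3) (.lit 1))
        (.add (.read 3 (.add (.reg 3) (.lit 1)))
          (.read 0 (.sub (.reg 0) (.add (.reg 2) (.lit 1)))))))

/-- Computes `hornerLift`. -/
def hornerProgram : Program :=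
  .seq (.setReal 3 (.lit 1) (.read 0 (.reg 0))) (forLoop 2 (.reg 0) hornerBody)

/-- The state of Horner's scheme after `i` steps. -/
structure HornerState (N : ℕ) (B : ℝ[X]) (i : ℕ) (s : Mem) : Prop where
  le : i ≤ N
  frame : Frame N 4 s
  coeffs : s.arr 0 = B.coeff
  counter : s.nat 2 = i
  half : s.nat 3 = (i + 1) / 2
  parity : s.nat 5 = 0
  lift : s.arr 3 = entries (hornerLift N B i)

theorem short_hornerLift {N : ℕ} {B : ℝ[X]} {i m : ℕ} (hi : i < m) :
    Short m (entries (hornerLift N B i)) :=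
  short_entries ((natDegree_hornerLift_le N B i).trans_lt hi)

theorem halts_hornerBody {N : ℕ} {B : ℝ[X]} {i : ℕ} (hi : i < N) {s : Mem}
    (h : HornerState N B i s) :
    Halts hornerBody s (12 * N + 13) fun s' =>
      HornerState N B (i + 1) (s'.setNat 2 (s'.nat 2 + 1)) := by
  have hdeg := natDegree_hornerLift_le N B i
  have hA := h.lift
  have hlift : hornerLift N B (i + 1) = C (1 / 2) * (hornerLift N B i + X * hornerLift N B i)
      + C (B.coeff (N - (i + 1))) * X ^ ((i + 2) / 2) := rfl
  have hAs := short_hornerLift (N := N) (B := B) (show i < 2 * N + 1 by omega)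
  generalize hornerLift N B i = A at hdeg hA hlift hAs
  set A' := C (1 / 2) * (A + X * A) with hA'
  have hgs : Short (2 * N + 1) (entries A') := by
    refine short_entries ?_
    refine (natDegree_C_mul_le _ _).trans_lt ((natDegree_add_le _ _).trans_lt (max_lt (by omega) ?_))
    refine natDegree_mul_le.trans_lt ?_
    rw [natDegree_X]
    omega
  -- The frame in the memory after the array assignment; the buffer then holds the new entries as
  -- well.
  have hfr := (((h.frame.updateNat (x := 1) (by decide) (by decide) (2 * N + 1)).updateBuffer
    (by decide) hgs).updateArr (a := 3) (by decide) (by decide) (entries A'))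
  refine (Halts.seq (Halts.assign (entries A') (by decide) h.frame.width h.frame.buffer
    (hA ▸ hAs) hgs ?_ (Halts.seq (T := 2) (T' := 1)
      ((Halts.ite (T := 1) (Q := fun s' => s' =
        ⟨Function.update (Function.update s.nat 1 (2 * N + 1)) 3 ((i + 2) / 2),
          Function.update (Function.update s.arr 2 (entries A')) 3 (entries A')⟩)
        (fun hb => Halts.setNat ?_) (fun hb => Halts.skip ?_)).mono le_rfl ?_)))).mono
      (by omega) fun _ => id
  · intro k hk b
    rcases k with _ | k <;>
    · simp [cell, RExp.eval, NExp.eval, hA, hA', coeff_X_mul]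
      ring
  -- Integer expressions offer only addition and subtraction, so `(i + 2) / 2` is maintained by
  -- raising register `3` whenever its double is less than `i + 1`.
  · simp [Test.Holds, NExp.eval, h.half, h.counter] at hb
    simp [Mem.setNat, NExp.eval, h.half]
    congr 1
    omega
  · simp [Test.Holds, NExp.eval, h.half, h.counter] at hb
    congr 1
    refine (Function.update_eq_self_iff.mpr ?_).symm
    simp [h.half]
    omega
  · rintro _ rfl
    refine Halts.setReal ?_
    have hfr' := ((hfr.updateNat (x := 3) (by decide) (by decide) ((i + 2) / 2)).updateArr (a := 3)
      (by decide) (by decide) (entries (hornerLift N B (i + 1)))).updateNat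
      (x := 2) (by decide) (by decide) (i + 1)
    simp only [Function.update_idem] at hfr'
    have hup := update_entries A' ((i + 2) / 2) (B.coeff (N - (i + 1)))
    rw [← hlift] at hup
    generalize hq : (i + 2) / 2 = q at hfr' hup ⊢
    simp [Mem.setReal, Mem.setNat, RExp.eval, NExp.eval, h.counter, h.coeffs, h.frame.bound, hup]
    exact ⟨hi, hfr', by simp [h.coeffs], by simp, by simp; omega, by simp [h.parity],
      by simp⟩

theorem halts_hornerProgram {N : ℕ} {B : ℝ[X]} {s : Mem} (hf : Frame N 3 s)
    (h0 : s.arr 0 = B.coeff) (h3 : s.nat 3 = 0) (h5 : s.nat 5 = 0) :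
    Halts hornerProgram s (N * (12 * N + 15) + 3) (HornerState N B N) := by
  refine (Halts.seq (Halts.setReal (Halts.forLoop (T := 12 * N + 13) (M := N)
    (I := HornerState N B) ?_ ?_ fun i hi s h => halts_hornerBody hi h))).mono
    (by rw [Nat.add_assoc (12 * N)]; omega)
    fun _ => id
  · have harr : Function.update (0 : ℕ → ℝ) 1 (B.coeff N) = entries (C (B.coeff N)) := by
      have := update_entries 0 0 (B.coeff N)
      simpa [entries_eq_zero] using this
    have hfr := ((hf.mono (show 3 ≤ 4 by decide)).updateArr (a := 3) (by decide) (by decide)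
      (entries (C (B.coeff N)))).updateNat (x := 2) (by decide) (by decide) 0
    simp [Mem.setReal, Mem.setNat, RExp.eval, NExp.eval, h0, hf.bound, hf.fresh 3 le_rfl, harr]
    exact ⟨Nat.zero_le N, hfr, by simp [h0], by simp, by simp [h3], by simp [h5],
      by simp [hornerLift]⟩
  · intro i s h
    exact ⟨h.counter, h.frame.bound⟩

end FlexQSP

namespace FlexQSP

open Polynomial

/-! ## The polynomial to be factored -/

/-- The coefficients of `v` from the `i`-th highest possible one on. -/
noncomputable def topPart (N : ℕ) (v : ℝ[X]) : ℕ → ℝ[X]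
  | 0 => 0
  | i + 1 => X * topPart N v i + C (v.coeff (N - i))

theorem coeff_topPart (N : ℕ) (v : ℝ[X]) {i : ℕ} (hi : i ≤ N + 1) (j : ℕ) :
    (topPart N v i).coeff j = if j < i then v.coeff (N + 1 - i + j) else 0 := by
  induction i generalizing j with
  | zero => simp [topPart]
  | succ i ih =>
    rw [topPart, coeff_add]
    rcases j with _ | j
    · simp
    · rw [coeff_X_mul, ih (by omega), coeff_C_succ, add_zero,
        show N + 1 - (i + 1) + (j + 1) = N + 1 - i + j by omega]
      simp

theorem topPart_top {N : ℕ} {v : ℝ[X]} (hv : v.natDegree ≤ N) : topPart N v (N + 1) = v := by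
  ext j
  rw [coeff_topPart N v le_rfl]
  split_ifs with h
  · rw [Nat.sub_self, zero_add]
  · exact (coeff_eq_zero_of_natDegree_lt (by omega)).symm

theorem natDegree_topPart_le (N : ℕ) (v : ℝ[X]) {i : ℕ} (hi : i ≤ N + 1) :
    (topPart N v i).natDegree ≤ N := by
  rw [natDegree_le_iff_coeff_eq_zero]
  intro j hj
  rw [coeff_topPart N v hi, if_neg (by omega)]

/-- One step of the computation of the square. -/
def squareBody : Program :=
  assign 4 (.add (cell 4 0)
    (.mul (.read 3 (.sub (.add (.reg 0) (.lit 1)) (.reg 2))) (cell 3 1)))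

/-- Computes the polynomial to be factored. -/
def remainderProgram : Program :=
  .seq (forLoop 2 (.add (.reg 0) (.lit 1)) squareBody)
    (.seq (fill 5 0 (.sub (.lit 0) (cell 4 1)))
      (.setReal 5 (.reg 0) (.add (.read 5 (.reg 0)) (.lit 1))))

/-- The state of the computation of the square after `i` steps. -/
structure SquareState (N : ℕ) (v : ℝ[X]) (i : ℕ) (s : Mem) : Prop where
  le : i ≤ N + 1
  frame : Frame N 5 s
  counter : s.nat 2 = i
  parity : s.nat 5 = 0
  lift : s.arr 3 = entries v
  square : s.arr 4 = entries (topPart N v i * v)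

theorem short_topPart {N : ℕ} {v : ℝ[X]} (hv : v.natDegree ≤ N) {i : ℕ} (hi : i ≤ N + 1) :
    Short (2 * N + 1) (entries (topPart N v i * v)) := by
  refine short_entries (natDegree_mul_le.trans_lt ?_)
  have := natDegree_topPart_le N v hi
  omega

/-- `v²` is built by Horner's scheme in one factor: the accumulated product is shifted by one
position and a multiple of `v` is added, the coefficients being taken from index `N` downwards. -/
theorem halts_squareBody {N : ℕ} {v : ℝ[X]} (hv : v.natDegree ≤ N) {i : ℕ} (hi : i < N + 1)
    {s : Mem} (h : SquareState N v i s) :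
    Halts squareBody s (12 * N + 10) fun s' =>
      SquareState N v (i + 1) (s'.setNat 2 (s'.nat 2 + 1)) := by
  have hs := short_topPart hv (show i + 1 ≤ N + 1 by omega)
  have hfr := ((((h.frame.updateNat (x := 1) (by decide) (by decide) (2 * N + 1)).updateBuffer
    (by decide) hs).updateArr (a := 4) (by decide) (by decide)
      (entries (topPart N v (i + 1) * v)))).updateNat (x := 2) (by decide) (by decide) (i + 1)
  refine (Halts.assign (entries (topPart N v (i + 1) * v)) (by decide) h.frame.width h.frame.buffer
    (by rw [h.square]; exact short_topPart hv h.le) hs ?_ ?_).mono (by omega) fun _ => id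
  · intro k hk b
    have e1 : N + 1 - i = (N - i) + 1 := by omega
    simp [cell, RExp.eval, NExp.eval, h.square, h.lift, h.frame.bound, h.counter, e1, topPart,
      add_mul, mul_assoc, entries]
  · simp [Mem.setNat, h.counter]
    exact ⟨hi, hfr, by simp, by simp [h.parity], by simp [h.lift], by simp⟩

/-- The state before the computation of the roots. -/
structure RemainderState (N : ℕ) (v : ℝ[X]) (s : Mem) : Prop where
  frame : Frame N 6 s
  parity : s.nat 5 = 0
  lift : s.arr 3 = entries v
  remainder : s.arr 5 = (X ^ N - v * v).coeff

theorem halts_remainderProgram {N : ℕ} {v : ℝ[X]} (hv : v.natDegree ≤ N) {s : Mem}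
    (hf : Frame N 4 s) (h3 : s.arr 3 = entries v) (h5 : s.nat 5 = 0) :
    Halts remainderProgram s ((N + 1) * (12 * N + 12) + 6 * N + 8) (RemainderState N v) := by
  have hd : (-(v * v)).natDegree < 2 * N + 1 := by
    rw [natDegree_neg]
    exact natDegree_mul_le.trans_lt (by omega)
  refine (Halts.seq ((Halts.forLoop (T := 12 * N + 10) (M := N + 1)
    (I := SquareState N v) ?_ ?_ fun i hi s h => halts_squareBody hv hi h).mono le_rfl
    fun s' h' => Halts.seq (Halts.fill (-(v * v)).coeff h'.frame.width ?_ ?_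
      (Halts.setReal ?_)))).mono (by rw [Nat.add_assoc (12 * N)]; omega) fun _ => id
  · have hfr := (hf.mono (show 4 ≤ 5 by decide)).updateNat (x := 2) (by decide) (by decide) 0
    exact ⟨Nat.zero_le _, hfr, by simp [Mem.setNat], by simp [Mem.setNat, h5],
      by simp [Mem.setNat, h3], by simp [Mem.setNat, hf.fresh 4 le_rfl, topPart, entries_eq_zero]⟩
  · intro i s h
    exact ⟨h.counter, by simp [NExp.eval, h.frame.bound]⟩
  · intro k hk
    simp [cell, RExp.eval, NExp.eval, h'.square, topPart_top hv]
  · intro j hj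
    rw [h'.frame.fresh 5 le_rfl, coeff_eq_zero_of_natDegree_lt (by omega)]
    rfl
  -- Array `5` has no shift, since it is passed to the root instruction; `X ^ N` adds one at
  -- position `N`.
  · have hup : Function.update (-(v * v)).coeff N ((-(v * v)).coeff N + 1)
        = (X ^ N - v * v).coeff := by
      funext j
      rw [Function.update_apply, sub_eq_neg_add, coeff_add, coeff_X_pow]
      split_ifs <;> simp_all
    have hfr := ((h'.frame.mono (show 5 ≤ 6 by decide)).updateNat (x := 1) (by decide) (by decide)
      (2 * N + 1)).updateArr (a := 5) (by decide) (by decide) (X ^ N - v * v).coeff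
    simp only [Mem.setReal, RExp.eval, NExp.eval, h'.frame.bound, Function.update_self,
      Function.update_idem, Nat.cast_one, ne_eq, show ¬ (0 = 1) by decide, not_false_eq_true,
      Function.update_of_ne, hup]
    exact ⟨hfr, by simp [h'.parity], by simp [h'.lift], by simp⟩

/-! ## The roots -/

/-- Computes the roots; the list is filled up with the number `2`. -/
def rootProgram : Program :=
  .seq (fill 6 0 (.lit 2)) (.roots 5 (.add (.reg 0) (.reg 0)) 6 7)

/-- The list of the roots, filled up. -/
noncomputable def paddedRoots (N : ℕ) (c : ℕ → ℝ) : List ℂ :=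
  complexRoots c (2 * N) ++ List.replicate (2 * N - (complexRoots c (2 * N)).length) 2

/-- The state after the computation of the roots. -/
structure RootState (N : ℕ) (v : ℝ[X]) (s : Mem) : Prop where
  frame : Frame N 8 s
  parity : s.nat 5 = 0
  lift : s.arr 3 = entries v
  root : ∀ i < 2 * N,
    (paddedRoots N (X ^ N - v * v).coeff)[i]? = some ⟨s.arr 6 i, s.arr 7 i⟩

theorem natDegree_remainder_le {N : ℕ} {v : ℝ[X]} (hv : v.natDegree ≤ N) :
    (X ^ N - v * v).natDegree ≤ 2 * N := by
  refine (natDegree_sub_le _ _).trans (max_le ?_ (natDegree_mul_le.trans (by omega)))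
  rw [natDegree_X_pow]; omega

/-- The root instruction does not report how many roots it found. Positions it leaves untouched keep
the real part `2` and the imaginary part `0`, and read as the root `2`, which the selection rejects.
-/
theorem halts_rootProgram {N : ℕ} {v : ℝ[X]} {s : Mem}
    (h : RemainderState N v s) : Halts rootProgram s (8 * N + 6) (RootState N v) := by
  refine (Halts.seq (T' := 2 * N + 1) (Halts.fill (fun j => if j < 2 * N + 1 then 2 else 0)
    h.frame.width ?_ ?_ ⟨_, _, .roots _ _ _ _ _, ?_, ?_⟩)).mono (by omega) fun _ => id
  · intro k hk
    simp [RExp.eval, hk]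
  · intro j hj
    rw [h.frame.fresh 6 le_rfl, if_neg (by omega)]
    rfl
  · simp [NExp.eval, h.frame.bound]
    omega
  · have hfr := (h.frame.mono (show 6 ≤ 8 by decide)).updateNat (x := 1) (by decide) (by decide)
      (2 * N + 1)
    simp only [NExp.eval, Mem.setList, h.frame.bound, ← two_mul, h.remainder, ne_eq,
      show ¬ (0 = 1) by decide, show ¬ (5 = 6) by decide, not_false_eq_true, Function.update_of_ne,
      Function.update_self, Function.update_idem, show ¬ (7 = 6) by decide]
    refine ⟨(hfr.updateArr (a := 6) (by decide) (by decide) _).updateArr (a := 7) (by decide)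
      (by decide) _, by simp [h.parity], by simp [h.lift], fun i hi => ?_⟩
    rw [paddedRoots, complexRoots, List.length_map]
    simp only [Function.update_self, ne_eq, show ¬ (6 = 7) by decide, not_false_eq_true,
      Function.update_of_ne, h.frame.fresh 7 (by decide)]
    generalize rootList _ _ = l
    rcases Nat.lt_or_ge i l.length with hl | hl
    · rw [List.getElem?_append_left (by simpa using hl)]
      simp [List.getD_eq_getElem?_getD, hl]
    · rw [List.getElem?_append_right (by simpa using hl), List.getElem?_replicate]
      simp [List.getD_eq_getElem?_getD, hl, show i < 2 * N + 1 by omega]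
      refine ⟨by omega, by apply Complex.ext <;> simp⟩

end FlexQSP

namespace FlexQSP

open Polynomial

/-! ## The product of the selected factors -/

/-- The real parts of the coefficients of a polynomial as the entries `1, 2, …` of an array. -/
noncomputable def reEntries (P : ℂ[X]) (k : ℕ) : ℝ := ((X * P).coeff k).re

/-- The imaginary parts of the coefficients of a polynomial as the entries `1, 2, …` of an array. -/
noncomputable def imEntries (P : ℂ[X]) (k : ℕ) : ℝ := ((X * P).coeff k).im

theorem short_reEntries {m : ℕ} {P : ℂ[X]} (h : P.natDegree < m) : Short m (reEntries P) := by
  refine ⟨by simp [reEntries], fun j hj => ?_⟩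
  obtain ⟨k, rfl⟩ : ∃ k, j = k + 1 := ⟨j - 1, by omega⟩
  rw [reEntries, coeff_X_mul, coeff_eq_zero_of_natDegree_lt (by omega), Complex.zero_re]

theorem short_imEntries {m : ℕ} {P : ℂ[X]} (h : P.natDegree < m) : Short m (imEntries P) := by
  refine ⟨by simp [imEntries], fun j hj => ?_⟩
  obtain ⟨k, rfl⟩ : ∃ k, j = k + 1 := ⟨j - 1, by omega⟩
  rw [imEntries, coeff_X_mul, coeff_eq_zero_of_natDegree_lt (by omega), Complex.zero_im]

/-- The real part of the root under consideration. -/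
def rootRe : RExp := .read 6 (.reg 2)

/-- The imaginary part of the root under consideration. -/
def rootIm : RExp := .read 7 (.reg 2)

/-- Multiplication by a linear factor. -/
def mulFactor : Program :=
  .seq (fill 10 1 (.sub (cell 8 0) (.sub (.mul rootRe (cell 8 1)) (.mul rootIm (cell 9 1)))))
    (.seq (assign 9 (.sub (cell 9 0) (.add (.mul rootRe (cell 9 1)) (.mul rootIm (cell 8 1)))))
      (copy 10 8))

/-- Multiplication by the linear factor if the root is selected. -/
def selectBody : Program :=
  .ite (.realLt (.add (.mul rootRe rootRe) (.mul rootIm rootIm)) (.lit 1)) mulFactor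
    (.ite (.realLt (.lit 1) (.add (.mul rootRe rootRe) (.mul rootIm rootIm))) .skip
      (.ite (.natLt (.reg 5) (.lit 1)) (.seq mulFactor (.setNat 5 (.lit 1)))
        (.setNat 5 (.lit 0))))

/-- Computes the product of the linear factors of the selected roots. -/
def selectProgram : Program :=
  .seq (.setReal 8 (.lit 1) (.lit 1)) (forLoop 2 (.add (.reg 0) (.reg 0)) selectBody)

/-- The state of the multiplication: `P` is the current product. -/
structure FactorState (N : ℕ) (v : ℝ[X]) (L : List ℂ) (P : ℂ[X]) (i p : ℕ) (s : Mem) : Prop where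
  frame : Frame N 11 s
  counter : s.nat 2 = i
  parity : s.nat 5 = p
  lift : s.arr 3 = entries v
  root : ∀ i < 2 * N, L[i]? = some ⟨s.arr 6 i, s.arr 7 i⟩
  buffer : Short (2 * N + 1) (s.arr 10)
  re : s.arr 8 = reEntries P
  im : s.arr 9 = imEntries P

theorem FactorState.setParity {N : ℕ} {v : ℝ[X]} {L : List ℂ} {P : ℂ[X]} {i p : ℕ} {s : Mem}
    (h : FactorState N v L P i p s) (q : ℕ) : FactorState N v L P i q (s.setNat 5 q) :=
  { h with
    frame := h.frame.updateNat (by decide) (by decide) q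
    counter := by simp [Mem.setNat, h.counter]
    parity := by simp [Mem.setNat] }

theorem FactorState.setCounter {N : ℕ} {v : ℝ[X]} {L : List ℂ} {P : ℂ[X]} {i p : ℕ} {s : Mem}
    (h : FactorState N v L P i p s) (j : ℕ) : FactorState N v L P j p (s.setNat 2 j) :=
  { h with
    frame := h.frame.updateNat (by decide) (by decide) j
    counter := by simp [Mem.setNat]
    parity := by simp [Mem.setNat, h.parity] }

/-- Complex multiplication in real arithmetic. The new imaginary part still needs the old real part,
so the new real part waits in array `10`. -/
theorem halts_mulFactor {N : ℕ} {v : ℝ[X]} {L : List ℂ} {P : ℂ[X]} {i p : ℕ} {s : Mem}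
    (h : FactorState N v L P i p s) (hd : P.natDegree < 2 * N) {r : ℂ}
    (hr : r = ⟨s.arr 6 i, s.arr 7 i⟩) :
    Halts mulFactor s (24 * N + 20) (FactorState N v L ((X - C r) * P) i p) := by
  have hd' : ((X - C r) * P).natDegree < 2 * N + 1 := by
    refine natDegree_mul_le.trans_lt ?_
    rw [natDegree_X_sub_C]
    omega
  have hre := short_reEntries hd'
  have him := short_imEntries hd'
  have hcoef : ∀ k, ((X - C r) * P).coeff k = (X * P).coeff k - r * P.coeff k := fun k => by
    rw [sub_mul, coeff_sub, coeff_C_mul]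
  have hrr : s.arr 6 i = r.re := by rw [hr]
  have hri : s.arr 7 i = r.im := by rw [hr]
  have hfr := (((((h.frame.updateNat (x := 1) (by decide) (by decide) (2 * N + 1)).updateArr
    (a := 10) (by decide) (by decide) (reEntries ((X - C r) * P))).updateBuffer (by decide)
    him).updateArr (a := 9) (by decide) (by decide) (imEntries ((X - C r) * P))).updateArr
    (a := 8) (by decide) (by decide) (reEntries ((X - C r) * P)))
  refine (Halts.seq (Halts.fillOne (reEntries ((X - C r) * P)) h.frame.width h.buffer hre ?_
    (Halts.seq (Halts.assign (imEntries ((X - C r) * P)) (m := 2 * N + 1) (by decide) ?_ ?_ ?_ him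
      ?_ (Halts.copy (m := 2 * N + 1) (by decide) ?_ ?_ ?_ ?_))))).mono (by omega) fun _ => id
  · intro k hk
    simp [cell, rootRe, rootIm, RExp.eval, NExp.eval, h.re, h.im, h.counter, reEntries, imEntries,
      hcoef, hrr, hri]
  · simp [h.frame.width]
  · simpa using h.frame.buffer
  · simpa [h.im] using short_imEntries (show P.natDegree < 2 * N + 1 by omega)
  · intro k hk b
    simp [cell, rootRe, rootIm, RExp.eval, NExp.eval, h.re, h.im, h.counter, reEntries, imEntries,
      hcoef, hrr, hri]
  · simp [h.frame.width]
  · simpa [h.re] using short_reEntries (show P.natDegree < 2 * N + 1 by omega)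
  · simpa using hre
  · simp
    exact ⟨hfr, by simp [h.counter], by simp [h.parity], by simp [h.lift], by simpa using h.root,
      by simpa using hre, by simp, by simp⟩

/-- The state of the selection after `i` steps. -/
structure SelectState (N : ℕ) (v : ℝ[X]) (L : List ℂ) (i : ℕ) (s : Mem) : Prop where
  counter : s.nat 2 = i
  width : s.nat 0 = N
  product : ∃ P p, FactorState N v L P i p s ∧ P.natDegree ≤ i ∧
    P * ((selectRoots p (L.drop i)).map fun a => X - C a).prod
      = ((selectRoots 0 L).map fun a => X - C a).prod

/-- The invariant says that the current product times the factors still to be selected equals the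
final product; the parity register carries the state of `selectRoots`. -/
theorem halts_selectBody {N : ℕ} {v : ℝ[X]} {L : List ℂ} {i : ℕ} (hi : i < 2 * N) {s : Mem}
    (h : SelectState N v L i s) :
    Halts selectBody s (24 * N + 24) fun s' =>
      SelectState N v L (i + 1) (s'.setNat 2 (s'.nat 2 + 1)) := by
  obtain ⟨P, p, hP, hd, hprod⟩ := h.product
  have hroot := hP.root i hi
  obtain ⟨r, hr⟩ : ∃ r : ℂ, r = ⟨s.arr 6 i, s.arr 7 i⟩ := ⟨_, rfl⟩
  rw [← hr] at hroot
  obtain ⟨hil, hLr⟩ := List.getElem?_eq_some_iff.mp hroot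
  rw [List.drop_eq_getElem_cons hil, hLr, selectRoots] at hprod
  have hfinal : ∀ {P' p' s'}, FactorState N v L P' i p' s' → P'.natDegree ≤ i + 1 →
      P' * ((selectRoots p' (L.drop (i + 1))).map fun a => X - C a).prod
        = ((selectRoots 0 L).map fun a => X - C a).prod →
      SelectState N v L (i + 1) (s'.setNat 2 (s'.nat 2 + 1)) := by
    intro P' p' s' h1 h2 h3
    have h4 := h1.setCounter (i + 1)
    rw [← h1.counter] at h4
    rw [h1.counter] at h4 ⊢
    exact ⟨h4.counter, h4.frame.bound, P', p', h4, h2, h3⟩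
  have hnorm : Complex.normSq r = s.arr 6 i * s.arr 6 i + s.arr 7 i * s.arr 7 i := by
    rw [hr, Complex.normSq_mk]
  have hmul := halts_mulFactor hP (hd.trans_lt hi) hr
  have hd' : ((X - C r) * P).natDegree ≤ i + 1 := by
    refine natDegree_mul_le.trans ?_
    rw [natDegree_X_sub_C]
    omega
  refine (Halts.ite (T := 24 * N + 23) (fun h1 => ?_) (fun h1 => Halts.ite (T := 24 * N + 22)
    (fun h2 => ?_) (fun h2 => Halts.ite (T := 24 * N + 21) (fun h3 => ?_) (fun h3 => ?_))))
  all_goals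
    simp only [Test.Holds, RExp.eval, NExp.eval, rootRe, rootIm, hP.counter, ← hnorm,
      Nat.cast_one] at h1
  · rw [if_pos h1, List.map_cons, List.prod_cons] at hprod
    exact hmul.mono (by omega) fun s' hs' => hfinal hs' hd' (by rw [← hprod]; ring)
  all_goals
    simp only [Test.Holds, RExp.eval, NExp.eval, rootRe, rootIm, hP.counter, ← hnorm,
      Nat.cast_one] at h2
  · rw [if_neg h1, if_pos h2] at hprod
    exact ⟨1, s, .skip s, by omega, hfinal hP (by omega) hprod⟩
  all_goals simp only [Test.Holds, NExp.eval, hP.parity] at h3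
  · rw [if_neg h1, if_neg h2, if_pos h3, List.map_cons, List.prod_cons] at hprod
    exact Halts.seq (T := 24 * N + 20) (T' := 1) (hmul.mono le_rfl fun s' hs' => Halts.setNat
      (hfinal (hs'.setParity 1) hd' (by rw [← hprod]; ring)))
  · rw [if_neg h1, if_neg h2, if_neg h3] at hprod
    exact (Halts.setNat (hfinal (hP.setParity 0) (by omega) hprod)).mono (by omega) fun _ => id

theorem halts_selectProgram {N : ℕ} {v : ℝ[X]} {L : List ℂ} (hL : L.length = 2 * N)
    {s : Mem} (hf : Frame N 8 s) (h5 : s.nat 5 = 0) (h3 : s.arr 3 = entries v)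
    (hroot : ∀ i < 2 * N, L[i]? = some ⟨s.arr 6 i, s.arr 7 i⟩) :
    Halts selectProgram s (2 * N * (24 * N + 26) + 3) fun s' => Frame N 11 s' ∧
      s'.arr 3 = entries v ∧ s'.arr 8 = reEntries ((selectRoots 0 L).map fun a => X - C a).prod := by
  refine (Halts.seq (Halts.setReal ((Halts.forLoop (T := 24 * N + 24) (M := 2 * N)
    (I := SelectState N v L) ?_ ?_ fun i hi s h => halts_selectBody hi h).mono le_rfl ?_))).mono
    (by rw [Nat.add_assoc (24 * N)]; omega) fun _ => id
  · have hfr := ((hf.mono (show 8 ≤ 11 by decide)).updateArr (a := 8) (by decide) (by decide)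
      (reEntries 1)).updateNat (x := 2) (by decide) (by decide) 0
    -- The initial product is the constant `1`, stored at position `1`; its imaginary part is the
    -- fresh zero array `9`.
    have hre : Function.update (0 : ℕ → ℝ) 1 1 = reEntries 1 := by
      funext j
      rw [Function.update_apply, reEntries, mul_one, coeff_X]
      by_cases hj : j = 1 <;> simp [hj, eq_comm]
    have him : (0 : ℕ → ℝ) = imEntries 1 := by
      funext j
      rw [imEntries, mul_one, coeff_X]
      split_ifs <;> simp
    simp only [Mem.setReal, Mem.setNat, RExp.eval, NExp.eval, Nat.cast_one, hf.fresh 8 le_rfl, hre]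
    refine ⟨by simp, by simp [hf.bound], 1, 0, ⟨hfr, by simp, by simp [h5], by simp [h3],
      by simpa using hroot, ?_, by simp, ?_⟩, by simp, by simp⟩
    · simpa [hf.fresh 10 (by decide)] using short_zero _
    · simpa [hf.fresh 9 (by decide)] using him
  · intro i s h
    exact ⟨h.counter, by simp [NExp.eval, h.width]; omega⟩
  · rintro s' ⟨-, -, P, p, hP, -, hprod⟩
    rw [List.drop_eq_nil_of_le hL.le, selectRoots, List.map_nil, List.prod_nil, mul_one] at hprod
    exact ⟨hP.frame, hP.lift, by rw [hP.re, hprod]⟩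

/-! ## Normalization -/

/-- Divides the product by its value at `-1`, up to a sign. -/
def normalizeProgram : Program :=
  .seq (forLoop 2 (.add (.reg 0) (.lit 1))
      (.setReal 11 (.lit 0) (.sub (.read 8 (.add (.reg 2) (.lit 1))) (.read 11 (.lit 0)))))
    (fill 12 1 (.div (cell 8 1) (.read 11 (.lit 0))))

/-- The state of the evaluation at `-1` after `i` steps. -/
structure NormalizeState (N : ℕ) (v w : ℝ[X]) (i : ℕ) (s : Mem) : Prop where
  frame : Frame N 12 s
  counter : s.nat 2 = i
  lift : s.arr 3 = entries v
  factor : s.arr 8 = entries w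
  value : s.arr 11 0 = -(-1) ^ i * ∑ j ∈ Finset.range i, w.coeff j * (-1) ^ j

/-- The state before the computation of the angles. -/
structure PairState (N : ℕ) (v w : ℝ[X]) (s : Mem) : Prop where
  frame : Frame N 13 s
  left : s.arr 3 = entries v
  right : s.arr 12 = entries w

/-- The update `e ↦ w_i - e` evaluates the alternating coefficient sum with an overall sign that
depends on the step. The final value is `±w(-1)`, and the sign is immaterial. -/
theorem halts_normalizeProgram {N : ℕ} {v w : ℝ[X]} (hw : w.natDegree ≤ N) {s : Mem}
    (hf : Frame N 11 s) (h3 : s.arr 3 = entries v) (h8 : s.arr 8 = entries w) :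
    Halts normalizeProgram s ((N + 1) * 3 + 6 * N + 7) fun s' =>
      ∃ e : ℝ, e ^ 2 = w.eval (-1) ^ 2 ∧ PairState N v (C e⁻¹ * w) s' := by
  refine (Halts.seq ((Halts.forLoop (T := 1) (M := N + 1)
    (I := NormalizeState N v w) ?_ ?_ fun i hi s h => Halts.setReal ?_).mono le_rfl
    fun s' h' => ?_)).mono (T := (N + 1) * 3 + 2 + (6 * N + 5)) (by omega) fun _ => id
  · refine ⟨(hf.mono (by decide)).updateNat (by decide) (by decide) 0, by simp [Mem.setNat],
      by simp [Mem.setNat, h3], by simp [Mem.setNat, h8], ?_⟩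
    simp [Mem.setNat, hf.fresh 11 le_rfl]
  · intro i s h
    exact ⟨h.counter, by simp [NExp.eval, h.frame.bound]⟩
  · have hfr := fun g => (h.frame.updateArr (a := 11) (by decide) (by decide) g).updateNat (x := 2)
      (by decide) (by decide) (i + 1)
    simp only [Mem.setReal, Mem.setNat, h.counter]
    refine ⟨hfr _, by simp, by simp [h.lift], by simp [h.factor], ?_⟩
    simp only [NExp.eval, RExp.eval, h.value, h.factor, h.counter, Function.update_self,
      entries_succ, Finset.sum_range_succ, pow_succ]
    have : ((-1 : ℝ) ^ i) * (-1) ^ i = 1 := by rw [← pow_add, Even.neg_one_pow ⟨i, rfl⟩]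
    linear_combination (-w.coeff i) * this
  · have hval : s'.arr 11 0 = -(-1) ^ (N + 1) * w.eval (-1) := by
      rw [h'.value, eval_eq_sum_range' (Nat.lt_succ_of_le hw)]
    refine (Halts.fillOne (entries (C (s'.arr 11 0)⁻¹ * w)) h'.frame.width ?_ ?_ ?_ ?_).mono
      (by omega) fun _ => id
    · rw [h'.frame.fresh 12 le_rfl]
      exact short_zero _
    · exact short_entries ((natDegree_C_mul_le _ _).trans_lt (by omega))
    · intro k hk
      simp [cell, RExp.eval, NExp.eval, h'.factor]
      ring
    · refine ⟨s'.arr 11 0, ?_, ?_, by simp [h'.lift], by simp⟩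
      · rw [hval, mul_pow, neg_sq, ← pow_mul, mul_comm, Even.neg_one_pow ⟨N + 1, by omega⟩, mul_one]
      · exact ((h'.frame.mono (show 12 ≤ 13 by decide)).updateNat (by decide) (by decide)
          _).updateArr (by decide) (by decide) _

end FlexQSP

namespace FlexQSP

open Polynomial

/-! ## The program for the angles -/

/-- A sum of two squares. -/
def sumSq (e f : RExp) : RExp := .add (.mul e e) (.mul f f)

/-- The value of `e / √(e² + f²)`. -/
def normalized (a e f : RExp) : RExp := .div a (.sqrt (sumSq e f))

/-- Computes the direction of the next angle. -/
def directionProgram : Program :=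
  .ite (.realLt (.lit 0) (sumSq (.read 3 (.lit 1)) (.read 12 (.lit 1))))
    (.seq (.setReal 13 (.lit 0)
        (normalized (.read 3 (.lit 1)) (.read 3 (.lit 1)) (.read 12 (.lit 1))))
      (.setReal 13 (.lit 1)
        (normalized (.read 12 (.lit 1)) (.read 3 (.lit 1)) (.read 12 (.lit 1)))))
    (.ite (.realLt (.lit 0) (sumSq (.read 3 (.sub (.add (.reg 0) (.lit 1)) (.reg 2)))
        (.read 12 (.sub (.add (.reg 0) (.lit 1)) (.reg 2)))))
      (.seq (.setReal 13 (.lit 0)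
          (normalized (.read 12 (.sub (.add (.reg 0) (.lit 1)) (.reg 2)))
            (.read 3 (.sub (.add (.reg 0) (.lit 1)) (.reg 2)))
            (.read 12 (.sub (.add (.reg 0) (.lit 1)) (.reg 2)))))
        (.setReal 13 (.lit 1)
          (normalized (.sub (.lit 0) (.read 3 (.sub (.add (.reg 0) (.lit 1)) (.reg 2))))
            (.read 3 (.sub (.add (.reg 0) (.lit 1)) (.reg 2)))
            (.read 12 (.sub (.add (.reg 0) (.lit 1)) (.reg 2))))))
      (.seq (.setReal 13 (.lit 0) (.lit 1)) (.setReal 13 (.lit 1) (.lit 0))))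

/-- Computes the next angle. -/
def angleProgram : Program :=
  .seq (.ite (.realLt (.read 13 (.lit 1)) (.lit 0))
      (.setReal 1 (.add (.reg 2) (.reg 2)) (.sub (.lit 0) (.arccos (.read 13 (.lit 0)))))
      (.setReal 1 (.add (.reg 2) (.reg 2)) (.arccos (.read 13 (.lit 0)))))
    (.setReal 1 (.add (.add (.reg 2) (.reg 2)) (.lit 1))
      (.sub (.lit 0) (.read 1 (.add (.reg 2) (.reg 2)))))

/-- Removes the next angle. -/
def peelStep : Program :=
  .seq (fill 2 1 (.sub (.mul (.read 13 (.lit 1)) (cell 3 2)) (.mul (.read 13 (.lit 0)) (cell 12 2))))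
    (.seq (fill 12 1
        (.add (.mul (.read 13 (.lit 0)) (cell 3 1)) (.mul (.read 13 (.lit 1)) (cell 12 1))))
      (copy 2 3))

/-- Computes the angles from the pair of polynomials. -/
def peelProgram : Program :=
  forLoop 2 (.add (.reg 0) (.lit 1)) (.seq directionProgram (.seq angleProgram peelStep))

/-- The state of the computation of the angles after `i` steps, for the current pair `p`. -/
structure PeelState (N i : ℕ) (ψ : ℕ → ℝ) (p : ℝ[X] × ℝ[X]) (s : Mem) : Prop where
  bound : s.nat 0 = N
  width : s.nat 4 = 2 * N + 1
  counter : s.nat 2 = i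
  buffer : Short (2 * N + 1) (s.arr 2)
  left : s.arr 3 = entries p.1
  right : s.arr 12 = entries p.2
  even : ∀ k < i, s.arr 1 (2 * k) = ψ k
  odd : ∀ k, s.arr 1 (2 * k + 1) = -s.arr 1 (2 * k)

theorem natDegree_peel_le {n M : ℕ} {v w : ℝ[X]} (hv : v.natDegree ≤ M) (hw : w.natDegree ≤ M) :
    (peel n v w).1.natDegree ≤ M ∧ (peel n v w).2.natDegree ≤ M := by
  constructor
  · refine (natDegree_sub_le _ _).trans (max_le ((natDegree_C_mul_le _ _).trans ?_)
      ((natDegree_C_mul_le _ _).trans ?_)) <;>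
    · rw [natDegree_divX_eq_natDegree_tsub_one]
      omega
  · exact (natDegree_add_le _ _).trans (max_le ((natDegree_C_mul_le _ _).trans hv)
      ((natDegree_C_mul_le _ _).trans hw))

theorem natDegree_peelSeq_le {N : ℕ} {v w : ℝ[X]} (hv : v.natDegree ≤ N) (hw : w.natDegree ≤ N)
    (k : ℕ) : (peelSeq N v w k).1.natDegree ≤ N ∧ (peelSeq N v w k).2.natDegree ≤ N := by
  induction k with
  | zero => exact ⟨hv, hw⟩
  | succ k ih => exact natDegree_peel_le ih.1 ih.2

theorem halts_directionProgram {N i : ℕ} (hi : i ≤ N) {ψ : ℕ → ℝ} {p : ℝ[X] × ℝ[X]} {s : Mem}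
    (h : PeelState N i ψ p s) : Halts directionProgram s 4 fun s' =>
      PeelState N i ψ p s' ∧ s'.arr 13 0 = (direction (N - i) p.1 p.2).1 ∧
        s'.arr 13 1 = (direction (N - i) p.1 p.2).2 := by
  -- Because of the shifted storage the coefficient of index `N - i` stands at position `N + 1 - i`.
  have hsub : N + 1 - i = (N - i) + 1 := by omega
  have hset : ∀ g, PeelState N i ψ p ⟨s.nat, Function.update s.arr 13 g⟩ := fun g =>
    ⟨h.bound, h.width, h.counter, by simpa using h.buffer, by simpa using h.left,
      by simpa using h.right, by simpa using h.even, by simpa using h.odd⟩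
  have h31 : s.arr 3 1 = p.1.coeff 0 := by rw [h.left]; exact entries_succ _ 0
  have h121 : s.arr 12 1 = p.2.coeff 0 := by rw [h.right]; exact entries_succ _ 0
  have h3n : s.arr 3 (N + 1 - i) = p.1.coeff (N - i) := by rw [h.left, hsub, entries_succ]
  have h12n : s.arr 12 (N + 1 - i) = p.2.coeff (N - i) := by rw [h.right, hsub, entries_succ]
  rw [direction]
  refine Halts.ite (T := 3) (fun h1 => (Halts.seq (Halts.setReal (Halts.setReal ?_))).mono
    (by omega) fun _ => id) fun h1 => Halts.ite (T := 2)
    (fun h2 => Halts.seq (Halts.setReal (Halts.setReal ?_))) fun h2 =>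
      Halts.seq (Halts.setReal (Halts.setReal ?_))
  all_goals simp only [Test.Holds, sumSq, RExp.eval, NExp.eval, Nat.cast_zero, h31, h121] at h1
  · rw [if_pos h1]
    simp only [Mem.setReal, Function.update_idem, Function.update_self]
    refine ⟨hset _, ?_, ?_⟩ <;>
    simp [normalized, sumSq, RExp.eval, NExp.eval, h31, h121]
  all_goals
    simp only [Test.Holds, sumSq, RExp.eval, NExp.eval, Nat.cast_zero, h.bound, h.counter, h3n,
      h12n] at h2
  · rw [if_neg h1, if_pos h2]
    simp only [Mem.setReal, Function.update_idem, Function.update_self]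
    refine ⟨hset _, ?_, ?_⟩ <;>
    simp [normalized, sumSq, RExp.eval, NExp.eval, h.bound, h.counter, h3n, h12n]
  · rw [if_neg h1, if_neg h2]
    simp only [Mem.setReal, Function.update_idem, Function.update_self]
    refine ⟨hset _, ?_, ?_⟩ <;>
    simp [RExp.eval, NExp.eval]

theorem halts_angleProgram {N i : ℕ} {ψ : ℕ → ℝ} {p : ℝ[X] × ℝ[X]} {s : Mem}
    (h : PeelState N i ψ p s) (hψ : ψ i = angle (s.arr 13 0) (s.arr 13 1)) :
    Halts angleProgram s 3 fun s' => (∀ k < i + 1, s'.arr 1 (2 * k) = ψ k) ∧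
      PeelState N i ψ p s' ∧ s'.arr 13 = s.arr 13 := by
  refine Halts.seq (T := 2) (T' := 1) ((Halts.ite (T := 1) (Q := fun s' => s' =
    ⟨s.nat, Function.update s.arr 1 (Function.update (s.arr 1) (i + i) (ψ i))⟩)
    (fun h1 => Halts.setReal ?_) (fun h1 => Halts.setReal ?_)).mono le_rfl ?_)
  · simp only [Test.Holds, RExp.eval, NExp.eval, Nat.cast_zero] at h1
    simp only [Mem.setReal, RExp.eval, NExp.eval, Nat.cast_zero, h.counter, hψ, angle, if_pos h1]
  · simp only [Test.Holds, RExp.eval, NExp.eval, Nat.cast_zero] at h1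
    simp only [Mem.setReal, RExp.eval, NExp.eval, h.counter, hψ, angle, if_neg h1]
  · rintro _ rfl
    refine Halts.setReal ?_
    simp only [Mem.setReal, RExp.eval, NExp.eval, h.counter, Nat.cast_zero, zero_sub,
      Function.update_idem, Function.update_self]
    -- Positions `2i` and `2i + 1` receive `ψ i` and `-ψ i`, the phases of the two flag sectors;
    -- earlier entries survive.
    have heven : ∀ k < i + 1, Function.update (Function.update (s.arr 1) (i + i) (ψ i)) (i + i + 1)
        (-ψ i) (2 * k) = ψ k := by
      intro k hk
      rw [Function.update_of_ne (by omega)]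
      rcases Nat.lt_or_ge k i with hk' | hk'
      · rw [Function.update_of_ne (by omega), h.even k hk']
      · obtain rfl : k = i := by omega
        rw [two_mul, Function.update_self]
    refine ⟨by simpa using heven, ⟨h.bound, h.width, h.counter, by simpa using h.buffer,
      by simpa using h.left, by simpa using h.right, ?_, ?_⟩, by simp⟩
    · simpa using fun k hk => heven k (Nat.lt_succ_of_lt hk)
    · intro k
      simp only [Function.update_self]
      by_cases hk : k = i
      · rw [heven k (by omega), hk, two_mul, Function.update_self]
      · rw [Function.update_of_ne (by omega), Function.update_of_ne (by omega),
          Function.update_of_ne (by omega), Function.update_of_ne (by omega), h.odd]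

/-- The old first polynomial is needed for both new ones, so its successor is parked in array `2`.
Array `12` may be overwritten in place because only its current entry is read. -/
theorem halts_peelStep {N i : ℕ} {ψ : ℕ → ℝ} {p : ℝ[X] × ℝ[X]}
    (hp1 : p.1.natDegree ≤ N) (hp2 : p.2.natDegree ≤ N) {s : Mem} (h : PeelState N i ψ p s)
    (heven : ∀ k < i + 1, s.arr 1 (2 * k) = ψ k) {n : ℕ}
    (hc : s.arr 13 0 = (direction n p.1 p.2).1) (hs : s.arr 13 1 = (direction n p.1 p.2).2) :
    Halts peelStep s (18 * N + 15) fun s' =>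
      PeelState N (i + 1) ψ (peel n p.1 p.2) (s'.setNat 2 (s'.nat 2 + 1)) := by
  obtain ⟨hd1, hd2⟩ := natDegree_peel_le (n := n) hp1 hp2
  have h1 : Short (2 * N + 1) (entries (peel n p.1 p.2).1) := short_entries (by omega)
  have h2 : Short (2 * N + 1) (entries (peel n p.1 p.2).2) := short_entries (by omega)
  refine (Halts.seq (Halts.fillOne (entries (peel n p.1 p.2).1) h.width h.buffer h1 ?_
    (Halts.seq (Halts.fillOne (entries (peel n p.1 p.2).2) (m := 2 * N + 1) ?_ ?_ h2 ?_
      (Halts.copy (m := 2 * N + 1) (by decide) ?_ ?_ ?_ ?_))))).mono (by omega) fun _ => id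
  · intro k hk
    simp [cell, RExp.eval, NExp.eval, h.left, h.right, hc, hs, peel]
  · simp [h.width]
  · simpa [h.right] using short_entries (show p.2.natDegree < 2 * N + 1 by omega)
  · intro k hk
    simp [cell, RExp.eval, NExp.eval, h.left, h.right, hc, hs, peel]
  · simp [h.width]
  · simpa [h.left] using short_entries (show p.1.natDegree < 2 * N + 1 by omega)
  · simpa using h1
  · simp [Mem.setNat]
    exact ⟨by simp [h.bound], by simp [h.width], by simp [h.counter], by simpa using h1, by simp,
      by simp, by simpa using heven, by simpa using h.odd⟩

theorem halts_peelProgram {N : ℕ} {v w : ℝ[X]} (hv : v.natDegree ≤ N) (hw : w.natDegree ≤ N)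
    {s : Mem} (h : PairState N v w s) :
    Halts peelProgram s ((N + 1) * (18 * N + 24) + 2) fun s' =>
      (∀ k ≤ N, s'.arr 1 (2 * k) = angleSeq N v w k) ∧
        ∀ k, s'.arr 1 (2 * k + 1) = -s'.arr 1 (2 * k) := by
  refine (Halts.forLoop (T := 18 * N + 22) (M := N + 1)
    (I := fun i => PeelState N i (angleSeq N v w) (peelSeq N v w i)) ?_ ?_
    fun i hi s h => ?_).mono le_rfl fun s' hs' =>
      ⟨fun k hk => hs'.even k (Nat.lt_succ_of_le hk), hs'.odd⟩
  · exact ⟨by simp [Mem.setNat, h.frame.bound], by simp [Mem.setNat, h.frame.width],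
      by simp [Mem.setNat], h.frame.buffer, h.left, h.right, fun k hk => absurd hk (Nat.not_lt_zero k),
      fun k => by simp [Mem.setNat, h.frame.output]⟩
  · intro i s h
    exact ⟨h.counter, by simp [NExp.eval, h.bound]⟩
  · obtain ⟨hd1, hd2⟩ := natDegree_peelSeq_le hv hw i
    refine (Halts.seq ((halts_directionProgram (by omega) h).mono le_rfl fun s1 hs1 =>
      Halts.seq ((halts_angleProgram hs1.1 (by rw [hs1.2.1, hs1.2.2]; rfl)).mono le_rfl
        fun s2 hs2 => halts_peelStep hd1 hd2 hs2.2.1 hs2.1 (by rw [hs2.2.2]; exact hs1.2.1)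
          (by rw [hs2.2.2]; exact hs1.2.2)))).mono (by omega) fun _ => id

/-- Computes the angles from the coefficients. -/
def anglesProgram : Program :=
  .seq (.setNat 4 (.add (.add (.reg 0) (.reg 0)) (.lit 1)))
    (.seq hornerProgram (.seq remainderProgram (.seq rootProgram (.seq selectProgram
      (.seq normalizeProgram peelProgram)))))

/-- Composition of the stages. The factor computed from the padded root list is the one provided by
`exists_normOne`, so the pair is norm-one and its peeled angles reproduce the lift of `B`. -/
theorem halts_anglesProgram {N : ℕ} {B : ℝ[X]} (hB : Admissible N B) :
    Halts anglesProgram (input N B) (200 * (N + 1) ^ 2) fun s =>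
      (∀ k, s.output (2 * k + 1) = -s.output (2 * k)) ∧
        IsLift N B (phasePoly (fun k => s.output (2 * k)) 0 N).1 := by
  have hv := natDegree_hornerLift_le N B N
  obtain ⟨w, hw, hwd, hnorm⟩ := exists_normOne hB (c := (X ^ N - hornerLift N B N
    * hornerLift N B N).coeff) fun _ _ => rfl
  have hlen : (complexRoots (X ^ N - hornerLift N B N * hornerLift N B N).coeff (2 * N)).length
      ≤ 2 * N := by
    rw [complexRoots, List.length_map]
    exact length_rootList_le (natDegree_remainder_le hv) fun _ _ => rfl
  have hsel : selectRoots 0 (paddedRoots N (X ^ N - hornerLift N B N * hornerLift N B N).coeff)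
      = selectRoots 0 (complexRoots (X ^ N - hornerLift N B N * hornerLift N B N).coeff (2 * N)) := by
    rw [paddedRoots]
    refine selectRoots_append _ _ (fun r hr => ?_) 0
    rw [List.eq_of_mem_replicate hr]
    norm_num [Complex.normSq_ofNat]
  refine (Halts.seq (Halts.setNat (Halts.seq ((halts_hornerProgram (N := N) (B := B)
    ⟨?_, ?_, ?_, ?_, ?_⟩ ?_ ?_ ?_).mono le_rfl fun s1 h1 =>
    Halts.seq ((halts_remainderProgram hv h1.frame h1.lift h1.parity).mono le_rfl fun s2 h2 =>
    Halts.seq ((halts_rootProgram h2).mono le_rfl fun s3 h3 =>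
    Halts.seq ((halts_selectProgram ?_ h3.frame h3.parity h3.lift h3.root).mono le_rfl fun s4 h4 =>
    Halts.seq ((halts_normalizeProgram hwd h4.1 h4.2.1 ?_).mono le_rfl ?_)))))))).mono
    (T := 1 + (N * (12 * N + 15) + 3 + ((N + 1) * (12 * N + 12) + 6 * N + 8 + (8 * N + 6
      + (2 * N * (24 * N + 26) + 3 + ((N + 1) * 3 + 6 * N + 7
      + ((N + 1) * (18 * N + 24) + 2))))))) ?_ fun _ => id
  · simp [Mem.setNat, input]
  · simp [Mem.setNat, input, NExp.eval]; omega
  · rfl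
  · exact short_zero _
  · intro a ha
    funext j
    simp [Mem.setNat, input, show a ≠ 0 by omega]
  · funext j
    simp [Mem.setNat, input]
  · simp [Mem.setNat, input]
  · simp [Mem.setNat, input]
  · rw [paddedRoots, List.length_append, List.length_replicate]
    omega
  · rw [h4.2.2, hsel, ← hw]
    funext j
    rcases j with _ | j <;> simp [reEntries]
  · rintro s5 ⟨e, he, h5⟩
    refine (halts_peelProgram hv (hnorm e he).right h5).mono le_rfl fun s6 h6 => ⟨h6.2, ?_⟩
    rw [phasePoly_angleSeq (ψ := fun k => s6.output (2 * k)) (hnorm e he) h6.1]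
    exact isLift_hornerLift hB
  -- Every stage takes quadratically many steps at most; `200 (N + 1)²` bounds the sum.
  · ring_nf
    omega

end FlexQSP

/-- There are an absolute constant `C`, one classical program with a polynomial time bound, and
circuit layouts depending on `N` and `d` only, such that the angles that the program computes from
the coefficients of `B` turn the layout into a circuit for a signal unitary `V` that encodes
`B[H]`. -/
theorem mainTheorem3 :
    ∃ (C : ℝ) (time : Polynomial ℕ) (P : FlexQSP.Program)
      (K : ∀ _ d : ℕ, FlexQSP.Circuit (Nat.clog 2 d)),
      (∀ N d : ℕ, 1 ≤ N → 1 ≤ d →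
        ((K N d).queries : ℝ) ≤ C * N ∧ ((K N d).gates : ℝ) ≤ C * N * Real.log (2 * d)) ∧
      ∀ (N : ℕ) (B : Polynomial ℝ), 1 ≤ N → FlexQSP.Admissible N B →
        ∃ (t : ℕ) (s : FlexQSP.Mem),
          FlexQSP.Exec P (FlexQSP.input N B) t s ∧ t ≤ time.eval N ∧
          ∀ (n d : ℕ) [NeZero d] (H : Matrix (Fin n) (Fin n) ℂ)
            (U : Matrix (Fin d × Fin n) (Fin d × Fin n) ℂ),
            FlexQSP.HermitianStandardForm H 1 U →
            ∃ V : Matrix (Fin (4 * d) × Fin n) (Fin (4 * d) × Fin n) ℂ,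
              FlexQSP.HermitianStandardForm
                (∑ j ∈ Finset.range (N + 1), (B.coeff j : ℂ) • H ^ j) 1 V ∧
              (K N d).Implements s.output U V := by
  -- `4416 = 3 * 1472` combines the gate count with `clog_add_one_le`. The program and its run are
  -- fixed before `n`, `d`, `H` and `U` are introduced.
  refine ⟨4416, 200 * (Polynomial.X + 1) ^ 2, FlexQSP.anglesProgram,
    fun N d => FlexQSP.layout N d, fun N d => FlexQSP.layout_size, fun N B _ hB => ?_⟩
  obtain ⟨t, s, he, ht, hneg, hlift⟩ := FlexQSP.halts_anglesProgram hB
  refine ⟨t, s, he, by simpa using ht, fun n d _ H U hU => ?_⟩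
  exact FlexQSP.exists_hermitianStandardForm hB.degree (FlexQSP.signalPoly_add_eq hneg hlift) hU
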